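/- Conventions. Bits are elements of $\mathbb{F}_2$; $\mathrm{wt}$ is Hamming weight; $n^{\varepsilon}$ stands for $\lfloor n^{\varepsilon}\rfloor$ wherever an integer is needed. $\mathrm{Ber}(n,\eta)$ is the distribution of $n$ independent bits that are $1$ with probability $\eta$. A function of $n$ is negligible if it is $O(n^{-c})$ for every $c$. Polynomial time is understood non-uniformly: a polynomial-time randomized (oracle) algorithm is a family of probabilistic circuits over $\{1,\oplus,\wedge\}$, with independent coins of arbitrary fixed bias and with oracle gates (each call answered with fresh randomness), of size polynomial in the security parameter and the input length. Public-key PRC. A zero-bit public-key pseudorandom code (PRC) over $\{0,1\}$ with block length $n$ and security parameter $n$ consists of polynomial-time randomized algorithms $\mathsf{KeyGen}$, $\mathsf{Encode}$, $\mathsf{Decode}$, where $\mathsf{KeyGen}(1^n)$ outputs $(\mathsf{sk},\mathsf{pk})$, $\mathsf{Encode}(1^n,\mathsf{pk})$ outputs a string in $\{0,1\}^n$ (an encoding of the only message, $1$) and $\mathsf{Decode}(1^n,\mathsf{sk},x)\in\{1,\bot\}$ for $x\in\{0,1\}^*$. It is robust to a channel (randomized map) $\mathcal{E}:\{0,1\}^*\to\{0,1\}^*$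 if $\Pr[\mathsf{Decode}(\mathsf{sk},\mathcal{E}(\mathsf{Encode}(\mathsf{pk})))=1]\ge 1-\mathrm{negl}(n)$. It is sound if $\Pr[\mathsf{Decode}(\mathsf{sk},c)=\bot]\ge 1-\mathrm{negl}(n)$ for all $c\in\{0,1\}^*$, with one negligible function for all $c$. It is pseudorandom if for every polynomial-time adversary $\mathcal{A}$, $$\bigl|\Pr[\mathcal{A}^{\mathsf{Encode}(\mathsf{pk})}(1^n,\mathsf{pk})=1]-\Pr[\mathcal{A}^{\mathcal{U}}(1^n,\mathsf{pk})=1]\bigr|$$ is negligible, where $\mathcal{U}$ answers every query with a fresh uniform string in $\{0,1\}^n$. It is a PRC robust to $\mathcal{E}$ if all of this holds. A length-preserving channel $\mathcal{E}$ (not necessarily efficient) is $p$-bounded if $\Pr_{x\gets\{0,1\}^n}[\mathrm{wt}(\mathcal{E}(x)\oplus x)>pn]$ is at most a negligible function of $n$. The code. $\mathsf{LDPC\text{-}PRC}_0[n,g,t,r,\eta,\zeta]$ is the following scheme. * $\mathsf{KeyGen}$: sample $P\in\mathbb{F}_2^{r\times n}$ with independent uniform rows of weight $t$, then $G\in\mathbb{F}_2^{n\times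 g}$ uniform subject to $PG=0$, and $z\gets\mathbb{F}_2^n$; output $\mathsf{sk}=(P,z)$, $\mathsf{pk}=(G,z)$. * $\mathsf{Encode}(G,z)$: sample $u\gets\mathbb{F}_2^g$, $e\gets\mathrm{Ber}(n,\eta)$; output $Gu\oplus z\oplus e$. * $\mathsf{Decode}((P,z),x)$: output $1$ if $x$ has length $n$ and $\mathrm{wt}(Px\oplus Pz)<(\tfrac12-\zeta)r$, and $\bot$ otherwise. Assumptions. $\mathsf{LPN}_{g,\eta}$: for every polynomial-time adversary, the advantage in distinguishing $(A,As\oplus e)$ from $(A,u)$ is negligible in $n$, where $A\gets\mathbb{F}_2^{n\times g(n)}$, $s\gets\mathbb{F}_2^{g(n)}$, $e\gets\mathrm{Ber}(n,\eta)$, $u\gets\mathbb{F}_2^n$. $\mathsf{XOR}_{m,t}$: for every polynomial-time adversary, the advantage in distinguishing a uniform $G\in\mathbb{F}_2^{n\times m(n)}$ from the following planted $G$ is negligible in $n$: sample a uniform $s\in\mathbb{F}_2^n$ of weight $t(n)$ and then $G\in\mathbb{F}_2^{n\times m(n)}$ uniform subject to $s^{T}G=0$. Theorem. For any constants $p,\eta\in(0,1/2)$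 and $\varepsilon\in(0,1)$ there is a function $t:\mathbb{N}\to\mathbb{N}$ with $t=\Theta(\log n)$ and $t(n)\le n$ such that $S=\mathsf{LDPC\text{-}PRC}_0[n,n^{\varepsilon},t,n^{\varepsilon},\eta,n^{-\varepsilon/4}]$ has these properties: 1. The three algorithms of $S$ run in polynomial time, $S$ has only one message, $S$ is sound, and $S$ is robust to every $p$-bounded channel. 2. If $\mathsf{LPN}_{n^{\varepsilon},\eta}$ and $\mathsf{XOR}_{2n^{\varepsilon},t}$ hold, then $S$ is pseudorandom, and hence it is a zero-bit public-key PRC that is robust to every $p$-bounded channel. -/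

import Mathlib

open Filter Asymptotics
open scoped Matrix

noncomputable section

namespace PRC

/-! ## Bits, strings, probabilities -/

/-- Bits; `{0,1}` is identified with the field with two elements, so that `⊕` is `+`. -/
abbrev F2 : Type := ZMod 2

/-- Binary strings of length `m`, i.e. (column) vectors over the field with two elements. -/
abbrev Str (m : ℕ) : Type := Fin m → F2

/-- A string of length `m`, given as a list, read as a vector. -/
def toStr {m : ℕ} (x : List F2) (h : x.length = m) : Str m := fun i => x.get (i.cast h.symm)

/-- The entries of a matrix, listed row by row. -/
def flat {a b : ℕ} (A : Matrix (Fin a) (Fin b) F2) : Str (a * b) :=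
  fun i => A (finProdFinEquiv.symm i).1 (finProdFinEquiv.symm i).2

/-- The matrix whose entries are listed row by row in `v` (the inverse of `flat`). -/
def unflat {a b : ℕ} (v : Str (a * b)) : Matrix (Fin a) (Fin b) F2 :=
  fun i j => v (finProdFinEquiv (i, j))

/-- The probability that a sample from `μ` lies in `S`. -/
def prob {α : Type} (μ : PMF α) (S : Set α) : ℝ := (μ.toOuterMeasure S).toReal

/-- The uniform distribution on a finite set. On the empty set, where there is none, the value is
the point mass at `0`. -/
def uniformOn {α : Type} [Zero α] (s : Finset α) : PMF α :=
  open Classical in if h : s.Nonempty then PMF.uniformOfFinset s h else PMF.pure 0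

/-- `x ← {0,1}^m`. -/
def uniformStr (m : ℕ) : PMF (Str m) := PMF.uniformOfFintype (Str m)

/-- `Ber(q)`: the bit is `1` with probability `q` and `0` with probability `1 - q`
(a real number `q` outside `[0,1]` is first moved to the nearest point of `[0,1]`). -/
def ber (q : ℝ) : PMF F2 :=
  PMF.ofFintype (fun b : F2 => if b = 1 then min (ENNReal.ofReal q) 1
      else 1 - min (ENNReal.ofReal q) 1) (by
    have h : (Finset.univ : Finset F2) = {0, 1} := by decide
    rw [h, Finset.sum_pair (by decide), if_neg (by decide), if_pos rfl]
    exact tsub_add_cancel_of_le (min_le_right _ _))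

/-- `Ber(n, q)`: `n` independent samples from `Ber(q)`. -/
def berStr (q : ℝ) : (n : ℕ) → PMF (Str n)
  | 0 => PMF.pure Fin.elim0
  | n + 1 => (ber q).bind fun b => (berStr q n).map fun v => Fin.cons b v

/-- Negligible functions: smaller than every inverse polynomial. -/
def Negligible (f : ℕ → ℝ) : Prop := SuperpolynomialDecay atTop (fun n : ℕ => (n : ℝ)) f

/-! ## Polynomial time: probabilistic (oracle) circuits of polynomial size

A circuit is a straight-line program over the basis `1, ⊕, ∧`. It works on a list of bits (wires),
which holds the input at the start, and each gate appends its output at the end. The wire with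
number `i` is the `i`-th bit of the list; a wire that does not exist reads `0`. -/

inductive Gate : Type
  /-- the constant `1` -/
  | one : Gate
  /-- exclusive or of two wires -/
  | add (i j : ℕ) : Gate
  /-- conjunction of two wires -/
  | mul (i j : ℕ) : Gate
  /-- a fresh coin that shows `1` with probability `q` -/
  | coin (q : ℝ) : Gate
  /-- a call to the oracle on the string on the listed wires; the whole answer is appended -/
  | oracle (query : List ℕ) : Gate

/-- A randomized oracle; each call is answered with fresh randomness. -/
abbrev Oracle : Type := List F2 → PMF (List F2)

/-- The bits on the listed wires. -/
def readWires (w : List F2) (l : List ℕ) : List F2 := l.map fun i => w.getD i 0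

/-- The wires after one more gate. -/
def Gate.step (O : Oracle) (w : List F2) : Gate → PMF (List F2)
  | .one => PMF.pure (w ++ [1])
  | .add i j => PMF.pure (w ++ [w.getD i 0 + w.getD j 0])
  | .mul i j => PMF.pure (w ++ [w.getD i 0 * w.getD j 0])
  | .coin q => (ber q).map fun b => w ++ [b]
  | .oracle l => (O (readWires w l)).map fun a => w ++ a

/-- A gate counts one step; an oracle call also counts the length of its query. -/
def Gate.cost : Gate → ℕ
  | .oracle l => 1 + l.length
  | _ => 1

/-- The wires after a list of gates. -/
def runGates (O : Oracle) : List Gate → List F2 → PMF (List F2)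
  | [], w => PMF.pure w
  | g :: gs, w => (g.step O w).bind fun w' => runGates O gs w'

/-- A circuit: its gates in order, and its output wires. -/
structure Circuit : Type where
  gates : List Gate
  outs : List ℕ

/-- The output distribution of the circuit on input `x`, with access to the oracle `O`. -/
def Circuit.eval (C : Circuit) (O : Oracle) (x : List F2) : PMF (List F2) :=
  (runGates O C.gates x).map fun w => readWires w C.outs

/-- The size of a circuit (its number of steps). -/
def Circuit.size (C : Circuit) : ℕ := (C.gates.map Gate.cost).sum + C.outs.length

/-- The trivial oracle: every answer is empty, so that oracle gates do nothing. -/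
def noOracle : Oracle := fun _ => PMF.pure []

/-- A (non-uniform) family of circuits of polynomial size. -/
def PolySize (C : ℕ → Circuit) : Prop :=
  ∃ P : Polynomial ℕ, ∀ l : ℕ, (C l).size ≤ P.eval l

/-- The oracle given by a randomized map from `{0,1}^k` to `{0,1}^m`; there is no answer to a
query of another length. -/
def oracleOf {k m : ℕ} (f : Str k → PMF (Str m)) : Oracle :=
  fun x => if h : x.length = k then (f (toStr x h)).map List.ofFn else PMF.pure []

/-! ## Public-key pseudorandom codes over the binary alphabet -/

/-- The syntax of a public-key code. `none` stands for `⊥`, and `l` for the security parameter. -/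
structure PKCode : Type where
  skLen : ℕ → ℕ
  pkLen : ℕ → ℕ
  blockLen : ℕ → ℕ
  msgLen : ℕ → ℕ
  keyGen : ∀ l, PMF (Str (skLen l) × Str (pkLen l))
  encode : ∀ l, Str (pkLen l) → Str (msgLen l) → PMF (Str (blockLen l))
  decode : ∀ l, Str (skLen l) → List F2 → PMF (Option (Str (msgLen l)))

/-- Bit encoding of a decoder's answer: `⊥` is `0`, and the message `m` is `1` followed by `m`. -/
def answerBits {k : ℕ} : Option (Str k) → List F2
  | none => 0 :: List.replicate k 0
  | some m => 1 :: List.ofFn m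

/-- The three algorithms run in polynomial time: they are computed exactly by probabilistic
circuits without oracle, of size polynomial in the security parameter and the input length. -/
structure PKCode.Efficient (S : PKCode) : Prop where
  keyGen : ∃ C : ℕ → Circuit, PolySize C ∧ ∀ l,
    (C l).eval noOracle [] = (S.keyGen l).map fun k => List.ofFn k.1 ++ List.ofFn k.2
  encode : ∃ C : ℕ → Circuit, PolySize C ∧ ∀ l pk m,
    (C l).eval noOracle (List.ofFn pk ++ List.ofFn m) = (S.encode l pk m).map List.ofFn
  decode : ∃ C : ℕ → ℕ → Circuit,
    (∃ P : Polynomial ℕ, ∀ l k, (C l k).size ≤ P.eval (l + k)) ∧ ∀ l sk (x : List F2),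
    (C l x.length).eval noOracle (List.ofFn sk ++ x) = (S.decode l sk x).map answerBits

/-- A channel: a randomized map on binary strings (not necessarily an efficient one). -/
abbrev Channel : Type := List F2 → PMF (List F2)

/-- Error correction: with overwhelming probability the decoder recovers the message from a
codeword that went through the channel `E`. -/
def PKCode.RobustTo (S : PKCode) (E : Channel) : Prop :=
  ∃ ν : ℕ → ℝ, Negligible ν ∧ ∀ (l : ℕ) (m : Str (S.msgLen l)),
    1 - ν l ≤ prob ((S.keyGen l).bind fun k => (S.encode l k.2 m).bind fun x =>
      (E (List.ofFn x)).bind fun y => S.decode l k.1 y) {some m}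

/-- Soundness: every fixed string decodes to `⊥` with overwhelming probability over the key. -/
def PKCode.Sound (S : PKCode) : Prop :=
  ∃ ν : ℕ → ℝ, Negligible ν ∧ ∀ (l : ℕ) (c : List F2),
    1 - ν l ≤ prob ((S.keyGen l).bind fun k => S.decode l k.1 c) {none}

/-- Pseudorandomness: no polynomial-time adversary that holds the public key can tell oracle
access to the encoder from an oracle that answers every query with a fresh uniform string. -/
def PKCode.Pseudorandom (S : PKCode) : Prop :=
  ∀ A : ℕ → Circuit, PolySize A → Negligible fun l =>
    |prob ((S.keyGen l).bind fun k =>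
        (A l).eval (oracleOf (S.encode l k.2)) (List.ofFn k.2)) {[1]}
      - prob ((S.keyGen l).bind fun k =>
        (A l).eval (oracleOf fun _ : Str (S.msgLen l) => uniformStr (S.blockLen l))
          (List.ofFn k.2)) {[1]}|

/-- A public-key pseudorandom error-correcting code with robustness to the channel `E`. -/
structure PKCode.IsPRC (S : PKCode) (E : Channel) : Prop where
  efficient : S.Efficient
  robust : S.RobustTo E
  sound : S.Sound
  pseudorandom : S.Pseudorandom

/-- Zero-bit: there is only one possible message (the empty string, which stands for `1`). -/
def PKCode.ZeroBit (S : PKCode) : Prop := ∀ l, S.msgLen l = 0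

/-- The number of positions in which two strings of the same length differ, `wt(x ⊕ y)`. -/
def wtDiff (x y : List F2) : ℕ := (List.zipWith (fun a b => a + b) x y).count 1

/-- `p`-bounded channels: length-preserving, and on a uniform string of length `n` they flip more
than `p n` bits with negligible probability only. -/
def PBounded (p : ℝ) (E : Channel) : Prop :=
  (∀ x, ∀ y ∈ (E x).support, y.length = x.length) ∧
  ∃ ν : ℕ → ℝ, Negligible ν ∧ ∀ n : ℕ,
    prob ((uniformStr n).bind fun x =>
      (E (List.ofFn x)).map fun y => (List.ofFn x, y))
      {xy | p * (n : ℝ) < (wtDiff xy.2 xy.1 : ℝ)} ≤ ν n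

/-! ## The zero-bit code from random low-density parity checks -/

/-- The `t`-sparse vectors of length `n`. -/
def sparseVecs (t n : ℕ) : Finset (Str n) := {s | hammingNorm s = t}

/-- The `r × n` matrices all of whose rows are `t`-sparse. -/
def sparseMats (t r n : ℕ) : Finset (Matrix (Fin r) (Fin n) F2) :=
  {P | ∀ i, hammingNorm (P i) = t}

/-- `LDPC[n,g,t,r]`: `P` has uniform independent `t`-sparse rows, and `G` is uniform subject to
`P G = 0`. -/
def ldpc (n g t r : ℕ) : PMF (Matrix (Fin r) (Fin n) F2 × Matrix (Fin n) (Fin g) F2) :=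
  (uniformOn (sparseMats t r n)).bind fun P =>
    (uniformOn {G : Matrix (Fin n) (Fin g) F2 | P * G = 0}).map fun G => (P, G)

/-- Public key `(G, z)` (or secret key `(P, z)`) as a string: the entries of the matrix row by
row, then the vector. -/
def packKey {a b m : ℕ} (A : Matrix (Fin a) (Fin b) F2) (z : Str m) : Str (a * b + m) :=
  Fin.append (flat A) z

/-- The matrix in a key. -/
def keyMat {a b m : ℕ} (k : Str (a * b + m)) : Matrix (Fin a) (Fin b) F2 :=
  unflat fun i => k (Fin.castAdd m i)

/-- The vector in a key. -/
def keyVec {a b m : ℕ} (k : Str (a * b + m)) : Str m := fun i => k (Fin.natAdd (a * b) i)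

/-- `LDPC-PRC₀[n,g,t,r,η,ζ]`. Its only message, the empty string, stands for `1`. The decoder
answers `⊥` to strings that do not have length `n`. -/
def ldpcPRC (n g t r : ℕ → ℕ) (η ζ : ℕ → ℝ) : PKCode where
  skLen l := r l * n l + n l
  pkLen l := n l * g l + n l
  blockLen l := n l
  msgLen _ := 0
  keyGen l := (ldpc (n l) (g l) (t l) (r l)).bind fun PG =>
    (uniformStr (n l)).map fun z => (packKey PG.1 z, packKey PG.2 z)
  encode l pk _ := (uniformStr (g l)).bind fun u =>
    (berStr (η l) (n l)).map fun e => keyMat pk *ᵥ u + keyVec pk + e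
  decode l sk x := open Classical in PMF.pure
    (if h : x.length = n l then
      if (hammingNorm (keyMat sk *ᵥ toStr x h + keyMat sk *ᵥ keyVec sk) : ℝ)
          < (1 / 2 - ζ l) * (r l : ℝ)
      then some Fin.elim0 else none
    else none)

/-! ## The two assumptions -/

/-- The decisional learning-parity-with-noise assumption `LPN_{g,η}`, with `n` samples: `(A, As ⊕ e)`
is computationally indistinguishable from `(A, u)`. -/
def LPN (g : ℕ → ℕ) (η : ℝ) : Prop :=
  ∀ D : ℕ → Circuit, PolySize D → Negligible fun n =>
    |prob ((PMF.uniformOfFintype (Matrix (Fin n) (Fin (g n)) F2)).bind fun A =>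
        (uniformStr (g n)).bind fun s => (berStr η n).bind fun e =>
          (D n).eval noOracle (List.ofFn (flat A) ++ List.ofFn (A *ᵥ s + e))) {[1]}
      - prob ((PMF.uniformOfFintype (Matrix (Fin n) (Fin (g n)) F2)).bind fun A =>
        (uniformStr n).bind fun u =>
          (D n).eval noOracle (List.ofFn (flat A) ++ List.ofFn u)) {[1]}|

/-- The null distribution: a uniform `n × m` matrix. -/
def nullDist (n m : ℕ) : PMF (Matrix (Fin n) (Fin m) F2) := PMF.uniformOfFintype _

/-- The planted distribution: a uniform `n × m` matrix `G` subject to `sᵀ G = 0`, for a uniform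
`t`-sparse vector `s`. -/
def plantedDist (n m t : ℕ) : PMF (Matrix (Fin n) (Fin m) F2) :=
  (uniformOn (sparseVecs t n)).bind fun s =>
    uniformOn {G : Matrix (Fin n) (Fin m) F2 | s ᵥ* G = 0}

/-- The planted XOR assumption `XOR_{m,t}`. -/
def PlantedXOR (m t : ℕ → ℕ) : Prop :=
  ∀ D : ℕ → Circuit, PolySize D → Negligible fun n =>
    |prob ((nullDist n (m n)).bind fun G => (D n).eval noOracle (List.ofFn (flat G))) {[1]}
      - prob ((plantedDist n (m n) (t n)).bind fun G =>
          (D n).eval noOracle (List.ofFn (flat G))) {[1]}|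

/-- `n^ε`, rounded down to a natural number. -/
def powFloor (ε : ℝ) (n : ℕ) : ℕ := ⌊(n : ℝ) ^ ε⌋₊

end PRC

end

namespace PRC

noncomputable section


/-! ## Finite product distributions -/

section Product

variable {ι κ : Type} [Fintype ι] [Fintype κ] {α β : ι → Type} [∀ i, Fintype (α i)]
  [∀ i, Fintype (β i)]

/-! Put κ = (1-2η)(1-2p), θ = κ/4, ζ = n^(-ε/4), r = n^ε, and let t be c log n, rounded down and
capped at n, with c = ε/(8 log(1/θ)). Then θ^t ≥ n^(-ε/8), which eventually exceeds 3ζ, while C(n,t)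
is superpolynomial and rζ² is of order n^(ε/2).

Robustness and soundness both rest on the bias of a random t-sparse parity of a vector w, that is,
on the average of (-1)^(s·w), which is `paritySum t w` divided by C(n,t). The decoder sees P(y+z)
only, and PG = 0. Since z is uniform, the codeword x can be drawn first and z recovered as x+Gu+e;
the decoder then tests P(w) for w = (y+x)+e, where y, x and e are independent of P
(`robust_game_eq`). A p-bounded channel makes y+x of weight at most pn, and a Chernoff bound over e
gives w a sign sum of at least κn/2 (`prob_noise_le`). The three-term recurrence of the Krawtchouk
polynomials turns this into bias at least θ^t ≥ 3ζ (`le_paritySum`), and a Chernoff bound over the r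
rows of P finishes the argument (`prob_le_weight`).

For soundness, w = z+c is uniform and independent of P. The parity sums have mean square C(n,t)
(`sum_paritySum_sq`), so Chebyshev bounds the bias by ζ except with probability 1/(ζ² C(n,t)), which
is negligible. A Chernoff bound over the rows applies again (`prob_weight_lt`).

Pseudorandomness is a hybrid argument along two parameters, the number i of checks that G satisfies
and the number j of uniform answers: (r,0) → (0,0) → (0,Q) → (r,Q). Changing i by one uses planted
XOR. Given an n × 2g challenge, i checks P are sampled and the first g+i columns are combined by an
injective matrix that depends only on P times the challenge and whose result P annihilates;
`map_combineCols` shows that the outcome has exactly the distribution with i or i+1 checks. Changing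
j by one while G is uniform is an instance of LPN, with the challenge shifted by a freshly drawn z.

The algorithms and reductions must be exact circuits. `Reach` describes straight-line programs over
a commutative ring, `DetC` the maps computed by them, `Samp` the maps computed from coins;
`Samp.exists_circuit` compiles the last. Sparse vectors are sampled one position at a time with
coins of suitable bias, and G is obtained by applying a linear projection onto ker P to a uniform
matrix. An adversary becomes a `Samp` map of its oracle's answers, drawn in advance. -/

theorem pmf_sum_eq_one {γ : Type} [Fintype γ] (μ : PMF γ) : ∑ x, μ x = 1 := by
  rw [← tsum_fintype (L := .unconditional _)]; exact μ.tsum_coe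

/-- The product of finitely many distributions on finite types. -/
def piPMF {α : ι → Type} [∀ i, Finite (α i)] (μ : ∀ i, PMF (α i)) : PMF (∀ i, α i) :=
  open Classical in
  letI := fun i => Fintype.ofFinite (α i)
  PMF.ofFintype (fun x => ∏ i, μ i (x i)) (by
    classical
    rw [← Fintype.piFinset_univ, ← Finset.prod_univ_sum]
    simp [pmf_sum_eq_one])

@[simp]
theorem piPMF_apply {α : ι → Type} [∀ i, Finite (α i)] (μ : ∀ i, PMF (α i)) (x : ∀ i, α i) : piPMF μ x = ∏ i, μ i (x i) := rfl

theorem piPMF_bind (μ : ∀ i, PMF (α i)) (k : ∀ i, α i → PMF (β i)) :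
    (piPMF μ).bind (fun x => piPMF fun i => k i (x i)) = piPMF fun i => (μ i).bind (k i) := by
  classical
  ext y
  simp only [PMF.bind_apply, piPMF_apply, tsum_fintype, ← Finset.prod_mul_distrib]
  rw [Finset.prod_univ_sum, Fintype.piFinset_univ]

theorem piPMF_pure (x : ∀ i, α i) : piPMF (fun i => PMF.pure (x i)) = PMF.pure x := by
  classical
  ext y
  simp only [piPMF_apply, PMF.pure_apply, Finset.prod_ite_zero, Finset.prod_const_one]
  simp [funext_iff]

theorem piPMF_map (μ : ∀ i, PMF (α i)) (h : ∀ i, α i → β i) :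
    (piPMF μ).map (fun x i => h i (x i)) = piPMF fun i => (μ i).map (h i) := by
  simp only [← PMF.bind_pure_comp, Function.comp_def]
  rw [← piPMF_bind]
  simp only [piPMF_pure]

theorem map_equiv_apply {γ δ : Type} (μ : PMF γ) (e : γ ≃ δ) (y : δ) :
    μ.map e y = μ (e.symm y) := by
  classical
  rw [PMF.map_apply, tsum_eq_single (e.symm y)]
  · simp
  · intro x hx
    rw [if_neg]
    rintro rfl
    simp at hx

theorem map_eq_of_equiv {γ δ : Type} {μ : PMF γ} {ν : PMF δ} (e : γ ≃ δ)
    (h : ∀ x, μ x = ν (e x)) : μ.map e = ν := by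
  ext y
  rw [map_equiv_apply, h, Equiv.apply_symm_apply]

theorem piPMF_reindex {γ : Type} [Fintype γ] (e : κ ≃ ι) (μ : ι → PMF γ) :
    (piPMF μ).map (fun x i => x (e i)) = piPMF fun i => μ (e i) := by
  refine map_eq_of_equiv (e.symm.arrowCongr (Equiv.refl γ)) fun x => ?_
  simp only [piPMF_apply]
  exact (e.prod_comp fun i => μ i (x i)).symm

theorem piPMF_sigma {τ : ι → Type} [∀ i, Fintype (τ i)] {γ : Type} [Fintype γ]
    (μ : (Σ i, τ i) → PMF γ) :
    (piPMF μ).map (fun x i j => x ⟨i, j⟩) = piPMF fun i => piPMF fun j => μ ⟨i, j⟩ := by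
  classical
  refine map_eq_of_equiv (Equiv.piCurry fun _ _ => γ) fun x => ?_
  simp [Fintype.prod_sigma, Sigma.curry, Equiv.piCurry]

theorem piPMF_sum {γ : Type} [Fintype γ] (μ : ι ⊕ κ → PMF γ) :
    (piPMF μ).map (fun x => (fun i => x (Sum.inl i), fun j => x (Sum.inr j))) =
      (piPMF fun i => μ (Sum.inl i)).bind fun x =>
        (piPMF fun j => μ (Sum.inr j)).map fun y => (x, y) := by
  classical
  ext ⟨a, b⟩
  rw [show (fun x : ι ⊕ κ → γ => ((fun i => x (Sum.inl i)), fun j => x (Sum.inr j))) =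
    (Equiv.sumArrowEquivProdArrow ι κ γ) from rfl, map_equiv_apply]
  simp only [PMF.bind_apply, PMF.map_apply, tsum_fintype, piPMF_apply, Fintype.prod_sum_type,
    Prod.mk.injEq, Equiv.sumArrowEquivProdArrow_symm_apply_inl,
    Equiv.sumArrowEquivProdArrow_symm_apply_inr]
  rw [Finset.sum_eq_single a, Finset.sum_eq_single b]
  · simp
  · intro c _ hc; simp [Ne.symm hc]
  · simp
  · intro c _ hc; simp [Ne.symm hc]
  · simp

theorem piPMF_cons {n : ℕ} {γ : Type} [Fintype γ] (μ : Fin (n + 1) → PMF γ) :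
    piPMF μ = (μ 0).bind fun b =>
      (piPMF fun i : Fin n => μ i.succ).map fun v => (Fin.cons b v : Fin (n + 1) → γ) := by
  classical
  ext y
  simp only [PMF.bind_apply, PMF.map_apply, tsum_fintype, piPMF_apply, Fin.prod_univ_succ]
  rw [Finset.sum_eq_single (y 0), Finset.sum_eq_single (Fin.tail y)]
  · simp [Fin.tail]
  · intro c _ hc
    rw [if_neg]
    intro h
    exact hc (by rw [h, Fin.tail_cons])
  · simp
  · intro c _ hc
    rw [Finset.sum_eq_zero, mul_zero]
    intro v _
    rw [if_neg]
    rintro rfl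
    simp at hc
  · simp

theorem piPMF_eval (μ : ∀ i, PMF (α i)) (i : ι) : (piPMF μ).map (fun x => x i) = μ i := by
  classical
  ext y
  simp only [PMF.map_apply, tsum_fintype, piPMF_apply]
  -- The marginal is a product of sums in which the factor with index `i` alone carries the
  -- indicator of `y`; all other factors sum to 1.
  have h := Finset.prod_univ_sum (fun j => (Finset.univ : Finset (α j)))
    (fun j a => if h : j = i then (if y = h ▸ a then μ j a else 0) else μ j a)
  rw [Fintype.piFinset_univ] at h
  rw [Finset.prod_eq_single i] at h
  · simp only [dite_true] at h
    rw [Finset.sum_eq_single y] at h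
    · rw [if_pos rfl] at h
      rw [h]
      refine Finset.sum_congr rfl fun x _ => ?_
      split_ifs with hy
      · refine Finset.prod_congr rfl fun j _ => ?_
        split_ifs with h1 h2
        · rfl
        · subst h1; exact absurd hy h2
        · rfl
      · refine (Finset.prod_eq_zero (Finset.mem_univ i) ?_).symm
        rw [dif_pos rfl, if_neg hy]
    · intro b _ hb
      rw [if_neg (Ne.symm hb)]
    · simp
  · intro j _ hj
    simp [hj, pmf_sum_eq_one]
  · simp

/-- Isolates one coordinate as a separate first sample; the hybrid over oracle answers replaces this
sample by the challenge. -/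
theorem piPMF_eq_bind_update {γ : Type} [Fintype γ] [DecidableEq ι] (μ : ι → PMF γ) (i : ι) :
    piPMF μ = (μ i).bind fun y => piPMF (Function.update μ i (PMF.pure y)) := by
  have h : ∀ y, (fun j => if j = i then PMF.pure y else μ j) =
      Function.update μ i (PMF.pure y) := by
    intro y; ext j; simp only [Function.update_apply]
  ext x
  simp only [PMF.bind_apply, tsum_fintype, piPMF_apply]
  rw [Finset.sum_eq_single (x i)]
  · rw [← Finset.mul_prod_erase _ _ (Finset.mem_univ i),
      ← Finset.mul_prod_erase _ _ (Finset.mem_univ i)]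
    simp only [Function.update_self, PMF.pure_apply, if_true, one_mul]
    congr 1
    refine Finset.prod_congr rfl fun j hj => ?_
    rw [Function.update_of_ne (Finset.ne_of_mem_erase hj)]
  · intro b _ hb
    rw [Finset.prod_eq_zero (Finset.mem_univ i), mul_zero]
    simp [PMF.pure_apply, Ne.symm hb]
  · simp

theorem berStr_eq (q : ℝ) (n : ℕ) : berStr q n = piPMF fun _ : Fin n => ber q := by
  induction n with
  | zero =>
    ext y
    simp only [berStr, PMF.pure_apply, piPMF_apply, Finset.univ_eq_empty, Finset.prod_empty]
    rw [if_pos (Subsingleton.elim _ _)]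
  | succ n ih => rw [piPMF_cons, berStr, ih]

end Product

/-! ## Uniform distributions -/

theorem uniformOn_apply {α : Type} [Zero α] [DecidableEq α] {s : Finset α} (hs : s.Nonempty)
    (x : α) : uniformOn s x = if x ∈ s then (s.card : ENNReal)⁻¹ else 0 := by
  rw [uniformOn, dif_pos hs, PMF.uniformOfFinset_apply]
  congr

theorem uniformOfFintype_eq_uniformOn {α : Type} [Zero α] [Fintype α] [Nonempty α] :
    PMF.uniformOfFintype α = uniformOn (Finset.univ : Finset α) := by
  rw [uniformOn, dif_pos Finset.univ_nonempty]
  rfl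

/-- A map with fibres of equal size sends the uniform distribution to the uniform distribution. -/
theorem map_uniformOn {α β : Type} [Zero α] [Zero β] [DecidableEq β] {s : Finset α}
    {t : Finset β} (f : α → β) (hs : s.Nonempty) (hf : ∀ x ∈ s, f x ∈ t) (y₀ : β)
    (h : ∀ y ∈ t, (s.filter fun x => f x = y).card = (s.filter fun x => f x = y₀).card) :
    (uniformOn s).map f = uniformOn t := by
  classical
  have ht : t.Nonempty := hs.elim fun x hx => ⟨f x, hf x hx⟩
  have hcard : s.card = t.card * (s.filter fun x => f x = y₀).card := by
    rw [Finset.card_eq_sum_card_fiberwise (f := f) (t := t) hf, Finset.sum_congr rfl h,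
      Finset.sum_const, smul_eq_mul]
  set c := (s.filter fun x => f x = y₀).card
  have hc : c ≠ 0 := by
    rintro h0
    rw [h0, mul_zero] at hcard
    exact hs.card_pos.ne' hcard
  ext y
  rw [PMF.map_apply, uniformOn_apply ht]
  have h1 : ∀ a, (if y = f a then uniformOn s a else 0) =
      if a ∈ s.filter (fun x => f x = y) then (s.card : ENNReal)⁻¹ else 0 := by
    intro a
    rw [uniformOn_apply hs]
    by_cases h1 : y = f a
    · subst h1; simp
    · simp [h1, Ne.symm h1]
  refine (tsum_congr (g := fun a => if a ∈ s.filter (fun x => f x = y) then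
    (s.card : ENNReal)⁻¹ else 0) fun a => by convert h1 a).trans ?_
  rw [tsum_eq_sum (s := s.filter fun x => f x = y) (by intro b hb; rw [if_neg hb]),
    Finset.sum_ite_mem, Finset.inter_self, Finset.sum_const, nsmul_eq_mul]
  split_ifs with hy
  · rw [h y hy, hcard, Nat.cast_mul, ENNReal.mul_inv (by simp) (by simp), mul_comm, mul_assoc,
      ENNReal.inv_mul_cancel (by exact_mod_cast hc) (by simp), mul_one]
  · rw [Finset.card_eq_zero.2, Nat.cast_zero, zero_mul]
    rw [Finset.filter_eq_empty_iff]
    rintro x hx rfl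
    exact hy (hf x hx)

/-- A map whose fibres are exchanged by involutions sends the uniform distribution to the uniform
distribution. -/
theorem map_uniformOn_of_involution {α β : Type} [Zero α] [Zero β] {s : Finset α}
    {t : Finset β} (f : α → β) (hs : s.Nonempty) (hf : ∀ x ∈ s, f x ∈ t) (y₀ : β)
    (h : ∀ y ∈ t, ∃ σ : α → α, ∀ x ∈ s, σ x ∈ s ∧ σ (σ x) = x ∧
      (f x = y → f (σ x) = y₀) ∧ (f x = y₀ → f (σ x) = y)) :
    (uniformOn s).map f = uniformOn t := by
  classical
  refine map_uniformOn f hs hf y₀ fun y hy => ?_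
  obtain ⟨σ, hσ⟩ := h y hy
  refine Finset.card_nbij' σ σ ?_ ?_ ?_ ?_
  · intro x hx
    have hx := Finset.mem_filter.1 hx
    exact Finset.mem_filter.2 ⟨(hσ x hx.1).1, (hσ x hx.1).2.2.1 hx.2⟩
  · intro x hx
    have hx := Finset.mem_filter.1 hx
    exact Finset.mem_filter.2 ⟨(hσ x hx.1).1, (hσ x hx.1).2.2.2 hx.2⟩
  · intro x hx
    exact (hσ x (Finset.mem_filter.1 hx).1).2.1
  · intro x hx
    exact (hσ x (Finset.mem_filter.1 hx).1).2.1

theorem piPMF_uniformOn {ι : Type} [Fintype ι] [DecidableEq ι] {α : ι → Type}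
    [∀ i, Fintype (α i)] [∀ i, Zero (α i)] (s : ∀ i, Finset (α i)) (hs : ∀ i, (s i).Nonempty) :
    piPMF (fun i => uniformOn (s i)) = uniformOn (Fintype.piFinset s) := by
  classical
  ext x
  rw [piPMF_apply, uniformOn_apply (Fintype.piFinset_nonempty.2 hs)]
  simp only [uniformOn_apply (hs _), Fintype.mem_piFinset, Finset.prod_ite_zero,
    Finset.mem_univ, true_implies]
  congr 1
  rw [Fintype.card_piFinset, Nat.cast_prod, ENNReal.prod_inv_distrib]
  intro i _ j _ _
  right; simp

theorem piPMF_uniformOfFintype {ι : Type} [Fintype ι] [DecidableEq ι] {α : Type} [Fintype α]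
    [Zero α] : piPMF (fun _ : ι => PMF.uniformOfFintype α) = PMF.uniformOfFintype (ι → α) := by
  simp only [uniformOfFintype_eq_uniformOn]
  rw [piPMF_uniformOn _ fun _ => Finset.univ_nonempty, Fintype.piFinset_univ]

theorem ber_half : ber (1 / 2) = PMF.uniformOfFintype F2 := by
  ext b
  have h : min (ENNReal.ofReal (1 / 2)) 1 = 2⁻¹ := by
    rw [min_eq_left (by rw [ENNReal.ofReal_le_one]; norm_num)]
    rw [one_div, ENNReal.ofReal_inv_of_pos (by norm_num)]
    simp
  rw [PMF.uniformOfFintype_apply]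
  simp only [ber, PMF.ofFintype_apply]
  rw [h]
  have h2 : (Fintype.card F2 : ENNReal) = 2 := by simp [ZMod.card]
  rw [h2]
  split_ifs
  · rfl
  · exact ENNReal.one_sub_inv_two

theorem uniformStr_eq (m : ℕ) : uniformStr m = piPMF fun _ : Fin m => ber (1 / 2) := by
  rw [uniformStr, ber_half, ← piPMF_uniformOfFintype]

theorem uniformStr_map_add {m : ℕ} (c : Str m) :
    (uniformStr m).map (fun z => z + c) = uniformStr m :=
  map_eq_of_equiv (Equiv.addRight c) fun x => by
    simp [uniformStr, PMF.uniformOfFintype_apply]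

theorem uniformMat_eq (a b : ℕ) : PMF.uniformOfFintype (Matrix (Fin a) (Fin b) F2) =
    piPMF fun _ : Fin a => uniformStr b := by
  classical
  rw [show uniformStr b = PMF.uniformOfFintype (Fin b → F2) from rfl, piPMF_uniformOfFintype]
  ext x
  rw [PMF.uniformOfFintype_apply]
  erw [PMF.uniformOfFintype_apply]
  rfl


/-! ## Straight-line programs -/

/-- From the elements of `B`, those of `F` are obtained by at most `N` operations. -/
inductive Reach {A : Type} [CommRing A] : ℕ → Set A → Set A → Prop
  | done {N : ℕ} {B F : Set A} : F ⊆ B → Reach N B F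
  | one {N : ℕ} {B F : Set A} : Reach N (insert 1 B) F → Reach (N + 1) B F
  | add {N : ℕ} {B F : Set A} {a b : A} : a ∈ B → b ∈ B → Reach N (insert (a + b) B) F →
      Reach (N + 1) B F
  | mul {N : ℕ} {B F : Set A} {a b : A} : a ∈ B → b ∈ B → Reach N (insert (a * b) B) F →
      Reach (N + 1) B F

namespace Reach

variable {A : Type} [CommRing A] {N M : ℕ} {B F H : Set A}

theorem mono (h : Reach N B F) {N' : ℕ} {B' F' : Set A} (hN : N ≤ N') (hB : B ⊆ B')
    (hF : F' ⊆ F) : Reach N' B' F' := by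
  induction h generalizing N' B' with
  | done h => exact .done ((hF.trans h).trans hB)
  | one _ ih =>
    obtain ⟨k, rfl⟩ : ∃ m, N' = m + 1 := ⟨N' - 1, by omega⟩
    exact .one (ih (by omega) (Set.insert_subset_insert hB) hF)
  | add ha hb _ ih =>
    obtain ⟨k, rfl⟩ : ∃ m, N' = m + 1 := ⟨N' - 1, by omega⟩
    exact .add (hB ha) (hB hb) (ih (by omega) (Set.insert_subset_insert hB) hF)
  | mul ha hb _ ih =>
    obtain ⟨k, rfl⟩ : ∃ m, N' = m + 1 := ⟨N' - 1, by omega⟩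
    exact .mul (hB ha) (hB hb) (ih (by omega) (Set.insert_subset_insert hB) hF)

/-- Operations only enlarge the set of available values, so the inputs survive and a later program
may use them again. -/
theorem keep (h : Reach N B F) : Reach N B (B ∪ F) := by
  induction h with
  | done h => exact .done (Set.union_subset subset_rfl h)
  | one _ ih =>
    exact .one (ih.mono le_rfl subset_rfl (Set.union_subset_union_left _ (Set.subset_insert _ _)))
  | add ha hb _ ih =>
    exact .add ha hb
      (ih.mono le_rfl subset_rfl (Set.union_subset_union_left _ (Set.subset_insert _ _)))
  | mul ha hb _ ih =>
    exact .mul ha hb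
      (ih.mono le_rfl subset_rfl (Set.union_subset_union_left _ (Set.subset_insert _ _)))

theorem trans (h : Reach N B F) (h' : Reach M (B ∪ F) H) : Reach (N + M) B H := by
  induction h with
  | done h =>
    rw [Set.union_eq_self_of_subset_right h] at h'
    exact h'.mono (Nat.le_add_left _ _) subset_rfl subset_rfl
  | one _ ih =>
    rw [Nat.add_right_comm]
    exact .one (ih (h'.mono le_rfl (Set.union_subset_union_left _ (Set.subset_insert _ _))
      subset_rfl))
  | add ha hb _ ih =>
    rw [Nat.add_right_comm]
    exact .add ha hb (ih (h'.mono le_rfl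
      (Set.union_subset_union_left _ (Set.subset_insert _ _)) subset_rfl))
  | mul ha hb _ ih =>
    rw [Nat.add_right_comm]
    exact .mul ha hb (ih (h'.mono le_rfl
      (Set.union_subset_union_left _ (Set.subset_insert _ _)) subset_rfl))

theorem union (h : Reach N B F) (h' : Reach M B H) : Reach (N + M) B (F ∪ H) :=
  h.trans ((h'.mono le_rfl Set.subset_union_left subset_rfl).keep.mono le_rfl subset_rfl
    (Set.union_subset_union_left _ Set.subset_union_right))

theorem biUnion {ι : Type} (s : Finset ι) {F : ι → Set A} (h : ∀ i ∈ s, Reach N B (F i)) :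
    Reach (s.card * N) B (⋃ i ∈ s, F i) := by
  classical
  induction s using Finset.induction_on with
  | empty => exact .done (by simp)
  | insert i s hi ih =>
    rw [Finset.card_insert_of_notMem hi, Finset.set_biUnion_insert, Nat.succ_mul, Nat.add_comm]
    exact (h i (Finset.mem_insert_self _ _)).union
      (ih fun j hj => h j (Finset.mem_insert_of_mem hj))

theorem iUnion {ι : Type} [Fintype ι] {F : ι → Set A} (h : ∀ i, Reach N B (F i)) :
    Reach (Fintype.card ι * N) B (⋃ i, F i) := by
  have := biUnion Finset.univ (F := F) fun i _ => h i
  simpa using this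

/-- A program uses nothing but ring operations, so a homomorphism carries it along. For
precomposition with a map this is substitution of one program into another. -/
theorem map {A' : Type} [CommRing A'] (φ : A →+* A') (h : Reach N B F) :
    Reach N (φ '' B) (φ '' F) := by
  induction h with
  | done h => exact .done (Set.image_mono h)
  | one _ ih =>
    rw [Set.image_insert_eq, map_one] at ih
    exact .one ih
  | add ha hb _ ih =>
    rw [Set.image_insert_eq, map_add] at ih
    exact .add (Set.mem_image_of_mem _ ha) (Set.mem_image_of_mem _ hb) ih
  | mul ha hb _ ih =>
    rw [Set.image_insert_eq, map_mul] at ih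
    exact .mul (Set.mem_image_of_mem _ ha) (Set.mem_image_of_mem _ hb) ih

theorem single_one : Reach 1 B {1} := .one (.done (by simp))

theorem single_add {a b : A} (ha : a ∈ B) (hb : b ∈ B) : Reach 1 B {a + b} :=
  .add ha hb (.done (by simp))

theorem single_mul {a b : A} (ha : a ∈ B) (hb : b ∈ B) : Reach 1 B {a * b} :=
  .mul ha hb (.done (by simp))

end Reach

/-! ## Types made of wires -/

/-- A type of values that are carried by wires. -/
class Wires (X : Type) where
  /-- the bits that a value consists of -/
  wires : Set (X → F2)

/-- A bit of a value is a function on its type. A program with inputs in `X` thus lives in the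
commutative ring `X → F2` and starts from the coordinate functions. -/
instance : Wires F2 := ⟨{id}⟩

instance {X Y : Type} [Wires X] [Wires Y] : Wires (X × Y) :=
  ⟨((fun w => w ∘ Prod.fst) '' Wires.wires) ∪ ((fun w => w ∘ Prod.snd) '' Wires.wires)⟩

instance {ι X : Type} [Wires X] : Wires (ι → X) :=
  ⟨⋃ i, (fun w => w ∘ fun x => x i) '' Wires.wires⟩

instance {a b : ℕ} : Wires (Matrix (Fin a) (Fin b) F2) :=
  inferInstanceAs (Wires (Fin a → Fin b → F2))

/-- Composition with a fixed map, as a ring homomorphism. -/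
def compHom {X Y : Type} (f : X → Y) : (Y → F2) →+* (X → F2) where
  toFun w := w ∘ f
  map_one' := rfl
  map_mul' _ _ := rfl
  map_zero' := rfl
  map_add' _ _ := rfl

theorem compHom_comp {X Y Z : Type} (f : X → Y) (g : Y → Z) (s : Set (Z → F2)) :
    compHom f '' (compHom g '' s) = compHom (g ∘ f) '' s := by
  rw [Set.image_image]; rfl

/-- The map `F` is computed by a straight-line program with `N` operations. -/
def DetC {X Y : Type} [Wires X] [Wires Y] (N : ℕ) (F : X → Y) : Prop :=
  Reach N Wires.wires (compHom F '' Wires.wires)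

namespace DetC

variable {X Y Z : Type} [Wires X] [Wires Y] [Wires Z] {N M : ℕ}

theorem mono {F : X → Y} (h : DetC N F) (hN : N ≤ M) : DetC M F :=
  Reach.mono h hN subset_rfl subset_rfl

/-- Precomposition with `F` is a ring homomorphism, so it turns the program for `G` into one that
starts from the output bits of `F`. -/
theorem comp {F : X → Y} {G : Y → Z} (hG : DetC M G) (hF : DetC N F) :
    DetC (N + M) fun x => G (F x) := by
  refine Reach.trans hF ?_
  have := Reach.map (compHom F) hG
  rw [compHom_comp] at this
  exact this.mono le_rfl Set.subset_union_right subset_rfl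

theorem prod {F : X → Y} {G : X → Z} (hF : DetC N F) (hG : DetC M G) :
    DetC (N + M) fun x => (F x, G x) := by
  refine (Reach.union hF hG).mono le_rfl subset_rfl ?_
  rintro _ ⟨w, ⟨w, hw, rfl⟩ | ⟨w, hw, rfl⟩, rfl⟩
  · exact Or.inl ⟨w, hw, rfl⟩
  · exact Or.inr ⟨w, hw, rfl⟩

theorem pi {ι : Type} [Fintype ι] {F : X → ι → Y} (h : ∀ i, DetC N fun x => F x i) :
    DetC (Fintype.card ι * N) F := by
  refine (Reach.iUnion h).mono le_rfl subset_rfl ?_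
  rintro _ ⟨w, hw, rfl⟩
  obtain ⟨i, v, hv, rfl⟩ := Set.mem_iUnion.1 hw
  exact Set.mem_iUnion.2 ⟨i, v, hv, rfl⟩

/-- Families of maps without operations. -/
theorem pi_zero {ι : Type} [Fintype ι] {F : X → ι → Y} (h : ∀ i, DetC 0 fun x => F x i) :
    DetC 0 F := by
  simpa using pi h

theorem pi_fin {a : ℕ} {F : X → Fin a → Y} (h : ∀ i, DetC N fun x => F x i) :
    DetC (a * N) F := by
  simpa using pi h

theorem mat {a b : ℕ} {F : X → Matrix (Fin a) (Fin b) F2}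
    (h : ∀ i j, DetC N fun x => F x i j) : DetC (a * (b * N)) F :=
  pi_fin (F := F) fun i => pi_fin fun j => h i j

theorem id : DetC 0 fun x : X => x := .done (by
  rintro _ ⟨w, hw, rfl⟩
  exact hw)

theorem fst : DetC 0 (Prod.fst : X × Y → X) := .done (by
  rintro _ ⟨w, hw, rfl⟩
  exact Or.inl ⟨w, hw, rfl⟩)

theorem snd : DetC 0 (Prod.snd : X × Y → Y) := .done (by
  rintro _ ⟨w, hw, rfl⟩
  exact Or.inr ⟨w, hw, rfl⟩)

theorem eval {ι : Type} (i : ι) : DetC 0 fun x : ι → X => x i := .done (by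
  rintro _ ⟨w, hw, rfl⟩
  exact Set.mem_iUnion.2 ⟨i, w, hw, rfl⟩)

theorem comp_zero {F : X → Y} {G : Y → Z} (hG : DetC M G) (hF : DetC 0 F) :
    DetC M fun x => G (F x) := by
  simpa using hG.comp hF

theorem app {ι : Type} {F : X → ι → Y} (h : DetC N F) (i : ι) : DetC N fun x => F x i :=
  (eval i).comp h

theorem entry {a b : ℕ} {F : X → Matrix (Fin a) (Fin b) F2} (h : DetC N F) (i : Fin a)
    (j : Fin b) : DetC N fun x => F x i j :=
  (show DetC N (fun x i => F x i) from h).app i |>.app j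

/-- Sharing of an intermediate value. -/
theorem letC {F : X → Y} {G : X × Y → Z} (hF : DetC N F) (hG : DetC M G) :
    DetC (N + M) fun x => G (x, F x) := by
  have := hG.comp (id.prod hF)
  simpa using this

theorem bit_iff {f : X → F2} : DetC N f ↔ Reach N Wires.wires {f} := by
  have : compHom f '' (Wires.wires : Set (F2 → F2)) = {f} := by
    change compHom f '' {_root_.id} = _
    rw [Set.image_singleton]; rfl
  rw [DetC, this]

theorem one : DetC 1 fun _ : X => (1 : F2) := bit_iff.2 Reach.single_one

theorem add {f g : X → F2} (hf : DetC N f) (hg : DetC M g) :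
    DetC (N + M + 1) fun x => f x + g x := by
  rw [bit_iff] at *
  exact (hf.union hg).trans (Reach.single_add (a := f) (b := g) (by simp) (by simp))

theorem mul {f g : X → F2} (hf : DetC N f) (hg : DetC M g) :
    DetC (N + M + 1) fun x => f x * g x := by
  rw [bit_iff] at *
  exact (hf.union hg).trans (Reach.single_mul (a := f) (b := g) (by simp) (by simp))

theorem zero : DetC 3 fun _ : X => (0 : F2) := by
  -- `0` is obtained as `1 + 1`: two constants and one sum.
  have := (one (X := X)).add one
  exact this

theorem const (c : F2) : DetC 3 fun _ : X => c := by
  fin_cases c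
  · exact zero
  · exact one.mono (by norm_num)

theorem sum {ι : Type} (s : Finset ι) {f : ι → X → F2} (h : ∀ i ∈ s, DetC N (f i)) :
    DetC (s.card * (N + 1) + 3) fun x => ∑ i ∈ s, f i x := by
  classical
  induction s using Finset.induction_on with
  | empty => simpa using zero
  | insert i s hi ih =>
    simp only [Finset.sum_insert hi, Finset.card_insert_of_notMem hi]
    exact ((h i (Finset.mem_insert_self _ _)).add
      (ih fun j hj => h j (Finset.mem_insert_of_mem hj))).mono (by ring_nf; omega)

theorem finProd {ι : Type} (s : Finset ι) {f : ι → X → F2} (h : ∀ i ∈ s, DetC N (f i)) :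
    DetC (s.card * (N + 1) + 1) fun x => ∏ i ∈ s, f i x := by
  classical
  induction s using Finset.induction_on with
  | empty => simpa using one
  | insert i s hi ih =>
    simp only [Finset.prod_insert hi, Finset.card_insert_of_notMem hi]
    exact ((h i (Finset.mem_insert_self _ _)).mul
      (ih fun j hj => h j (Finset.mem_insert_of_mem hj))).mono (by ring_nf; omega)

/-- The condition does not depend on the input, so the choice is made when the program is written
and costs no operation. -/
theorem ite {f g : X → F2} (c : Prop) [Decidable c] (hf : DetC N f) (hg : DetC N g) :
    DetC N fun x => if c then f x else g x := by
  split_ifs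
  · exact hf
  · exact hg

end DetC

/-! ## Sampling with coins -/

/-- The randomized map `f` is computed by tossing at most `N` coins and a straight-line program
with at most `N` operations. -/
def Samp {X Y : Type} [Wires X] [Wires Y] (N : ℕ) (f : X → PMF Y) : Prop :=
  ∃ (ι : Type) (_ : Fintype ι) (q : ι → ℝ) (F : X × (ι → F2) → Y),
    Fintype.card ι ≤ N ∧ DetC N F ∧
      ∀ x, f x = (piPMF fun i => ber (q i)).map fun ω => F (x, ω)

namespace Samp

variable {X Y Z : Type} [Wires X] [Wires Y] [Wires Z] {N M : ℕ}

theorem mono {f : X → PMF Y} (h : Samp N f) (hN : N ≤ M) : Samp M f := by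
  obtain ⟨ι, hι, q, F, h1, h2, h3⟩ := h
  exact ⟨ι, hι, q, F, h1.trans hN, h2.mono hN, h3⟩

theorem det {F : X → Y} (h : DetC N F) : Samp N fun x => PMF.pure (F x) := by
  refine ⟨Empty, inferInstance, Empty.elim, fun y => F y.1, by simp, h.comp_zero .fst,
    fun x => ?_⟩
  exact (PMF.map_const _ _).symm

theorem coin (q : ℝ) : Samp 1 fun _ : X => ber q := by
  refine ⟨Unit, inferInstance, fun _ => q, fun y => y.2 (), by simp,
    ((DetC.eval ()).comp_zero .snd).mono zero_le_one, fun x => ?_⟩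
  exact (piPMF_eval (fun _ : Unit => ber q) ()).symm

/-- The two stages toss disjoint sets of coins, which are independent by `piPMF_sum`. -/
theorem bind {f : X → PMF Y} {g : X × Y → PMF Z} (hf : Samp N f) (hg : Samp M g) :
    Samp (N + M) fun x => (f x).bind fun y => g (x, y) := by
  obtain ⟨ι, hι, q, F, h1, h2, h3⟩ := hf
  obtain ⟨κ, hκ, r, G, g1, g2, g3⟩ := hg
  have ha : DetC 0 fun z : X × (ι ⊕ κ → F2) => fun i => z.2 (Sum.inl i) :=
    .pi_zero fun i => (DetC.eval (Sum.inl i)).comp_zero .snd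
  have hb : DetC 0 fun z : X × (ι ⊕ κ → F2) => fun i => z.2 (Sum.inr i) :=
    .pi_zero fun i => (DetC.eval (Sum.inr i)).comp_zero .snd
  refine ⟨ι ⊕ κ, inferInstance, Sum.elim q r, fun z => G ((z.1, F (z.1, fun i => z.2 (Sum.inl i))),
    fun i => z.2 (Sum.inr i)), ?_, ?_, fun x => ?_⟩
  · simpa using Nat.add_le_add h1 g1
  · have hF := h2.comp_zero (DetC.fst.prod ha)
    have := g2.comp ((DetC.fst.prod hF).prod hb)
    simpa using this
  · have := piPMF_sum fun i => ber (Sum.elim q r i)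
    simp only [Sum.elim_inl, Sum.elim_inr] at this
    rw [show (fun ω : ι ⊕ κ → F2 => G ((x, F (x, fun i => ω (Sum.inl i))),
      fun i => ω (Sum.inr i))) = (fun p : (ι → F2) × (κ → F2) => G ((x, F (x, p.1)), p.2)) ∘
        fun ω => (fun i => ω (Sum.inl i), fun i => ω (Sum.inr i)) from rfl, ← PMF.map_comp, this,
      PMF.map_bind]
    simp only [h3, PMF.bind_map, PMF.map_comp, Function.comp_def, g3]

theorem comp {f : Y → PMF Z} {F : X → Y} (hf : Samp M f) (hF : DetC N F) :
    Samp (N + M) fun x => f (F x) := by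
  obtain ⟨ι, hι, q, G, h1, h2, h3⟩ := hf
  have ha : DetC N fun z : X × (ι → F2) => F z.1 := hF.comp_zero .fst
  refine ⟨ι, hι, q, fun z => G (F z.1, z.2), by omega, ?_, fun x => h3 _⟩
  have := h2.comp (ha.prod .snd)
  exact this

theorem comp_zero {f : Y → PMF Z} {F : X → Y} (hf : Samp M f) (hF : DetC 0 F) :
    Samp M fun x => f (F x) := by
  simpa using hf.comp hF

theorem pi {ι : Type} [Fintype ι] [Finite Y] {f : ι → X → PMF Y} (h : ∀ i, Samp N (f i)) :
    Samp (Fintype.card ι * N) fun x => piPMF fun i => f i x := by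
  have := Fintype.ofFinite Y
  choose κ hκ q F h1 h2 h3 using h
  have ha : ∀ i, DetC 0 fun z : X × ((Σ i, κ i) → F2) => fun j => z.2 ⟨i, j⟩ := fun i =>
    .pi_zero fun j => (DetC.eval (⟨i, j⟩ : Σ i, κ i)).comp_zero .snd
  refine ⟨Σ i, κ i, inferInstance, fun s => q s.1 s.2, fun z i => F i (z.1, fun j => z.2 ⟨i, j⟩),
    ?_, ?_, fun x => ?_⟩
  · rw [Fintype.card_sigma]
    exact (Finset.sum_le_card_nsmul _ _ N fun i _ => h1 i).trans (by simp)
  · exact DetC.pi fun i => (h2 i).comp_zero (DetC.fst.prod (ha i))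
  · classical
    have := piPMF_sigma fun s : Σ i, κ i => ber (q s.1 s.2)
    simp only [h3]
    rw [← piPMF_map, ← this, PMF.map_comp]
    rfl

theorem pi_fin {a : ℕ} [Finite Y] {f : Fin a → X → PMF Y} (h : ∀ i, Samp N (f i)) :
    Samp (a * N) fun x => piPMF fun i => f i x := by
  simpa using pi h

theorem ber_str (q : ℝ) (n : ℕ) : Samp n fun _ : X => berStr q n := by
  simp only [berStr_eq]
  simpa using pi_fin (a := n) fun _ => coin (X := X) q

theorem uniform_str (n : ℕ) : Samp n fun _ : X => uniformStr n := by
  simp only [uniformStr_eq]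
  simpa using pi_fin (a := n) fun _ => coin (X := X) (1 / 2)

theorem uniform_mat (a b : ℕ) :
    Samp (a * b) fun _ : X => PMF.uniformOfFintype (Matrix (Fin a) (Fin b) F2) := by
  simp only [uniformMat_eq]
  exact pi_fin (a := a) fun _ => uniform_str (X := X) b

end Samp

/-! ## From straight-line programs to circuits -/

theorem runGates_append (O : Oracle) (g₁ g₂ : List Gate) (w : List F2) :
    runGates O (g₁ ++ g₂) w = (runGates O g₁ w).bind (runGates O g₂) := by
  induction g₁ generalizing w with
  | nil => simp [runGates]
  | cons g gs ih => simp only [List.cons_append, runGates, ih, PMF.bind_bind]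

theorem getD_map_of_getElem? {Ω : Type} {W : List (Ω → F2)} {i : ℕ} {a : Ω → F2}
    (h : W[i]? = some a) (ω : Ω) : (W.map fun f => f ω).getD i 0 = a ω := by
  rw [List.getD_eq_getElem?_getD, List.getElem?_map, h]
  rfl

/-- A straight-line program as a list of gates that acts on the wires in `W`. -/
theorem exists_gates_of_reach {Ω : Type} {N : ℕ} {B F : Set (Ω → F2)} (h : Reach N B F)
    (W : List (Ω → F2)) (hW : ∀ b ∈ B, b ∈ W) :
    ∃ (gs : List Gate) (W' : List (Ω → F2)), (gs.map Gate.cost).sum ≤ N ∧ (∀ f ∈ F, f ∈ W') ∧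
      ∀ O ω, runGates O gs (W.map fun f => f ω) = PMF.pure (W'.map fun f => f ω) := by
  have step : ∀ (g : Gate) (c : Ω → F2) (B : Set (Ω → F2)) (N : ℕ) (W : List (Ω → F2)),
      (∀ b ∈ B, b ∈ W) → g.cost = 1 →
      (∀ O ω, g.step O (W.map fun f => f ω) = PMF.pure ((W ++ [c]).map fun f => f ω)) →
      (∀ W : List (Ω → F2), (∀ b ∈ insert c B, b ∈ W) →
        ∃ (gs : List Gate) (W' : List (Ω → F2)), (gs.map Gate.cost).sum ≤ N ∧
          (∀ f ∈ F, f ∈ W') ∧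
          ∀ O ω, runGates O gs (W.map fun f => f ω) = PMF.pure (W'.map fun f => f ω)) →
      ∃ (gs : List Gate) (W' : List (Ω → F2)), (gs.map Gate.cost).sum ≤ N + 1 ∧
        (∀ f ∈ F, f ∈ W') ∧
        ∀ O ω, runGates O gs (W.map fun f => f ω) = PMF.pure (W'.map fun f => f ω) := by
    intro g c B N W hW hc hg ih
    obtain ⟨gs, W', h1, h2, h3⟩ := ih (W ++ [c]) (by
      rintro b (rfl | hb)
      · simp
      · exact List.mem_append_left _ (hW b hb))
    refine ⟨g :: gs, W', ?_, h2, fun O ω => ?_⟩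
    · simp only [List.map_cons, List.sum_cons, hc]; omega
    · rw [runGates, hg, PMF.pure_bind, h3]
  induction h generalizing W with
  | done h => exact ⟨[], W, by simp, fun f hf => hW f (h hf), fun O ω => rfl⟩
  | one _ ih =>
    exact step .one 1 _ _ W hW rfl (fun O ω => by simp [Gate.step]) (ih · · step)
  | @add N B F a b ha hb _ ih =>
    obtain ⟨i, hi⟩ := List.getElem?_of_mem (hW a ha)
    obtain ⟨j, hj⟩ := List.getElem?_of_mem (hW b hb)
    exact step (.add i j) (a + b) _ _ W hW rfl (fun O ω => by
      simp only [Gate.step, getD_map_of_getElem? hi, getD_map_of_getElem? hj]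
      simp) (ih · · step)
  | @mul N B F a b ha hb _ ih =>
    obtain ⟨i, hi⟩ := List.getElem?_of_mem (hW a ha)
    obtain ⟨j, hj⟩ := List.getElem?_of_mem (hW b hb)
    exact step (.mul i j) (a * b) _ _ W hW rfl (fun O ω => by
      simp only [Gate.step, getD_map_of_getElem? hi, getD_map_of_getElem? hj]
      simp) (ih · · step)

theorem runGates_coins (O : Oracle) (m : ℕ) (q : Fin m → ℝ) (w : List F2) :
    runGates O (List.ofFn fun i => Gate.coin (q i)) w =
      (piPMF fun i => ber (q i)).map fun ω => w ++ List.ofFn ω := by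
  induction m generalizing w with
  | zero =>
    have : (fun ω : Fin 0 → F2 => w ++ List.ofFn ω) = Function.const _ w := by
      funext ω; simp
    rw [this, PMF.map_const]
    simp [runGates]
  | succ m ih =>
    rw [List.ofFn_succ, runGates, Gate.step, PMF.bind_map, piPMF_cons, PMF.map_bind]
    congr 1
    funext b
    rw [Function.comp_apply, ih, PMF.map_comp]
    congr 1
    funext ω
    simp [List.ofFn_succ]

/-- Circuits for efficiently samplable maps on strings. -/
theorem Samp.exists_circuit {k o N : ℕ} {f : Str k → PMF (Str o)} (h : Samp N f) :
    ∃ C : Circuit, C.size ≤ 2 * N + o ∧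
      ∀ O x, C.eval O (List.ofFn x) = (f x).map List.ofFn := by
  obtain ⟨ι, hι, q, F, h1, h2, h3⟩ := h
  let e := Fintype.equivFin ι
  set m := Fintype.card ι
  let Φ : Str k × Str m → Str o := fun z => F (z.1, fun i => z.2 (e i))
  have hΦ : DetC N Φ := h2.comp_zero
    (DetC.fst.prod (.pi_zero fun i => (DetC.eval (e i)).comp_zero .snd))
  -- The wires once the coin gates have run: the input bits, then the coins, enumerated by `e`.
  let W : List (Str k × Str m → F2) :=
    (List.ofFn fun i : Fin k => fun z : Str k × Str m => z.1 i) ++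
      List.ofFn fun i : Fin m => fun z : Str k × Str m => z.2 i
  obtain ⟨gs, W', g1, g2, g3⟩ := exists_gates_of_reach hΦ W (by
    rintro _ (⟨w, hw, rfl⟩ | ⟨w, hw, rfl⟩) <;>
    · obtain ⟨i, v, hv, rfl⟩ := Set.mem_iUnion.1 hw
      obtain rfl : v = _root_.id := hv
      simp only [W, List.mem_append, List.mem_ofFn]
      first
      | exact Or.inl ⟨i, rfl⟩
      | exact Or.inr ⟨i, rfl⟩)
  have hidx : ∀ j : Fin o, ∃ i, W'[i]? = some fun z => Φ z j := fun j =>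
    List.getElem?_of_mem (g2 _ ⟨fun y => y j, Set.mem_iUnion.2 ⟨j, _root_.id, rfl, rfl⟩, rfl⟩)
  choose idx hidx using hidx
  refine ⟨⟨(List.ofFn fun i => Gate.coin (q (e.symm i))) ++ gs, List.ofFn idx⟩, ?_, fun O x => ?_⟩
  · have : ((List.ofFn fun i : Fin m => Gate.coin (q (e.symm i))).map Gate.cost).sum = m := by
      simp [List.map_ofFn, Function.comp_def, Gate.cost]
    simp only [Circuit.size, List.map_append, List.sum_append, this, List.length_ofFn]
    omega
  · have hre := piPMF_reindex e.symm.symm fun i => ber (q (e.symm i))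
    simp only [Equiv.symm_symm, Equiv.symm_apply_apply] at hre
    rw [h3, ← hre]
    simp only [Circuit.eval, runGates_append, runGates_coins, PMF.map_comp, PMF.bind_map,
      PMF.map_bind]
    rw [← PMF.bind_pure_comp]
    congr 1
    funext ω
    have hw : List.ofFn x ++ List.ofFn ω = W.map fun f => f (x, ω) := by
      simp [W, List.map_ofFn, Function.comp_def]
    simp only [Function.comp_apply]
    rw [hw, g3, PMF.pure_map, readWires, List.map_ofFn]
    congr 2
    funext j
    exact getD_map_of_getElem? (hidx j) _


/-! ## Sampling sparse vectors -/

theorem F2_cases (b : F2) : b = 0 ∨ b = 1 := by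
  fin_cases b
  · exact Or.inl rfl
  · exact Or.inr rfl

theorem ber_one {q : ℝ} (hq : q ≤ 1) : ber q 1 = ENNReal.ofReal q := by
  simp only [ber, PMF.ofFintype_apply, if_true]
  exact min_eq_left (by rwa [ENNReal.ofReal_le_one])

theorem ber_zero {q : ℝ} (h0 : 0 ≤ q) (hq : q ≤ 1) : ber q 0 = ENNReal.ofReal (1 - q) := by
  simp only [ber, PMF.ofFintype_apply, zero_ne_one, if_false]
  rw [min_eq_left (by rwa [ENNReal.ofReal_le_one]), ENNReal.ofReal_sub _ h0, ENNReal.ofReal_one]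

theorem hammingNorm_cons {n : ℕ} (b : F2) (v : Str n) :
    hammingNorm (Fin.cons b v : Str (n + 1)) = (if b = 1 then 1 else 0) + hammingNorm v := by
  simp only [hammingNorm, Finset.card_filter, Fin.sum_univ_succ, Fin.cons_zero, Fin.cons_succ]
  congr 1
  rcases F2_cases b with rfl | rfl <;> simp

/-- Sequential sampling of a `c`-sparse vector: among the `n + 1` remaining positions the first one
belongs to the support with probability `c / (n + 1)`. -/
def seqSparse : (n : ℕ) → ℕ → PMF (Str n)
  | 0, _ => PMF.pure Fin.elim0
  | n + 1, c => (ber ((c : ℝ) / (n + 1 : ℕ))).bind fun b =>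
      (seqSparse n (if b = 1 then c - 1 else c)).map fun v => Fin.cons b v

theorem map_cons_apply {n : ℕ} (μ : PMF (Str n)) (b b' : F2) (v : Str n) :
    (μ.map fun v => (Fin.cons b v : Str (n + 1))) (Fin.cons b' v) = if b' = b then μ v else 0 := by
  classical
  rw [PMF.map_apply, tsum_eq_single v]
  · simp only [Fin.cons_inj, and_true]
  · intro v' hv
    rw [if_neg]
    intro h
    exact hv (Fin.cons_inj.1 h).2.symm

/-- Induction on the length: the factors (n+1-c)/(n+1) and c/(n+1) for a first bit 0 or 1 are the
ratios C(n,c)/C(n+1,c) and C(n,c-1)/C(n+1,c). The hypothesis `hc` keeps the bias in [0,1]. -/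
theorem seqSparse_apply {n c : ℕ} (hc : c ≤ n) (v : Str n) :
    seqSparse n c v = if hammingNorm v = c then ENNReal.ofReal (1 / (n.choose c : ℝ)) else 0 := by
  induction n generalizing c with
  | zero =>
    obtain rfl : c = 0 := by omega
    rw [seqSparse, PMF.pure_apply, if_pos (Subsingleton.elim _ _), if_pos (by simp [hammingNorm])]
    simp
  | succ n ih =>
    obtain ⟨b, v, rfl⟩ : ∃ b w, v = (Fin.cons b w : Str (n + 1)) :=
      ⟨v 0, Fin.tail v, (Fin.cons_self_tail v).symm⟩
    have hn : (0 : ℝ) < (n + 1 : ℕ) := by positivity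
    have hq0 : 0 ≤ (c : ℝ) / (n + 1 : ℕ) := by positivity
    have hq1 : (c : ℝ) / (n + 1 : ℕ) ≤ 1 := by
      rw [div_le_one hn]; exact_mod_cast hc
    have hu : (Finset.univ : Finset F2) = {0, 1} := by decide
    rw [seqSparse, PMF.bind_apply, tsum_fintype, hu, Finset.sum_pair (by decide),
      map_cons_apply, map_cons_apply, hammingNorm_cons, ber_one hq1, ber_zero hq0 hq1]
    have hCpos : (0 : ℝ) < ((n + 1).choose c : ℝ) := by exact_mod_cast Nat.choose_pos hc
    rcases F2_cases b with rfl | rfl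
    · simp only [if_true, zero_ne_one, if_false, mul_zero, add_zero, zero_add]
      -- If c = n+1, the first bit is 1 with certainty and a vector starting with 0 cannot reach
      -- weight c; the induction hypothesis is not available there.
      rcases Nat.lt_or_ge n c with h | h
      · obtain rfl : c = n + 1 := by omega
        rw [div_self hn.ne', sub_self, ENNReal.ofReal_zero, zero_mul, if_neg]
        have := hammingNorm_le_card_fintype (x := v)
        rw [Fintype.card_fin] at this
        omega
      · rw [ih h]
        split_ifs
        · rw [← ENNReal.ofReal_mul (by linarith)]
          congr 1
          have h1 := Nat.choose_mul_succ_eq n c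
          have hpos : (0 : ℝ) < (n.choose c : ℝ) := by exact_mod_cast Nat.choose_pos h
          have h2 : (n.choose c : ℝ) * (n + 1 : ℕ) = ((n + 1).choose c : ℝ) * ((n + 1 : ℕ) - c) := by
            rw [← Nat.cast_sub (by omega)]; exact_mod_cast h1
          field_simp
          linarith
        · simp
    · simp only [one_ne_zero, if_false, mul_zero, zero_add, if_true]
      rcases Nat.eq_zero_or_pos c with rfl | h
      · simp
      · obtain ⟨k, rfl⟩ : ∃ k, c = k + 1 := ⟨c - 1, by omega⟩
        rw [Nat.add_sub_cancel, ih (by omega)]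
        have : 1 + hammingNorm v = k + 1 ↔ hammingNorm v = k := by omega
        simp only [this]
        split_ifs
        · rw [← ENNReal.ofReal_mul hq0]
          congr 1
          have h1 := Nat.add_one_mul_choose_eq n k
          have hpos : (0 : ℝ) < (n.choose k : ℝ) := by
            exact_mod_cast Nat.choose_pos (by omega)
          have h2 : ((n + 1 : ℕ) : ℝ) * n.choose k = ((n + 1).choose (k + 1) : ℝ) * (k + 1 : ℕ) := by
            exact_mod_cast h1
          field_simp
          linarith
        · simp

theorem mem_sparseVecs {t n : ℕ} {v : Str n} : v ∈ sparseVecs t n ↔ hammingNorm v = t := by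
  simp [sparseVecs]

/-- Read off from the sampler: it gives each sparse vector mass 1/C(n,t), and the masses add up to
1. -/
theorem card_sparseVecs {t n : ℕ} (h : t ≤ n) : (sparseVecs t n).card = n.choose t := by
  have h1 := pmf_sum_eq_one (seqSparse n t)
  simp only [seqSparse_apply h] at h1
  rw [← Finset.sum_filter, Finset.sum_const, nsmul_eq_mul] at h1
  have hpos : (0 : ℝ) < (n.choose t : ℝ) := by exact_mod_cast Nat.choose_pos h
  change ((sparseVecs t n).card : ENNReal) * _ = 1 at h1
  rw [← ENNReal.ofReal_natCast, ← ENNReal.ofReal_mul (by positivity), ENNReal.ofReal_eq_one] at h1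
  field_simp at h1
  exact_mod_cast h1

theorem sparseVecs_nonempty {t n : ℕ} (h : t ≤ n) : (sparseVecs t n).Nonempty := by
  rw [← Finset.card_pos, card_sparseVecs h]
  exact Nat.choose_pos h

theorem seqSparse_eq {t n : ℕ} (h : t ≤ n) : seqSparse n t = uniformOn (sparseVecs t n) := by
  ext v
  rw [seqSparse_apply h, uniformOn_apply (sparseVecs_nonempty h), card_sparseVecs h]
  simp only [mem_sparseVecs]
  rw [one_div, ENNReal.ofReal_inv_of_pos (by exact_mod_cast Nat.choose_pos h),
    ENNReal.ofReal_natCast]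

theorem sparseMats_eq (t r n : ℕ) :
    sparseMats t r n = Fintype.piFinset fun _ : Fin r => sparseVecs t n := by
  ext P
  refine Iff.trans ?_ (Fintype.mem_piFinset (f := P)).symm
  simp [sparseMats, sparseVecs]

theorem uniformOn_sparseMats {t n : ℕ} (r : ℕ) (h : t ≤ n) :
    uniformOn (sparseMats t r n) = piPMF fun _ : Fin r => uniformOn (sparseVecs t n) := by
  rw [piPMF_uniformOn _ fun _ => sparseVecs_nonempty h, sparseMats_eq]
  rfl

/-- The one-hot representation of the counter of `seqSparse` after one step. -/
def nextCounter {T : ℕ} (s b : Fin (T + 1) → F2) : Fin (T + 1) → F2 := fun c =>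
  ∑ d, s d * ((if (c : ℕ) = d - 1 then b d else 0) + if c = d then 1 + b d else 0)

/-- `seqSparse` with the counter in one-hot representation. -/
def oneHotSparse (T : ℕ) : (n : ℕ) → (Fin (T + 1) → F2) → PMF (Str n)
  | 0, _ => PMF.pure Fin.elim0
  | n + 1, s => (piPMF fun c : Fin (T + 1) => ber (((c : ℕ) : ℝ) / (n + 1 : ℕ))).bind fun b =>
      (oneHotSparse T n (nextCounter s b)).map fun v => Fin.cons (∑ c, s c * b c) v

/-- A gate's coin has a fixed bias, which cannot follow a counter on wires. Hence one coin is tossed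
for every value the counter may have, and the one-hot state selects the relevant one; the others are
marginalized away by `piPMF_eval`. -/
theorem oneHotSparse_single (T n : ℕ) (c : Fin (T + 1)) :
    oneHotSparse T n (Pi.single c 1) = seqSparse n c := by
  induction n generalizing c with
  | zero => rfl
  | succ n ih =>
    rw [oneHotSparse, seqSparse,
      ← piPMF_eval (fun c : Fin (T + 1) => ber (((c : ℕ) : ℝ) / (n + 1 : ℕ))) c, PMF.bind_map]
    congr 1
    funext b
    have h1 : ∑ d, (Pi.single c 1 : Fin (T + 1) → F2) d * b d = b c := by
      simp [Pi.single_apply]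
    have h2 : nextCounter (Pi.single c 1) b =
        Pi.single (if b c = 1 then ⟨c - 1, by omega⟩ else c) 1 := by
      funext d
      simp only [nextCounter, Pi.single_apply, ite_mul, one_mul, zero_mul, Finset.sum_ite_eq',
        Finset.mem_univ, if_true]
      rcases F2_cases (b c) with h | h
      · simp [h]
      · simp only [h, if_true, Fin.ext_iff]
        rw [show (1 : F2) + 1 = 0 from rfl, ite_self, add_zero]
    rw [h1, h2, ih, Function.comp_apply]
    congr 2
    split_ifs <;> rfl

theorem DetC.cons {X : Type} [Wires X] {n N M : ℕ} {f : X → F2} {v : X → Str n}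
    (hf : DetC N f) (hv : DetC M v) : DetC (N + M) fun x => (Fin.cons (f x) (v x) : Str (n + 1)) := by
  have h : DetC 0 fun p : F2 × Str n => (Fin.cons p.1 p.2 : Str (n + 1)) :=
    .pi_zero fun i => by
      cases i using Fin.cases with
      | zero => exact DetC.fst
      | succ i => exact DetC.snd.app i
  simpa using h.comp (hf.prod hv)

theorem samp_oneHotSparse (T n : ℕ) :
    Samp (n * (20 * (T + 1) ^ 2)) (oneHotSparse T n) := by
  induction n with
  | zero => exact (Samp.det (DetC.pi_zero fun i => i.elim0)).mono (Nat.zero_le _)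
  | succ n ih =>
    have hcoin : Samp (T + 1) fun _ : Fin (T + 1) → F2 =>
        piPMF fun c : Fin (T + 1) => ber (((c : ℕ) : ℝ) / (n + 1 : ℕ)) := by
      simpa using Samp.pi_fin (X := Fin (T + 1) → F2)
        fun c : Fin (T + 1) => Samp.coin (((c : ℕ) : ℝ) / (n + 1 : ℕ))
    have hx : DetC ((T + 1) * 2 + 3) fun z : (Fin (T + 1) → F2) × (Fin (T + 1) → F2) =>
        ∑ c, z.1 c * z.2 c := by
      have : ∀ c ∈ Finset.univ, DetC (0 + 0 + 1)
          fun z : (Fin (T + 1) → F2) × (Fin (T + 1) → F2) => z.1 c * z.2 c :=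
        fun c _ => (DetC.fst.app c).mul (DetC.snd.app c)
      simpa using DetC.sum Finset.univ this
    have hs : DetC ((T + 1) * ((T + 1) * 9 + 3))
        fun z : (Fin (T + 1) → F2) × (Fin (T + 1) → F2) => nextCounter z.1 z.2 := by
      refine DetC.pi_fin fun c => ?_
      have : ∀ d ∈ Finset.univ, DetC (0 + (3 + 3 + 1) + 1)
          fun z : (Fin (T + 1) → F2) × (Fin (T + 1) → F2) =>
          z.1 d * ((if (c : ℕ) = d - 1 then z.2 d else 0) + if c = d then 1 + z.2 d else 0) :=
        fun d _ => (DetC.fst.app d).mul (DetC.add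
          (.ite _ ((DetC.snd.app d).mono (Nat.zero_le _)) .zero)
          (.ite _ ((DetC.one.add (DetC.snd.app d)).mono (by norm_num)) .zero))
      simpa [nextCounter] using DetC.sum Finset.univ this
    have hstep := hcoin.bind ((ih.comp hs).bind
      (.det ((hx.comp_zero .fst).cons DetC.snd)))
    refine Samp.mono ?_ (show (T + 1) + (((T + 1) * ((T + 1) * 9 + 3) + n * (20 * (T + 1) ^ 2)) +
      ((T + 1) * 2 + 3 + 0)) ≤ _ from ?_)
    · exact (funext fun s => rfl : oneHotSparse T (n + 1) = _) ▸ hstep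
    · nlinarith

theorem samp_sparseVecs {X : Type} [Wires X] {t n : ℕ} (h : t ≤ n) :
    Samp (3 * (t + 1) + n * (20 * (t + 1) ^ 2)) fun _ : X => uniformOn (sparseVecs t n) := by
  have h1 : DetC ((t + 1) * 3) fun _ : X => (Pi.single (Fin.last t) 1 : Fin (t + 1) → F2) :=
    DetC.pi_fin fun i => .const _
  have h2 := (samp_oneHotSparse t n).comp h1
  simp only [oneHotSparse_single, Fin.val_last, seqSparse_eq h] at h2
  exact h2.mono (by rw [mul_comm 3])

theorem samp_sparseMats {X : Type} [Wires X] {t n : ℕ} (r : ℕ) (h : t ≤ n) :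
    Samp (r * (3 * (t + 1) + n * (20 * (t + 1) ^ 2)))
      fun _ : X => uniformOn (sparseMats t r n) := by
  rw [uniformOn_sparseMats r h]
  exact Samp.pi_fin fun _ => samp_sparseVecs h

/-! ## Linear algebra by straight-line programs -/

theorem DetC.matMul {X : Type} [Wires X] {a b c N M : ℕ} {F : X → Matrix (Fin a) (Fin b) F2}
    {G : X → Matrix (Fin b) (Fin c) F2} (hF : DetC N F) (hG : DetC M G) :
    DetC (N + M + a * (c * (b * 2 + 3))) fun x => F x * G x := by
  have h : DetC (a * (c * (b * 2 + 3))) fun p : Matrix (Fin a) (Fin b) F2 ×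
      Matrix (Fin b) (Fin c) F2 => p.1 * p.2 := by
    refine .mat fun i j => ?_
    simp only [Matrix.mul_apply]
    simpa using DetC.sum Finset.univ fun k _ => (DetC.fst.entry i k).mul (DetC.snd.entry k j)
  exact h.comp (hF.prod hG)

theorem DetC.mulVec {X : Type} [Wires X] {a b N M : ℕ} {F : X → Matrix (Fin a) (Fin b) F2}
    {v : X → Str b} (hF : DetC N F) (hv : DetC M v) :
    DetC (N + M + a * (b * 2 + 3)) fun x => F x *ᵥ v x := by
  have h : DetC (a * (b * 2 + 3)) fun p : Matrix (Fin a) (Fin b) F2 × Str b => p.1 *ᵥ p.2 := by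
    refine .pi_fin fun i => ?_
    simp only [Matrix.mulVec, dotProduct]
    simpa using DetC.sum Finset.univ fun k _ => (DetC.fst.entry i k).mul (DetC.snd.app k)
  exact h.comp (hF.prod hv)

theorem DetC.vecMul {X : Type} [Wires X] {a b N M : ℕ} {v : X → Str a}
    {F : X → Matrix (Fin a) (Fin b) F2} (hv : DetC N v) (hF : DetC M F) :
    DetC (N + M + b * (a * 2 + 3)) fun x => v x ᵥ* F x := by
  have h : DetC (b * (a * 2 + 3)) fun p : Str a × Matrix (Fin a) (Fin b) F2 => p.1 ᵥ* p.2 := by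
    refine .pi_fin fun i => ?_
    simp only [Matrix.vecMul, dotProduct]
    simpa using DetC.sum Finset.univ fun k _ => (DetC.fst.app k).mul (DetC.snd.entry k i)
  exact h.comp (hv.prod hF)

theorem DetC.vecAdd {X : Type} [Wires X] {a N M : ℕ} {v w : X → Str a}
    (hv : DetC N v) (hw : DetC M w) : DetC (N + M + a) fun x => v x + w x := by
  have h : DetC (a * 1) fun p : Str a × Str a => p.1 + p.2 :=
    .pi_fin fun i => (DetC.fst.app i).add (DetC.snd.app i)
  simpa using h.comp (hv.prod hw)

/-- The indicator of the first position with a nonzero entry. -/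
def firstOne {n : ℕ} (v : Str n) : Str n := fun p => v p * ∏ i with i < p, (1 + v i)

theorem firstOne_zero {n : ℕ} : firstOne (0 : Str n) = 0 := by
  funext p; simp [firstOne]

theorem exists_firstOne {n : ℕ} (v : Str n) :
    (v = 0 ∧ ∀ p, ∏ i with i < p, (1 + v i) = 1) ∨
      ∃ p, v p = 1 ∧ firstOne v = Pi.single p 1 := by
  by_cases h : ∃ p, v p = 1
  · right
    classical
    have hS : (Finset.univ.filter fun p => v p = 1).Nonempty := by
      obtain ⟨p, hp⟩ := h
      exact ⟨p, by simpa using hp⟩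
    set p := (Finset.univ.filter fun p => v p = 1).min' hS
    have hp : v p = 1 := by simpa using Finset.min'_mem _ hS
    have hlt : ∀ i, i < p → v i = 0 := by
      intro i hi
      rcases F2_cases (v i) with h | h
      · exact h
      · exact absurd (Finset.min'_le _ i (by simpa using h)) (not_le.2 hi)
    refine ⟨p, hp, ?_⟩
    funext q
    rw [firstOne, Pi.single_apply]
    rcases lt_trichotomy q p with h1 | rfl | h1
    · rw [hlt q h1, zero_mul, if_neg h1.ne]
    · rw [if_pos rfl, hp, one_mul]
      refine Finset.prod_eq_one fun i hi => ?_
      rw [hlt i (Finset.mem_filter.1 hi).2, add_zero]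
    · rw [if_neg h1.ne', Finset.prod_eq_zero (i := p) (by simpa using h1), mul_zero]
      rw [hp]; rfl
  · left
    have : v = 0 := by
      funext p
      rcases F2_cases (v p) with h1 | h1
      · exact h1
      · exact absurd ⟨p, h1⟩ h
    subst this
    simp

theorem detC_firstOne {n : ℕ} : DetC (n * (3 * n + 2)) (firstOne : Str n → Str n) := by
  refine .pi_fin fun p => ?_
  have h : DetC ((Finset.univ.filter fun i => i < p).card * (2 + 1) + 1)
      fun v : Str n => ∏ i with i < p, (1 + v i) :=
    DetC.finProd _ fun i _ => (DetC.one.add (.eval i)).mono (by norm_num)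
  refine ((DetC.eval p).mul h).mono ?_
  have := Finset.card_filter_le (Finset.univ : Finset (Fin n)) fun i => i < p
  rw [Finset.card_fin] at this
  omega

/-- If the columns of `N` span a space, then those of the new matrix span its part orthogonal
to `a`. -/
def projStep {n : ℕ} (N : Matrix (Fin n) (Fin n) F2) (a : Str n) : Matrix (Fin n) (Fin n) F2 :=
  N + Matrix.vecMulVec (N *ᵥ firstOne (a ᵥ* N)) (a ᵥ* N)

/-- A projection onto the kernel of `P`. -/
def kerProj {n : ℕ} : {r : ℕ} → Matrix (Fin r) (Fin n) F2 → Matrix (Fin n) (Fin n) F2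
  | 0, _ => 1
  | _ + 1, P => projStep (kerProj fun i => P i.succ) (P 0)

theorem F2_add_self (b : F2) : b + b = 0 := CharTwo.add_self_eq_zero b

theorem str_add_self {m : ℕ} (v : Str m) : v + v = 0 := funext fun i => F2_add_self (v i)

theorem mat_add_self {a b : ℕ} (v : Matrix (Fin a) (Fin b) F2) : v + v = 0 :=
  Matrix.ext fun i j => F2_add_self (v i j)

/-- With b = aN and f the indicator of the first 1 in b, the product is b + (b·f)b. If b ≠ 0, then
b·f = 1 and this is b + b = 0. -/
theorem vecMul_projStep_self {n : ℕ} (N : Matrix (Fin n) (Fin n) F2) (a : Str n) :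
    a ᵥ* projStep N a = 0 := by
  rw [projStep, Matrix.vecMul_add, Matrix.vecMul_vecMulVec, Matrix.dotProduct_mulVec]
  rcases exists_firstOne (a ᵥ* N) with ⟨h, -⟩ | ⟨p, hp, h⟩
  · rw [h]; simp
  · rw [h, dotProduct_single, hp]
    simpa using str_add_self (a ᵥ* N)

theorem vecMul_projStep {n : ℕ} {N : Matrix (Fin n) (Fin n) F2} (a : Str n) {b : Str n}
    (hb : b ᵥ* N = 0) : b ᵥ* projStep N a = 0 := by
  rw [projStep, Matrix.vecMul_add, Matrix.vecMul_vecMulVec, Matrix.dotProduct_mulVec, hb]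
  simp

/-- The correction term sends y to a multiple of Nf with coefficient aNy = a·y, which vanishes. -/
theorem projStep_mulVec {n : ℕ} {N : Matrix (Fin n) (Fin n) F2} {a y : Str n}
    (hy : N *ᵥ y = y) (ha : a ⬝ᵥ y = 0) : projStep N a *ᵥ y = y := by
  rw [projStep, Matrix.add_mulVec, Matrix.vecMulVec_mulVec, ← Matrix.dotProduct_mulVec, hy, ha]
  simp

theorem vecMul_kerProj {n r : ℕ} (P : Matrix (Fin r) (Fin n) F2) (i : Fin r) :
    P i ᵥ* kerProj P = 0 := by
  induction r with
  | zero => exact i.elim0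
  | succ r ih =>
    rw [kerProj]
    cases i using Fin.cases with
    | zero => exact vecMul_projStep_self _ _
    | succ i => exact vecMul_projStep _ (ih (fun i => P i.succ) i)

theorem mul_kerProj {n r : ℕ} (P : Matrix (Fin r) (Fin n) F2) : P * kerProj P = 0 := by
  ext i j
  exact congrFun (vecMul_kerProj P i) j

theorem kerProj_mulVec {n r : ℕ} {P : Matrix (Fin r) (Fin n) F2} {y : Str n}
    (hy : P *ᵥ y = 0) : kerProj P *ᵥ y = y := by
  induction r with
  | zero => simp [kerProj]
  | succ r ih =>
    rw [kerProj]
    refine projStep_mulVec (ih (funext fun i => congrFun hy i.succ)) (congrFun hy 0)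

theorem kerProj_mul {n r g : ℕ} {P : Matrix (Fin r) (Fin n) F2} {G : Matrix (Fin n) (Fin g) F2}
    (hG : P * G = 0) : kerProj P * G = G := by
  ext i j
  have h : P *ᵥ (fun k => G k j) = 0 := funext fun i => congrFun (congrFun hG i) j
  exact congrFun (kerProj_mulVec h) i

/-- `kerProj P` maps into the kernel of P and fixes it pointwise, so translation by Y exchanges the
fibres over 0 and over Y. No knowledge of the rank of P is needed. -/
theorem uniform_ker_eq {n r g : ℕ} (P : Matrix (Fin r) (Fin n) F2) :
    (PMF.uniformOfFintype (Matrix (Fin n) (Fin g) F2)).map (fun U => kerProj P * U) =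
      uniformOn ({G : Matrix (Fin n) (Fin g) F2 | P * G = 0} : Finset _) := by
  rw [uniformOfFintype_eq_uniformOn]
  refine map_uniformOn_of_involution _ Finset.univ_nonempty (fun U _ => ?_) 0 fun Y hY => ?_
  · simp [← Matrix.mul_assoc, mul_kerProj]
  · have hY : P * Y = 0 := by simpa using hY
    refine ⟨fun U => U + Y, fun U _ => ⟨Finset.mem_univ _, ?_, ?_, ?_⟩⟩
    · change U + Y + Y = U
      rw [add_assoc, mat_add_self, add_zero]
    · intro h
      rw [Matrix.mul_add, h, kerProj_mul hY, mat_add_self]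
    · intro h
      rw [Matrix.mul_add, h, kerProj_mul hY, zero_add]

theorem detC_projStep {n : ℕ} :
    DetC (30 * (n + 1) ^ 3) fun x : Matrix (Fin n) (Fin n) F2 × Str n => projStep x.1 x.2 := by
  have h1 := DetC.snd.vecMul (DetC.fst (X := Matrix (Fin n) (Fin n) F2) (Y := Str n))
  have h2 : DetC (n * (3 * n + 2) + n * (2 * n + 3))
      fun z : (Matrix (Fin n) (Fin n) F2 × Str n) × Str n => z.1.1 *ᵥ firstOne z.2 :=
    ((DetC.fst.comp_zero .fst).mulVec (detC_firstOne.comp_zero .snd)).mono (by ring_nf; omega)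
  have h3 : DetC (n * (n * 2)) fun z : ((Matrix (Fin n) (Fin n) F2 × Str n) × Str n) × Str n =>
      z.1.1.1 + Matrix.vecMulVec z.2 z.1.2 :=
    DetC.mat fun i j => ((DetC.fst.comp_zero (DetC.fst.comp_zero .fst)).entry i j).add
      ((DetC.snd.app i).mul ((DetC.snd.comp_zero .fst).app j))
  exact (h1.letC (h2.letC h3)).mono (by ring_nf; nlinarith [Nat.zero_le n, Nat.zero_le (n ^ 2)])

theorem detC_kerProj {r n : ℕ} :
    DetC ((r + 1) * (30 * (n + 1) ^ 3)) (kerProj : Matrix (Fin r) (Fin n) F2 → _) := by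
  induction r with
  | zero =>
    refine DetC.mono (DetC.mat fun i j => DetC.const _) (M := _) (N := n * (n * 3)) ?_
    nlinarith [Nat.zero_le (n ^ 3), Nat.zero_le n, Nat.zero_le (n ^ 2)]
  | succ r ih =>
    have h1 : DetC 0 fun P : Matrix (Fin (r + 1)) (Fin n) F2 =>
        (fun i => P i.succ : Matrix (Fin r) (Fin n) F2) :=
      .pi_zero fun i => .pi_zero fun j => DetC.id.entry i.succ j
    have h2 : DetC 0 fun P : Matrix (Fin (r + 1)) (Fin n) F2 => (P 0 : Str n) :=
      .pi_zero fun j => DetC.id.entry 0 j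
    exact (detC_projStep.comp ((ih.comp_zero h1).prod h2)).mono (by ring_nf; omega)

/-! ## Matrices that select a subspace of columns -/

/-- The indicator of a pivot position of `v`: the first nonzero entry, or the last position. -/
def pivotInd {k : ℕ} (v : Str (k + 1)) : Str (k + 1) := fun p =>
  firstOne v p + if p = Fin.last k then ∏ i, (1 + v i) else 0

theorem exists_pivotInd {k : ℕ} (v : Str (k + 1)) :
    ∃ p, pivotInd v = Pi.single p 1 ∧ (v = 0 ∨ v p = 1) := by
  rcases exists_firstOne v with ⟨rfl, -⟩ | ⟨p, hp, h⟩
  · refine ⟨Fin.last k, ?_, Or.inl rfl⟩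
    funext p
    simp [pivotInd, firstOne_zero, Pi.single_apply]
  · refine ⟨p, ?_, Or.inr hp⟩
    funext q
    have : ∏ i, (1 + v i) = 0 :=
      Finset.prod_eq_zero (Finset.mem_univ p) (by rw [hp]; rfl)
    simp [pivotInd, h, this]

/-- A matrix whose columns are linearly independent and orthogonal to `v`. -/
def orthStep {k : ℕ} (v : Str (k + 1)) : Matrix (Fin (k + 1)) (Fin k) F2 := fun i j =>
  ∑ p, pivotInd v p *
    ((if i = p then v (p.succAbove j) else 0) + if i = p.succAbove j then 1 else 0)

/-- The equation v·x = 0 is solved for the pivot variable: column j is the unit vector at the j-th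
remaining position, plus the multiple of the pivot's unit vector that restores orthogonality. For v
= 0 an arbitrary pivot is dropped, so that there are always k columns. -/
theorem exists_orthStep {k : ℕ} (v : Str (k + 1)) : ∃ p, (v = 0 ∨ v p = 1) ∧
    ∀ i j, orthStep v i j =
      (if i = p then v (p.succAbove j) else 0) + if i = p.succAbove j then 1 else 0 := by
  obtain ⟨p, h, hp⟩ := exists_pivotInd v
  refine ⟨p, hp, fun i j => ?_⟩
  simp [orthStep, h, Pi.single_apply]

theorem vecMul_orthStep {k : ℕ} (v : Str (k + 1)) : v ᵥ* orthStep v = 0 := by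
  obtain ⟨p, hp, h⟩ := exists_orthStep v
  funext j
  simp only [Matrix.vecMul, dotProduct, h, mul_add, mul_ite, mul_zero, mul_one,
    Finset.sum_add_distrib, Finset.sum_ite_eq', Finset.mem_univ, if_true, Pi.zero_apply]
  rcases hp with rfl | hp
  · simp
  · rw [hp, one_mul, F2_add_self]

/-- The rows other than the pivot row form the identity matrix, so deleting the pivot row is a left
inverse. -/
theorem exists_mul_orthStep {k : ℕ} (v : Str (k + 1)) :
    ∃ L : Matrix (Fin k) (Fin (k + 1)) F2, L * orthStep v = 1 := by
  obtain ⟨p, -, h⟩ := exists_orthStep v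
  refine ⟨Matrix.of fun i j => if j = p.succAbove i then 1 else 0, ?_⟩
  ext i j
  simp [Matrix.mul_apply, h, Matrix.one_apply, Fin.succAbove_ne]

/-- The remaining equations after the first one has been solved by `orthStep`. -/
def orthRest {i k : ℕ} (M : Matrix (Fin (i + 1)) (Fin (k + 1)) F2) : Matrix (Fin i) (Fin k) F2 :=
  (Matrix.of fun a => M a.succ) * orthStep (M 0)

/-- A matrix with linearly independent columns that are in the kernel of `M`. -/
def kerCols {g : ℕ} : {i : ℕ} → Matrix (Fin i) (Fin (g + i)) F2 →
    Matrix (Fin (g + i)) (Fin g) F2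
  | 0, _ => 1
  | i + 1, M => orthStep (k := g + i) (M 0) * kerCols (orthRest (k := g + i) M)

theorem mul_kerCols {g i : ℕ} (M : Matrix (Fin i) (Fin (g + i)) F2) : M * kerCols M = 0 := by
  induction i with
  | zero => ext a; exact a.elim0
  | succ i ih =>
    ext a b
    rw [kerCols]
    cases a using Fin.cases with
    | zero =>
      have := congrArg (fun w => (w ᵥ* kerCols (orthRest (k := g + i) M)) b)
        (vecMul_orthStep (k := g + i) (M 0))
      simp only [Matrix.vecMul_vecMul, Matrix.zero_vecMul] at this
      exact this
    | succ a =>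
      have := congrFun (congrFun (ih (orthRest (k := g + i) M)) a) b
      nth_rewrite 1 [orthRest] at this
      rw [Matrix.mul_assoc] at this
      exact this

/-- A left inverse is the form of linear independence that `map_combineCols` uses. Each step loses
exactly one column, so g columns remain even if the equations are dependent. -/
theorem exists_mul_kerCols {g i : ℕ} (M : Matrix (Fin i) (Fin (g + i)) F2) :
    ∃ L : Matrix (Fin g) (Fin (g + i)) F2, L * kerCols M = 1 := by
  induction i with
  | zero => exact ⟨1, by simp [kerCols]⟩
  | succ i ih =>
    obtain ⟨L, hL⟩ := exists_mul_orthStep (k := g + i) (M 0)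
    obtain ⟨L', hL'⟩ := ih (orthRest (k := g + i) M)
    refine ⟨L' * L, ?_⟩
    rw [kerCols]
    refine Eq.trans (b := L' * (L * orthStep (k := g + i) (M 0)) *
      kerCols (orthRest (k := g + i) M)) ?_ ?_
    · simp only [Matrix.mul_assoc]
    · rw [hL, Matrix.mul_one, hL']

theorem detC_pivotInd {k : ℕ} : DetC ((k + 1) * (3 * (k + 1) + 2) + (k + 1) * (3 * (k + 1) + 4))
    (pivotInd : Str (k + 1) → Str (k + 1)) := by
  refine DetC.letC (G := fun z : Str (k + 1) × Str (k + 1) => fun p =>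
    z.2 p + if p = Fin.last k then ∏ i, (1 + z.1 i) else 0) detC_firstOne
    (.pi_fin fun p => ?_)
  have h : ∀ i ∈ Finset.univ, DetC 2 fun z : Str (k + 1) × Str (k + 1) => 1 + z.1 i :=
    fun i _ => DetC.one.add (DetC.fst.app i)
  have h2 := DetC.finProd Finset.univ h
  rw [Finset.card_fin] at h2
  exact ((DetC.snd.app p).add ((h2.mono (M := 3 * (k + 1) + 3) (by omega)).ite _
    (DetC.zero.mono (by omega)))).mono (by omega)

theorem detC_orthStep {k : ℕ} :
    DetC (30 * (k + 1) ^ 3) (orthStep : Str (k + 1) → Matrix (Fin (k + 1)) (Fin k) F2) := by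
  have h : DetC ((k + 1) * (k * ((k + 1) * 9 + 3))) fun z : Str (k + 1) × Str (k + 1) =>
      (Matrix.of fun i j => ∑ p, z.2 p * ((if i = p then z.1 (p.succAbove j) else 0) +
        if i = p.succAbove j then 1 else 0) : Matrix (Fin (k + 1)) (Fin k) F2) := by
    refine .mat fun i j => ?_
    have : ∀ p ∈ Finset.univ, DetC (0 + (3 + 3 + 1) + 1) fun z : Str (k + 1) × Str (k + 1) =>
        z.2 p * ((if i = p then z.1 (p.succAbove j) else 0) +
          if i = p.succAbove j then 1 else 0) :=
      fun p _ => (DetC.snd.app p).mul (.add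
        (.ite _ ((DetC.fst.app _).mono (Nat.zero_le _)) .zero)
        (.ite _ (DetC.one.mono (by norm_num)) .zero))
    simpa using DetC.sum Finset.univ this
  refine (detC_pivotInd.letC h).mono ?_
  nlinarith [Nat.zero_le k, Nat.zero_le (k ^ 2), Nat.zero_le (k ^ 3)]

theorem detC_kerCols {g i : ℕ} : DetC ((i + 1) * (50 * (g + i + 1) ^ 3))
    (kerCols : Matrix (Fin i) (Fin (g + i)) F2 → Matrix (Fin (g + i)) (Fin g) F2) := by
  induction i with
  | zero =>
    refine DetC.mono (DetC.mat fun i j => DetC.const _) (M := _) (N := g * (g * 3)) ?_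
    nlinarith [Nat.zero_le (g ^ 3), Nat.zero_le g, Nat.zero_le (g ^ 2)]
  | succ i ih =>
    have h1 : DetC 0 fun M : Matrix (Fin (i + 1)) (Fin (g + i + 1)) F2 =>
        (Matrix.of fun a => M a.succ : Matrix (Fin i) (Fin (g + i + 1)) F2) :=
      .pi_zero fun a => .pi_zero fun b => DetC.id.entry a.succ b
    have h2 : DetC 0 fun M : Matrix (Fin (i + 1)) (Fin (g + i + 1)) F2 =>
        (M 0 : Str (g + i + 1)) :=
      .pi_zero fun j => DetC.id.entry 0 j
    have h3 := detC_orthStep.comp_zero h2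
    have h4 : DetC _ fun z : Matrix (Fin (i + 1)) (Fin (g + i + 1)) F2 ×
        Matrix (Fin (g + i + 1)) (Fin (g + i)) F2 => (Matrix.of fun a => z.1 a.succ :
          Matrix (Fin i) (Fin (g + i + 1)) F2) * z.2 := (h1.comp_zero .fst).matMul .snd
    have h5 := h3.letC (DetC.matMul .snd (ih.comp h4))
    refine DetC.mono (show DetC _ (kerCols (g := g) (i := i + 1)) from h5) ?_
    have e1 : i * ((g + i) * ((g + i + 1) * 2 + 3)) ≤ 5 * (g + (i + 1) + 1) ^ 3 := by
      calc i * ((g + i) * ((g + i + 1) * 2 + 3))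
          ≤ (g + (i + 1) + 1) * ((g + (i + 1) + 1) * (5 * (g + (i + 1) + 1))) := by
            exact Nat.mul_le_mul (by omega) (Nat.mul_le_mul (by omega) (by omega))
        _ = _ := by ring
    have e2 : (g + i + 1) * (g * ((g + i) * 2 + 3)) ≤ 5 * (g + (i + 1) + 1) ^ 3 := by
      calc (g + i + 1) * (g * ((g + i) * 2 + 3))
          ≤ (g + (i + 1) + 1) * ((g + (i + 1) + 1) * (5 * (g + (i + 1) + 1))) := by
            exact Nat.mul_le_mul (by omega) (Nat.mul_le_mul (by omega) (by omega))
        _ = _ := by ring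
    have e3 : (g + i + 1) ^ 3 ≤ (g + (i + 1) + 1) ^ 3 := by gcongr; omega
    have e4 := Nat.mul_le_mul_left (i + 1) e3
    nlinarith


/-! ## The algorithms of the code run in polynomial time -/

theorem polySize_of_le {C : ℕ → Circuit} (c k : ℕ) (h : ∀ l, (C l).size ≤ c * (l + 1) ^ k) :
    PolySize C :=
  ⟨Polynomial.C c * (Polynomial.X + 1) ^ k, fun l => by simpa using h l⟩

theorem detC_flat {a b : ℕ} : DetC 0 (flat : Matrix (Fin a) (Fin b) F2 → Str (a * b)) :=
  .pi_zero fun _ => DetC.id.entry _ _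

theorem detC_unflat {a b : ℕ} : DetC 0 (unflat : Str (a * b) → Matrix (Fin a) (Fin b) F2) :=
  .pi_zero fun _ => .pi_zero fun _ => DetC.id.app _

theorem detC_append {a b : ℕ} : DetC 0 fun x : Str a × Str b => (Fin.append x.1 x.2 : Str (a + b)) :=
  .pi_zero fun i => by
    cases i using Fin.addCases with
    | left i => simpa using DetC.fst.app i
    | right i => simpa using DetC.snd.app i

theorem detC_packKey {a b m : ℕ} : DetC 0 fun x : Matrix (Fin a) (Fin b) F2 × Str m =>
    packKey x.1 x.2 :=
  detC_append.comp_zero ((detC_flat.comp_zero .fst).prod .snd)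

theorem detC_keyMat {a b m : ℕ} :
    DetC 0 (keyMat : Str (a * b + m) → Matrix (Fin a) (Fin b) F2) :=
  detC_unflat.comp_zero (.pi_zero fun _ => DetC.id.app _)

theorem detC_keyVec {a b m : ℕ} : DetC 0 (keyVec (a := a) (b := b) (m := m)) :=
  .pi_zero fun _ => DetC.id.app _

@[simp]
theorem unflat_flat {a b : ℕ} (A : Matrix (Fin a) (Fin b) F2) : unflat (flat A) = A := by
  ext i j; simp [unflat, flat]

@[simp]
theorem keyMat_packKey {a b m : ℕ} (A : Matrix (Fin a) (Fin b) F2) (z : Str m) :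
    keyMat (packKey A z) = A := by
  simp [keyMat, packKey]

@[simp]
theorem keyVec_packKey {a b m : ℕ} (A : Matrix (Fin a) (Fin b) F2) (z : Str m) :
    keyVec (packKey A z) = z := by
  funext i; simp [keyVec, packKey]

theorem samp_encode {n g : ℕ} (η : ℝ) :
    Samp (2 * n + g + n * (2 * g + 3) + n) fun pk : Str (n * g + n) =>
      (uniformStr g).bind fun u => (berStr η n).map fun e => keyMat pk *ᵥ u + keyVec pk + e := by
  have h : DetC (n * (g * 2 + 3) + n + n) fun z : (Str (n * g + n) × Str g) × Str n =>
      keyMat z.1.1 *ᵥ z.1.2 + keyVec z.1.1 + z.2 := by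
    have h1 := (detC_keyMat (a := n) (b := g) (m := n)).comp_zero
      (DetC.fst.comp_zero (DetC.fst (X := Str (n * g + n) × Str g) (Y := Str n)))
    have h2 := h1.mulVec (DetC.snd.comp_zero .fst)
    exact ((h2.vecAdd (detC_keyVec.comp_zero (DetC.fst.comp_zero .fst))).vecAdd .snd).mono
      (by omega)
  refine ((Samp.uniform_str g).bind ((Samp.ber_str η n).bind (.det h))).mono ?_
  rw [mul_comm g 2]; omega

theorem ldpc_eq {n g t r : ℕ} : ldpc n g t r = (uniformOn (sparseMats t r n)).bind fun P =>
    (PMF.uniformOfFintype (Matrix (Fin n) (Fin g) F2)).map fun U => (P, kerProj P * U) := by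
  rw [ldpc]
  congr 1
  funext P
  rw [← uniform_ker_eq, PMF.map_comp]
  rfl

theorem samp_keyGen {n g t r : ℕ} (h : t ≤ n) :
    Samp (r * (3 * (t + 1) + n * (20 * (t + 1) ^ 2)) + n * g + n +
      (r + 1) * (30 * (n + 1) ^ 3) + n * (g * (2 * n + 3)))
      fun _ : Str 0 => ((ldpc n g t r).bind fun PG => (uniformStr n).map fun z =>
        (Fin.append (packKey PG.1 z) (packKey PG.2 z) : Str (r * n + n + (n * g + n)))) := by
  simp only [ldpc_eq, PMF.bind_bind, PMF.bind_map, Function.comp_def]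
  have h1 := samp_sparseMats (X := Str 0) r h
  have h2 := Samp.uniform_mat (X := Str 0 × Matrix (Fin r) (Fin n) F2) n g
  have h3 := Samp.uniform_str
    (X := (Str 0 × Matrix (Fin r) (Fin n) F2) × Matrix (Fin n) (Fin g) F2) n
  have h4 : DetC ((r + 1) * (30 * (n + 1) ^ 3) + n * (g * (n * 2 + 3)))
      fun z : ((Str 0 × Matrix (Fin r) (Fin n) F2) × Matrix (Fin n) (Fin g) F2) × Str n =>
        (Fin.append (packKey z.1.1.2 z.2) (packKey (kerProj z.1.1.2 * z.1.2) z.2) :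
          Str (r * n + n + (n * g + n))) := by
    have a1 : DetC 0 fun z : ((Str 0 × Matrix (Fin r) (Fin n) F2) ×
        Matrix (Fin n) (Fin g) F2) × Str n => z.1.1.2 :=
      DetC.snd.comp_zero (DetC.fst.comp_zero .fst)
    have a2 := (detC_kerProj.comp_zero a1).matMul (DetC.snd.comp_zero .fst)
    have a3 := detC_append.comp ((detC_packKey.comp_zero (a1.prod .snd)).prod
      (detC_packKey.comp (a2.prod .snd)))
    exact a3.mono (by omega)
  exact (h1.bind (h2.bind (h3.bind (.det h4)))).mono (by rw [mul_comm 2 n]; omega)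

/-- The one-hot representation of the weight is updated position by position: a bit 1 shifts it by
one place, a bit 0 leaves it alone. -/
theorem detC_wtInd (K r : ℕ) : DetC (3 * (K + 1) + r * ((K + 1) * 8))
    fun (v : Str r) (k : Fin (K + 1)) => if hammingNorm v = k then (1 : F2) else 0 := by
  induction r with
  | zero =>
    refine (DetC.pi_fin (N := 3) fun k => ?_).mono (by omega)
    have : ∀ x : Str 0, hammingNorm x = 0 := fun x => by simp [hammingNorm]
    simp only [this]
    exact .const _
  | succ r ih =>
    have h1 : DetC 0 fun v : Str (r + 1) => (Fin.tail v : Str r) :=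
      .pi_zero fun i => DetC.id.app i.succ
    have h2 : DetC ((K + 1) * 8) fun z : Str (r + 1) × (Fin (K + 1) → F2) =>
        fun k : Fin (K + 1) => z.1 0 * (if (k : ℕ) = 0 then 0 else z.2 ⟨k - 1, by omega⟩) +
          (1 + z.1 0) * z.2 k := by
      refine .pi_fin fun k => ?_
      refine (((DetC.fst.app 0).mul (.ite _ .zero ((DetC.snd.app _).mono (Nat.zero_le _)))).add
        ((DetC.one.add (DetC.fst.app 0)).mul (DetC.snd.app k))).mono (by norm_num)
    have h3 := (ih.comp_zero h1).letC h2
    refine DetC.mono ?_ (show 3 * (K + 1) + r * ((K + 1) * 8) + (K + 1) * 8 ≤ _ by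
      rw [Nat.add_mul r 1]; omega)
    convert h3 using 3 with v k
    obtain ⟨b, w, rfl⟩ : ∃ b w, v = (Fin.cons b w : Str (r + 1)) :=
      ⟨v 0, Fin.tail v, (Fin.cons_self_tail v).symm⟩
    simp only [hammingNorm_cons, Fin.cons_zero, Fin.tail_cons]
    rcases F2_cases b with rfl | rfl
    · simp
    · rw [show (1 : F2) + 1 = 0 from rfl, one_mul, zero_mul, add_zero, if_pos rfl]
      have : 1 + hammingNorm w = k ↔ (k : ℕ) ≠ 0 ∧ hammingNorm w = k - 1 := by omega
      by_cases h : (k : ℕ) = 0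
      · simp [h]
      · simp [this, h]

/-- A weight has only r+1 possible values, so any predicate of it, a comparison with a real
threshold included, is a fixed table wired into the program. -/
theorem detC_wt (r : ℕ) (p : ℕ → Prop) [DecidablePred p] :
    DetC (20 * (r + 1) ^ 2) fun v : Str r => if p (hammingNorm v) then (1 : F2) else 0 := by
  have h : ∀ k ∈ (Finset.univ : Finset (Fin (r + 1))),
      DetC 3 fun s : Fin (r + 1) → F2 => if p k then s k else 0 :=
    fun k _ => .ite _ ((DetC.eval k).mono (by norm_num)) .zero
  have h2 := (DetC.sum Finset.univ h).comp (detC_wtInd r r)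
  refine DetC.mono ?_ (show 3 * (r + 1) + r * ((r + 1) * 8) +
    ((Finset.univ : Finset (Fin (r + 1))).card * (3 + 1) + 3) ≤ _ from ?_)
  · convert h2 using 2 with v
    have hv : hammingNorm v < r + 1 := by
      have := hammingNorm_le_card_fintype (x := v)
      rw [Fintype.card_fin] at this
      omega
    rw [Finset.sum_eq_single (⟨hammingNorm v, hv⟩ : Fin (r + 1))]
    · simp
    · intro k _ hk
      have : hammingNorm v ≠ k := fun h => hk (Fin.ext h.symm)
      simp [this]
    · simp
  · rw [Finset.card_fin]
    nlinarith

theorem ofFn_toStr {m : ℕ} (x : List F2) (h : x.length = m) : List.ofFn (toStr x h) = x := by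
  subst h
  exact List.ofFn_get x

variable {g t r : ℕ → ℕ} {η : ℝ} {ζ : ℕ → ℝ}

theorem detC_decode {n r : ℕ} (p : ℕ → Prop) [DecidablePred p] :
    DetC (2 * (r * (n * 2 + 3)) + r + 20 * (r + 1) ^ 2)
      fun (y : Str (r * n + n + n)) (_ : Fin 1) =>
        if p (hammingNorm (keyMat (fun i => y (Fin.castAdd n i)) *ᵥ
          (fun i => y (Fin.natAdd (r * n + n) i)) + keyMat (fun i => y (Fin.castAdd n i)) *ᵥ
          keyVec (fun i => y (Fin.castAdd n i)))) then (1 : F2) else 0 := by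
  have h1 : DetC 0 fun y : Str (r * n + n + n) => (fun i => y (Fin.castAdd n i) :
      Str (r * n + n)) := .pi_zero fun i => DetC.id.app _
  have h2 : DetC 0 fun y : Str (r * n + n + n) => (fun i => y (Fin.natAdd (r * n + n) i) :
      Str n) := .pi_zero fun i => DetC.id.app _
  have hP := (detC_keyMat (a := r) (b := n) (m := n)).comp_zero h1
  have hz := (detC_keyVec (a := r) (b := n) (m := n)).comp_zero h1
  have h3 := (detC_wt r p).comp ((hP.mulVec h2).vecAdd (hP.mulVec hz))
  refine DetC.mono (DetC.pi_fin fun _ : Fin 1 => h3) (by omega)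

theorem ldpcPRC_efficient (hg : ∀ l, g l ≤ l) (ht : ∀ l, t l ≤ l) (hr : ∀ l, r l ≤ l) :
    (ldpcPRC (fun n => n) g t r (fun _ => η) ζ).Efficient where
  keyGen := by
    choose C hC1 hC2 using fun l => (samp_keyGen (g := g l) (r := r l) (ht l)).exists_circuit
    refine ⟨C, polySize_of_le 200 4 fun l => (hC1 l).trans ?_, fun l => ?_⟩
    · have e1 : r l * (3 * (t l + 1) + l * (20 * (t l + 1) ^ 2)) ≤ 23 * (l + 1) ^ 4 := by
        calc r l * (3 * (t l + 1) + l * (20 * (t l + 1) ^ 2))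
            ≤ (l + 1) * (3 * (l + 1) ^ 3 + (l + 1) * (20 * (l + 1) ^ 2)) := by
              have h1 := ht l
              have h2 := hr l
              have h3 : 3 * (t l + 1) ≤ 3 * (l + 1) ^ 3 := by
                have : l + 1 ≤ (l + 1) ^ 3 := Nat.le_self_pow (by norm_num) _
                omega
              gcongr <;> omega
          _ = _ := by ring
      have e2 : l * g l ≤ (l + 1) ^ 4 := by
        calc l * g l ≤ (l + 1) * (l + 1) := Nat.mul_le_mul (by omega) (by have := hg l; omega)
          _ = (l + 1) ^ 2 := by ring
          _ ≤ _ := Nat.pow_le_pow_right (by omega) (by norm_num)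
      have e3 : l ≤ (l + 1) ^ 4 := (Nat.le_succ l).trans (Nat.le_self_pow (by norm_num) _)
      have e4 : (r l + 1) * (30 * (l + 1) ^ 3) ≤ 30 * (l + 1) ^ 4 := by
        calc _ ≤ (l + 1) * (30 * (l + 1) ^ 3) := Nat.mul_le_mul (by have := hr l; omega) le_rfl
          _ = _ := by ring
      have e5 : l * (g l * (2 * l + 3)) ≤ 3 * (l + 1) ^ 4 := by
        calc _ ≤ (l + 1) * ((l + 1) * (3 * (l + 1))) :=
              Nat.mul_le_mul (by omega) (Nat.mul_le_mul (by have := hg l; omega) (by omega))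
          _ = 3 * (l + 1) ^ 3 := by ring
          _ ≤ _ := by gcongr <;> omega
      have e6 : r l * l ≤ (l + 1) ^ 4 := by
        calc r l * l ≤ (l + 1) * (l + 1) := Nat.mul_le_mul (by have := hr l; omega) (by omega)
          _ = (l + 1) ^ 2 := by ring
          _ ≤ _ := Nat.pow_le_pow_right (by omega) (by norm_num)
      omega
    · have := hC2 l noOracle Fin.elim0
      rw [List.ofFn_zero] at this
      rw [this]
      refine Eq.trans ?_ (PMF.map_bind _ _ _).symm
      rw [PMF.map_bind]
      congr 1
      funext PG
      refine (PMF.map_comp _ _ _).trans (Eq.trans ?_ (PMF.map_comp _ _ _).symm)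
      congr 1
      funext z
      exact List.ofFn_fin_append _ _
  encode := by
    choose C hC1 hC2 using fun l => (samp_encode (n := l) (g := g l) η).exists_circuit
    refine ⟨C, polySize_of_le 30 2 fun l => (hC1 l).trans ?_, fun l pk m => ?_⟩
    · have e : l * (2 * g l + 3) ≤ (l + 1) * (3 * (l + 1)) :=
        Nat.mul_le_mul (by omega) (by have := hg l; omega)
      have := hg l
      nlinarith
    · rw [show List.ofFn m = [] from List.ofFn_zero, List.append_nil]
      exact hC2 l noOracle pk
  decode := by
    classical
    let p : ℕ → ℕ → Prop := fun l w => (w : ℝ) < (1 / 2 - ζ l) * (r l : ℝ)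
    choose C hC1 hC2 using fun l => (Samp.det (detC_decode (n := l) (r := r l)
      (p l))).exists_circuit
    -- For inputs of the wrong length the output wire has a number beyond the last wire (key, `k`
    -- bits of input, two gates). Such a wire reads `0`, the code of `⊥`.
    refine ⟨fun l k => if k = l then C l else ⟨[Gate.one, Gate.add 0 0], [(r l * l + l) + k + 5]⟩,
      ⟨Polynomial.C 100 * (Polynomial.X + 1) ^ 2, fun l k => ?_⟩, fun l sk x => ?_⟩
    · beta_reduce
      split_ifs with h
      · subst h
        refine (hC1 k).trans ?_
        have h1 : r k * (k * 2 + 3) ≤ (k + 1) * (3 * (k + 1)) :=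
          Nat.mul_le_mul (by have := hr k; omega) (by omega)
        have h2 : (r k + 1) ^ 2 ≤ (k + 1) ^ 2 := by
          have := hr k
          gcongr
        have h3 := hr k
        have h4 : (k + 1) ^ 2 ≤ (k + k + 1) ^ 2 := by gcongr; omega
        simp only [Polynomial.eval_mul, Polynomial.eval_C, Polynomial.eval_pow,
          Polynomial.eval_add, Polynomial.eval_X, Polynomial.eval_one]
        nlinarith
      · simp only [Circuit.size, Polynomial.eval_mul, Polynomial.eval_C, Polynomial.eval_pow,
          Polynomial.eval_add, Polynomial.eval_X, Polynomial.eval_one]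
        simp only [List.map_cons, Gate.cost, List.map_nil, List.sum_cons, List.sum_nil,
          List.length_cons, List.length_nil]
        have := Nat.one_le_pow 2 (l + k + 1) (by omega)
        omega
    · obtain ⟨sk, rfl⟩ : ∃ sk' : Str (r l * l + l), sk' = sk := ⟨sk, rfl⟩
      refine Eq.trans ?_ (PMF.pure_map _ _).symm
      beta_reduce
      by_cases h : x.length = l
      · rw [if_pos h, dif_pos h]
        have hx : List.ofFn sk ++ x = List.ofFn (Fin.append sk (toStr x h)) := by
          rw [List.ofFn_fin_append, ofFn_toStr]
        refine (congrArg ((C l).eval noOracle) hx).trans ?_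
        refine (hC2 l noOracle (Fin.append sk (toStr x h))).trans ?_
        have e1 : (fun i => Fin.append sk (toStr x h) (Fin.castAdd l i)) = sk :=
          funext fun i => Fin.append_left _ _ i
        have e2 : (fun i => Fin.append sk (toStr x h) (Fin.natAdd (r l * l + l) i)) =
          toStr x h := funext fun i => Fin.append_right _ _ i
        rw [PMF.pure_map, e1, e2]
        congr 1
        simp only [p, List.ofFn_succ, List.ofFn_zero]
        split_ifs <;> rfl
      · rw [if_neg h, dif_neg h]
        simp only [Circuit.eval, runGates, Gate.step, PMF.pure_bind, PMF.pure_map, readWires,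
          List.map_cons, List.map_nil, answerBits]
        congr 2
        rw [List.getD_eq_default]
        simp [ldpcPRC]
        omega


/-! ## Adversaries as maps of the oracle's answers -/

/-- The bias of the coin that a gate tosses. -/
def Gate.bias : Gate → ℝ
  | .coin q => q
  | _ => 0

/-- The new wires of a gate, if its coin shows `c` and its oracle answers `a` to the empty query and
nothing to other queries. -/
def Gate.out {R : Type} [CommRing R] {n : ℕ} (c : R) (a : Fin n → R) (w : List R) : Gate → List R
  | .one => [1]
  | .add i j => [w.getD i 0 + w.getD j 0]
  | .mul i j => [w.getD i 0 * w.getD j 0]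
  | .coin _ => [c]
  | .oracle l => if l = [] then List.ofFn a else []

/-- The wires after a list of gates, if their coins show `c` and their oracles answer `a`. -/
def runDet {R : Type} [CommRing R] {n : ℕ} : (gs : List Gate) → (Fin gs.length → R) →
    (Fin gs.length → Fin n → R) → List R → List R
  | [], _, _, w => w
  | g :: gs, c, a, w => runDet gs (fun i => c i.succ) (fun i => a i.succ)
      (w ++ g.out (c 0) (a 0) w)

theorem oracleOf_of_length_ne {k m : ℕ} (f : Str k → PMF (Str m)) {x : List F2}
    (h : x.length ≠ k) : oracleOf f x = PMF.pure [] := dif_neg h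

/-- Every gate is granted a coin and an oracle answer, which it may ignore. With message length 0
only the empty query has a nontrivial answer, so answers do not depend on the course of the
computation. -/
theorem step_oracleOf {n : ℕ} (f : Str 0 → PMF (Str n)) (g : Gate) (w : List F2) :
    g.step (oracleOf f) w = (ber g.bias).bind fun c =>
      (f Fin.elim0).map fun a => w ++ g.out c a w := by
  have hc : ∀ l : List F2, (f Fin.elim0).map (fun _ => w ++ l) = PMF.pure (w ++ l) :=
    fun l => PMF.map_const _ _
  cases g with
  | one => simp [Gate.step, Gate.out, hc]
  | add i j => simp only [Gate.step, Gate.out, hc, PMF.bind_const]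
  | mul i j => simp only [Gate.step, Gate.out, hc, PMF.bind_const]
  | coin q =>
    simp only [Gate.step, Gate.out, hc]
    exact (PMF.bind_pure_comp _ _).symm
  | oracle l =>
    simp only [Gate.step, Gate.out, PMF.bind_const]
    cases l with
    | nil =>
      simp only [readWires, List.map_nil, if_true]
      have h : oracleOf f [] = (f Fin.elim0).map List.ofFn := by
        rw [oracleOf, dif_pos List.length_nil]
        exact congrArg (fun x => (f x).map List.ofFn) (Subsingleton.elim _ _)
      rw [h, PMF.map_comp]
      rfl
    | cons i l =>
      simp only [reduceCtorEq, if_false, hc]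
      rw [oracleOf_of_length_ne f (by simp [readWires]), PMF.pure_map]

/-- Since each call uses fresh randomness and its law is fixed, all coins and answers may be drawn
before the run, which is then deterministic. -/
theorem runGates_oracleOf {n : ℕ} (f : Str 0 → PMF (Str n)) (gs : List Gate) (w : List F2) :
    runGates (oracleOf f) gs w = (piPMF fun i : Fin gs.length => ber (gs.get i).bias).bind fun c =>
      (piPMF fun _ : Fin gs.length => f Fin.elim0).map fun a => runDet gs c a w := by
  induction gs generalizing w with
  | nil =>
    have : ∀ c : Fin 0 → F2, (piPMF fun _ : Fin 0 => f Fin.elim0).map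
        (fun a => runDet [] c a w) = PMF.pure w := fun c => PMF.map_const _ _
    exact ((congrArg _ (funext this)).trans (PMF.bind_const _ _)).symm
  | cons g gs ih =>
    rw [runGates, step_oracleOf, PMF.bind_bind]
    simp only [PMF.bind_map, Function.comp_def, ih]
    have h1 := piPMF_cons fun i : Fin (gs.length + 1) => ber ((g :: gs).get i).bias
    have h2 := piPMF_cons fun _ : Fin (gs.length + 1) => f Fin.elim0
    refine Eq.trans ?_ (congrArg₂ (fun μ ν => PMF.bind μ fun c => PMF.map (fun a =>
      runDet (g :: gs) c a w) ν) h1 h2).symm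
    simp only [PMF.bind_bind, PMF.map_bind, PMF.bind_map, Function.comp_def, PMF.map_comp]
    congr 1
    funext c
    rw [PMF.bind_comm]
    rfl

theorem map_getD {R R' : Type} [CommRing R] [CommRing R'] (φ : R →+* R') (w : List R) (i : ℕ) :
    (w.map φ).getD i 0 = φ (w.getD i 0) := by
  rw [List.getD_eq_getElem?_getD, List.getD_eq_getElem?_getD, List.getElem?_map]
  cases w[i]? <;> simp

theorem map_out {R R' : Type} [CommRing R] [CommRing R'] (φ : R →+* R') {n : ℕ} (g : Gate)
    (c : R) (a : Fin n → R) (w : List R) :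
    (g.out c a w).map φ = g.out (φ c) (fun i => φ (a i)) (w.map φ) := by
  cases g with
  | oracle l =>
    simp only [Gate.out]
    split_ifs
    · rw [List.map_ofFn]; rfl
    · rfl
  | _ => simp only [Gate.out, map_getD, map_add, map_mul, map_one, List.map_cons, List.map_nil]

/-- A deterministic run consists of ring operations. It can therefore be performed in the ring of
functions of the coins, answers and input, and evaluated at a point afterwards. -/
theorem map_runDet {R R' : Type} [CommRing R] [CommRing R'] (φ : R →+* R') {n : ℕ}
    (gs : List Gate) (c : Fin gs.length → R) (a : Fin gs.length → Fin n → R) (w : List R) :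
    (runDet gs c a w).map φ =
      runDet gs (fun i => φ (c i)) (fun i j => φ (a i j)) (w.map φ) := by
  induction gs generalizing w with
  | nil => rfl
  | cons g gs ih =>
    rw [runDet, ih, runDet, List.map_append, map_out]

theorem getD_mem_or {R : Type} [CommRing R] {B : Set R} {w : List R} (hw : ∀ b ∈ w, b ∈ B)
    (h0 : (0 : R) ∈ B) (i : ℕ) : w.getD i 0 ∈ B := by
  rcases Nat.lt_or_ge i w.length with h | h
  · rw [List.getD_eq_getElem _ _ h]
    exact hw _ (List.getElem_mem h)
  · rwa [List.getD_eq_default _ _ h]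

theorem reach_runDet {R : Type} [CommRing R] {n : ℕ} (gs : List Gate) (c : Fin gs.length → R)
    (a : Fin gs.length → Fin n → R) (w : List R) {B : Set R} (h0 : (0 : R) ∈ B)
    (hc : ∀ i, c i ∈ B) (ha : ∀ i j, a i j ∈ B) (hw : ∀ b ∈ w, b ∈ B) :
    Reach gs.length B {b | b ∈ runDet gs c a w} := by
  induction gs generalizing w B with
  | nil => exact .done hw
  | cons g gs ih =>
    have key : ∀ (B' : Set R), B ⊆ B' → (∀ b ∈ g.out (c 0) (a 0) w, b ∈ B') →
        Reach gs.length B' {b | b ∈ runDet (g :: gs) c a w} := fun B' hB h =>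
      ih _ _ _ (hB h0) (fun i => hB (hc _)) (fun i j => hB (ha _ _)) fun b hb => by
        rcases List.mem_append.1 hb with hb | hb
        · exact hB (hw b hb)
        · exact h b hb
    cases g with
    | one => exact .one (key _ (Set.subset_insert _ _) (by simp [Gate.out]))
    | add i j =>
      exact .add (getD_mem_or hw h0 i) (getD_mem_or hw h0 j)
        (key _ (Set.subset_insert _ _) (by simp [Gate.out]))
    | mul i j =>
      exact .mul (getD_mem_or hw h0 i) (getD_mem_or hw h0 j)
        (key _ (Set.subset_insert _ _) (by simp [Gate.out]))
    | coin q =>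
      refine (key B subset_rfl ?_).mono (Nat.le_succ _) subset_rfl subset_rfl
      simpa [Gate.out] using hc 0
    | oracle l =>
      refine (key B subset_rfl ?_).mono (Nat.le_succ _) subset_rfl subset_rfl
      intro b hb
      simp only [Gate.out] at hb
      split_ifs at hb
      · obtain ⟨j, rfl⟩ := List.mem_ofFn.1 hb
        exact ha 0 j
      · simp at hb

/-- Evaluation at a point, as a ring homomorphism. -/
def evalHom {X : Type} (x : X) : (X → F2) →+* F2 := Pi.evalRingHom (fun _ => F2) x

/-- A circuit with an oracle that takes no input is an efficient randomized map of the answers. -/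
theorem exists_samp_adversary (C : Circuit) (n k : ℕ) :
    ∃ T : Str k × (Fin C.gates.length → Str n) → PMF (Str C.outs.length),
      Samp (C.gates.length + 3) T ∧ ∀ f x, C.eval (oracleOf f) (List.ofFn x) =
        ((piPMF fun _ => f Fin.elim0).bind fun a => T (x, a)).map List.ofFn := by
  set Q := C.gates.length
  let F : (Str k × (Fin Q → Str n)) × (Fin Q → F2) → Str C.outs.length := fun z j =>
    (runDet C.gates z.2 z.1.2 (List.ofFn z.1.1)).getD (C.outs.get j) 0
  let X := (Str k × (Fin Q → Str n)) × (Fin Q → F2)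
  let W : List (X → F2) := runDet C.gates (fun i z => z.2 i) (fun i j z => z.1.2 i j)
    (List.ofFn fun i z => z.1.1 i)
  have hW : ∀ z : X, W.map (evalHom z) = runDet C.gates z.2 z.1.2 (List.ofFn z.1.1) := by
    intro z
    rw [map_runDet, List.map_ofFn]
    rfl
  have hF : DetC (Q + 3) F := by
    have h0 : Reach 3 (Wires.wires : Set (X → F2)) {0} := DetC.bit_iff.1 (DetC.zero (X := X))
    have hin : ∀ i, (fun z : X => z.1.1 i) ∈ (Wires.wires : Set (X → F2)) := fun i =>
      Or.inl ⟨_, Or.inl ⟨_, Set.mem_iUnion.2 ⟨i, _, rfl, rfl⟩, rfl⟩, rfl⟩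
    have hco : ∀ i, (fun z : X => z.2 i) ∈ (Wires.wires : Set (X → F2)) := fun i =>
      Or.inr ⟨_, Set.mem_iUnion.2 ⟨i, _, rfl, rfl⟩, rfl⟩
    have han : ∀ i j, (fun z : X => z.1.2 i j) ∈ (Wires.wires : Set (X → F2)) := fun i j =>
      Or.inl ⟨_, Or.inr ⟨_, Set.mem_iUnion.2 ⟨i, _, Set.mem_iUnion.2 ⟨j, _, rfl, rfl⟩, rfl⟩,
        rfl⟩, rfl⟩
    -- `0` has to be among the available values because missing wires read `0`; producing it
    -- accounts for the additional 3 operations.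
    have h1 := reach_runDet (B := (Wires.wires : Set (X → F2)) ∪ {0}) C.gates (fun i z => z.2 i)
      (fun i j z => z.1.2 i j) (List.ofFn fun i z => z.1.1 i) (by simp)
      (fun i => Or.inl (hco i)) (fun i j => Or.inl (han i j)) (by
        intro b hb
        obtain ⟨i, rfl⟩ := List.mem_ofFn.1 hb
        exact Or.inl (hin i))
    have h2 := h0.trans h1.keep
    refine h2.mono (Nat.add_comm _ _).le subset_rfl ?_
    rintro _ ⟨v, hv, rfl⟩
    obtain ⟨j, u, hu, rfl⟩ := Set.mem_iUnion.1 hv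
    obtain rfl : u = _root_.id := hu
    have : compHom F ((fun w => w ∘ fun x : Str C.outs.length => x j) _root_.id) =
        W.getD (C.outs.get j) 0 := by
      funext z
      change (runDet C.gates z.2 z.1.2 (List.ofFn z.1.1)).getD (C.outs.get j) 0 =
        evalHom z (W.getD (C.outs.get j) 0)
      rw [← map_getD, hW]
    rw [this]
    exact getD_mem_or (B := (Wires.wires ∪ {0}) ∪ {b | b ∈ W}) (fun b hb => Or.inr hb)
      (Or.inl (Or.inr rfl)) _
  refine ⟨fun z => (piPMF fun i : Fin Q => ber (C.gates.get i).bias).map fun ω => F (z, ω),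
    ⟨Fin Q, inferInstance, fun i => (C.gates.get i).bias, F, by simp, hF, fun z => rfl⟩,
    fun f x => ?_⟩
  rw [Circuit.eval, runGates_oracleOf, PMF.map_bind, PMF.map_bind]
  simp only [← PMF.bind_pure_comp, PMF.bind_bind, Function.comp_def, PMF.pure_bind]
  rw [PMF.bind_comm]
  congr 1; funext a; congr 1; funext c
  congr 1
  rw [readWires]
  refine List.ext_getElem (by simp) fun i h1 h2 => ?_
  simp [F]

/-! ## Asymptotics -/

/-- Functions that are bounded by a polynomial. -/
def PolyBdd (N : ℕ → ℕ) : Prop := ∃ P : Polynomial ℕ, ∀ l, N l ≤ P.eval l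

namespace PolyBdd

variable {N M : ℕ → ℕ}

theorem mono (h : PolyBdd M) (hN : ∀ l, N l ≤ M l) : PolyBdd N :=
  h.imp fun _ hP l => (hN l).trans (hP l)

theorem const (c : ℕ) : PolyBdd fun _ => c := ⟨Polynomial.C c, fun l => by simp⟩

theorem id : PolyBdd fun l => l := ⟨Polynomial.X, fun l => by simp⟩

theorem add (hN : PolyBdd N) (hM : PolyBdd M) : PolyBdd fun l => N l + M l := by
  obtain ⟨P, hP⟩ := hN
  obtain ⟨R, hR⟩ := hM
  exact ⟨P + R, fun l => by rw [Polynomial.eval_add]; exact Nat.add_le_add (hP l) (hR l)⟩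

theorem mul (hN : PolyBdd N) (hM : PolyBdd M) : PolyBdd fun l => N l * M l := by
  obtain ⟨P, hP⟩ := hN
  obtain ⟨R, hR⟩ := hM
  exact ⟨P * R, fun l => by rw [Polynomial.eval_mul]; exact Nat.mul_le_mul (hP l) (hR l)⟩

theorem pow (hN : PolyBdd N) (k : ℕ) : PolyBdd fun l => N l ^ k := by
  obtain ⟨P, hP⟩ := hN
  exact ⟨P ^ k, fun l => by rw [Polynomial.eval_pow]; exact Nat.pow_le_pow_left (hP l) k⟩

end PolyBdd

theorem Negligible.of_abs_le {f h : ℕ → ℝ} (hh : Negligible h) (hf : ∀ l, |f l| ≤ |h l|) :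
    Negligible f :=
  SuperpolynomialDecay.trans_abs_le hh hf

theorem Negligible.polyBdd_mul {f : ℕ → ℝ} (hf : Negligible f) {N : ℕ → ℕ} (hN : PolyBdd N) :
    Negligible fun l => (N l : ℝ) * f l := by
  obtain ⟨P, hP⟩ := hN
  have h := SuperpolynomialDecay.polynomial_mul hf (P.map (Nat.castRingHom ℝ))
  refine Negligible.of_abs_le h fun l => ?_
  have : (P.map (Nat.castRingHom ℝ)).eval (l : ℝ) = (P.eval l : ℕ) := by
    rw [Polynomial.eval_natCast_map]; rfl
  simp only [this, abs_mul, Nat.abs_cast]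
  exact mul_le_mul_of_nonneg_right (by exact_mod_cast hP l) (abs_nonneg _)

/-- The hybrid argument. -/
theorem negligible_hybrid {Q : ℕ → ℕ} (hQ : PolyBdd Q) (a : ℕ → ℕ → ℝ)
    (h : ∀ j : ℕ → ℕ, Negligible fun l =>
      if j l < Q l then |a l (j l) - a l (j l + 1)| else 0) :
    Negligible fun l => |a l 0 - a l (Q l)| := by
  -- For each `l` the index of the largest gap is chosen. The function `j` need not be computable:
  -- the hypothesis covers every choice of indices, as circuits are non-uniform.
  have hj : ∀ l, ∃ j, 0 < Q l → j < Q l ∧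
      ∀ i < Q l, |a l i - a l (i + 1)| ≤ |a l j - a l (j + 1)| := by
    intro l
    by_cases hl : 0 < Q l
    · obtain ⟨j, hj, hmax⟩ := Finset.exists_max_image (Finset.range (Q l))
        (fun i => |a l i - a l (i + 1)|) ⟨0, by simpa using hl⟩
      exact ⟨j, fun _ => ⟨by simpa using hj, fun i hi => hmax i (by simpa using hi)⟩⟩
    · exact ⟨0, fun h => absurd h hl⟩
  choose j hj using hj
  refine Negligible.of_abs_le ((h j).polyBdd_mul hQ) fun l => ?_
  rw [abs_abs]
  rcases Nat.eq_zero_or_pos (Q l) with h0 | hpos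
  · rw [h0]; simp
  · obtain ⟨h1, h2⟩ := hj l hpos
    rw [if_pos h1, abs_mul, Nat.abs_cast, abs_abs, ← Finset.sum_range_sub' (a l)]
    calc _ ≤ ∑ i ∈ Finset.range (Q l), |a l i - a l (i + 1)| := Finset.abs_sum_le_sum_abs _ _
      _ ≤ (Finset.range (Q l)).card • |a l (j l) - a l (j l + 1)| :=
        Finset.sum_le_card_nsmul _ _ _ fun i hi => h2 i (by simpa using hi)
      _ = _ := by simp

/-- The probability that a test accepts. -/
def acc {o : ℕ} (μ : PMF (Str o)) : ℝ := prob (μ.map List.ofFn) {[1]}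


/-! ## From one planted parity check to many -/

/-- The matrices `G` of the keys with `i` parity checks. -/
def checkDist (n g t i : ℕ) : PMF (Matrix (Fin n) (Fin g) F2) :=
  (uniformOn (sparseMats t i n)).bind fun P =>
    uniformOn {G : Matrix (Fin n) (Fin g) F2 | P * G = 0}

/-- Combinations of the first columns of `G` that satisfy the parity checks in `P`. -/
def combineCols {n m g i : ℕ} (h : g + i ≤ m) (P : Matrix (Fin i) (Fin n) F2)
    (G : Matrix (Fin n) (Fin m) F2) : Matrix (Fin n) (Fin g) F2 :=
  G.submatrix id (Fin.castLE h) * kerCols (P * G.submatrix id (Fin.castLE h))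

theorem combineCols_eq {n m g i : ℕ} (h : g + i ≤ m) (P : Matrix (Fin i) (Fin n) F2)
    (G : Matrix (Fin n) (Fin m) F2) : combineCols h P G = G *
      ((1 : Matrix (Fin m) (Fin m) F2).submatrix id (Fin.castLE h) *
        kerCols (P * G * (1 : Matrix (Fin m) (Fin m) F2).submatrix id (Fin.castLE h))) := by
  have : G.submatrix id (Fin.castLE h) =
      G * (1 : Matrix (Fin m) (Fin m) F2).submatrix id (Fin.castLE h) := by
    ext a b; simp [Matrix.mul_apply, Matrix.one_apply]
  rw [combineCols, this]
  simp only [Matrix.mul_assoc]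

/-- Write the combination as G·K with K depending only on PG, and let Λ be a left inverse of K. For
Y with SY = PY = 0, replacing G by G + YΛ keeps SG and PG, hence K and Λ, and changes GK by Y. In
characteristic 2 this is an involution that exchanges the fibres over Y and over 0. -/
theorem map_combineCols {n m g i k : ℕ} (h : g + i ≤ m) (P : Matrix (Fin i) (Fin n) F2)
    (S : Matrix (Fin k) (Fin n) F2) :
    (uniformOn ({G : Matrix (Fin n) (Fin m) F2 | S * G = 0} : Finset _)).map (combineCols h P) =
      uniformOn ({G : Matrix (Fin n) (Fin g) F2 | S * G = 0 ∧ P * G = 0} : Finset _) := by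
  set E := (1 : Matrix (Fin m) (Fin m) F2).submatrix id (Fin.castLE h)
  have hE : (1 : Matrix (Fin m) (Fin m) F2).submatrix (Fin.castLE h) id * E = 1 := by
    ext a b; simp [E, Matrix.mul_apply, Matrix.one_apply]
  choose L hL using fun M : Matrix (Fin i) (Fin (g + i)) F2 => exists_mul_kerCols M
  let Λ : Matrix (Fin i) (Fin m) F2 → Matrix (Fin g) (Fin m) F2 := fun M =>
    L (M * E) * (1 : Matrix (Fin m) (Fin m) F2).submatrix (Fin.castLE h) id
  have hΛ : ∀ M, Λ M * (E * kerCols (M * E)) = 1 := by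
    intro M
    rw [← Matrix.mul_assoc, Matrix.mul_assoc (L (M * E)), hE, Matrix.mul_one, hL]
  refine map_uniformOn_of_involution _ ⟨0, by simp⟩ (fun G hG => ?_) 0 fun Y hY => ?_
  · have hG : S * G = 0 := by simpa using hG
    simp only [Finset.mem_filter, Finset.mem_univ, true_and]
    constructor
    · rw [combineCols_eq, ← Matrix.mul_assoc, hG, Matrix.zero_mul]
    · rw [combineCols, ← Matrix.mul_assoc, mul_kerCols]
  · have hY : S * Y = 0 ∧ P * Y = 0 := by simpa using hY
    have hP : ∀ G : Matrix (Fin n) (Fin m) F2, P * (G + Y * Λ (P * G)) = P * G := by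
      intro G
      rw [Matrix.mul_add, ← Matrix.mul_assoc P Y, hY.2, Matrix.zero_mul, add_zero]
    have hcomb : ∀ G : Matrix (Fin n) (Fin m) F2,
        combineCols h P (G + Y * Λ (P * G)) = combineCols h P G + Y := by
      intro G
      rw [combineCols_eq, combineCols_eq, hP, Matrix.add_mul, Matrix.mul_assoc Y, hΛ,
        Matrix.mul_one]
    refine ⟨fun G => G + Y * Λ (P * G), fun G hG => ⟨?_, ?_, fun hy => ?_, fun hy => ?_⟩⟩
    · have hG : S * G = 0 := by simpa using hG
      simp [Matrix.mul_add, ← Matrix.mul_assoc, hY.1, hG]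
    · change G + Y * Λ (P * G) + Y * Λ (P * (G + Y * Λ (P * G))) = G
      rw [hP, add_assoc, mat_add_self, add_zero]
    · rw [hcomb, hy, mat_add_self]
    · rw [hcomb, hy, zero_add]

theorem null_bind_combineCols {n m g i t : ℕ} (h : g + i ≤ m) :
    (nullDist n m).bind (fun G => (uniformOn (sparseMats t i n)).map fun P =>
      combineCols h P G) = checkDist n g t i := by
  simp only [← PMF.bind_pure_comp, Function.comp_def]
  rw [PMF.bind_comm, checkDist]
  congr 1
  funext P
  have h1 := map_combineCols h P (0 : Matrix (Fin 0) (Fin n) F2)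
  simp only [Matrix.zero_mul, true_and, Finset.filter_true] at h1
  rw [← h1, nullDist, uniformOfFintype_eq_uniformOn]
  rfl

/-- The columns of the challenge are orthogonal to the planted s, and so are their combinations. As
s has the law of a row of P and is independent of the others, it serves as check number i+1. -/
theorem planted_bind_combineCols {n m g i t : ℕ} (h : g + i ≤ m) (ht : t ≤ n) :
    (plantedDist n m t).bind (fun G => (uniformOn (sparseMats t i n)).map fun P =>
      combineCols h P G) = checkDist n g t (i + 1) := by
  simp only [← PMF.bind_pure_comp, Function.comp_def]
  rw [PMF.bind_comm]
  simp only [plantedDist, PMF.bind_bind]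
  rw [PMF.bind_comm, checkDist, uniformOn_sparseMats (i + 1) ht, uniformOn_sparseMats i ht]
  have h2 := piPMF_cons fun _ : Fin (i + 1) => uniformOn (sparseVecs t n)
  refine Eq.trans ?_ (congrArg (fun μ => PMF.bind μ fun P : Matrix (Fin (i + 1)) (Fin n) F2 =>
    uniformOn ({G : Matrix (Fin n) (Fin g) F2 | P * G = 0} : Finset _)) h2).symm
  refine Eq.trans ?_ (PMF.bind_bind _ _ _).symm
  refine congrArg (PMF.bind _) (funext fun s => ?_)
  refine Eq.trans ?_ (PMF.bind_map _ _ _).symm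
  refine congrArg (PMF.bind _) (funext fun P => ?_)
  -- The planted vector is the single row of S; for fixed s and P the combination is uniform among
  -- the matrices annihilated by both.
  have h1 := map_combineCols h P (Matrix.of fun _ : Fin 1 => s)
  have e1 : ∀ k : ℕ, ∀ G : Matrix (Fin n) (Fin k) F2,
      (Matrix.of fun _ : Fin 1 => s) * G = 0 ↔ s ᵥ* G = 0 := by
    intro k G
    constructor
    · intro h; exact congrFun h 0
    · intro h; ext a b; exact congrFun h b
  obtain ⟨P', hP'⟩ : ∃ P' : Matrix (Fin (i + 1)) (Fin n) F2,
    P' = (Fin.cons s P : Fin (i + 1) → Fin n → F2) := ⟨_, rfl⟩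
  have e2 : ∀ G : Matrix (Fin n) (Fin g) F2, P' * G = 0 ↔ s ᵥ* G = 0 ∧ P * G = 0 := by
    subst hP'
    intro G
    constructor
    · intro h
      exact ⟨congrFun h 0, funext fun a => congrFun h a.succ⟩
    · rintro ⟨ha, hb⟩
      funext a
      cases a using Fin.cases with
      | zero => exact ha
      | succ a => exact congrFun hb a
  simp only [e1] at h1
  refine Eq.trans ?_ (congrArg (fun P' : Matrix (Fin (i + 1)) (Fin n) F2 =>
    uniformOn ({G : Matrix (Fin n) (Fin g) F2 | P' * G = 0} : Finset _)) hP')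
  simp only [e2]
  rw [← h1]
  rfl

theorem detC_combineCols {n m g i : ℕ} (h : g + i ≤ m) :
    DetC (i * ((g + i) * (n * 2 + 3)) + (i + 1) * (50 * (g + i + 1) ^ 3) +
      n * (g * ((g + i) * 2 + 3)))
      fun x : Matrix (Fin n) (Fin m) F2 × Matrix (Fin i) (Fin n) F2 => combineCols h x.2 x.1 := by
  have h1 : DetC 0 fun x : Matrix (Fin n) (Fin m) F2 × Matrix (Fin i) (Fin n) F2 =>
      x.1.submatrix id (Fin.castLE h) :=
    .pi_zero fun a => .pi_zero fun b => DetC.fst.entry _ _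
  exact (h1.matMul (detC_kerCols.comp (DetC.matMul .snd h1))).mono (by omega)

theorem PolySize.of_polyBdd {C : ℕ → Circuit} {N o : ℕ → ℕ} (hN : PolyBdd N) (ho : PolyBdd o)
    (h : ∀ l, (C l).size ≤ 2 * N l + o l) : PolySize C :=
  (((PolyBdd.const 2).mul hN).add ho).mono h

variable {g t r : ℕ → ℕ} {η : ℝ} {ζ : ℕ → ℝ} {o N Q : ℕ → ℕ}

/-- Under the planted XOR assumption no test tells a matrix `G` with parity checks from a uniform
matrix. -/
theorem negligible_checkDist (hX : PlantedXOR (fun n => 2 * g n) t) (ht : ∀ l, t l ≤ l)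
    (hg : ∀ l, g l ≤ l) (hr : ∀ l, r l ≤ g l)
    {E : ∀ l, Matrix (Fin l) (Fin (g l)) F2 → PMF (Str (o l))} (hN : PolyBdd N) (ho : PolyBdd o)
    (hE : ∀ l, Samp (N l) (E l)) :
    Negligible fun l => |acc ((checkDist l (g l) (t l) 0).bind (E l)) -
      acc ((checkDist l (g l) (t l) (r l)).bind (E l))| := by
  have hrl : ∀ l, r l ≤ l := fun l => (hr l).trans (hg l)
  refine negligible_hybrid (PolyBdd.id.mono hrl)
    (fun l i => acc ((checkDist l (g l) (t l) i).bind (E l))) fun j => ?_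
  let cost : ℕ → ℕ := fun l => l * (3 * (l + 1) + l * (20 * (l + 1) ^ 2)) +
    ((l * ((l + l) * (l * 2 + 3)) + (l + 1) * (50 * (l + l + 1) ^ 3) +
      l * (l * ((l + l) * 2 + 3))) + N l)
  have hcost : PolyBdd cost := by
    have c := PolyBdd.const
    have x := PolyBdd.id
    have x1 := x.add (c 1)
    have x2 := x.add x
    exact (x.mul (((c 3).mul x1).add (x.mul ((c 20).mul (x1.pow 2))))).add
      ((((x.mul (x2.mul ((x.mul (c 2)).add (c 3)))).add
        (x1.mul ((c 50).mul ((x2.add (c 1)).pow 3)))).add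
        (x.mul (x.mul ((x2.mul (c 2)).add (c 3))))).add hN)
  -- The reduction: sample `j l` checks, combine the columns of the challenge, run the test. It
  -- needs `g l + j l` columns, and `2 * g l` are enough because `j l < r l ≤ g l`. For other `l`
  -- the gap is `0` by convention and the empty circuit serves.
  have hD : ∀ l, ∃ C : Circuit, C.size ≤ 2 * cost l + o l ∧ ∀ h : j l < r l,
      ∀ x, C.eval noOracle (List.ofFn x) = ((uniformOn (sparseMats (t l) (j l) l)).bind fun P =>
        E l (combineCols (m := 2 * g l) (by have := hr l; omega) P (unflat x))).map List.ofFn := by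
    intro l
    by_cases h : j l < r l
    · have hm : g l + j l ≤ 2 * g l := by have := hr l; omega
      have h1 := samp_sparseMats (X := Str (l * (2 * g l))) (j l) (ht l)
      have h2 : DetC 0 fun z : Str (l * (2 * g l)) × Matrix (Fin (j l)) (Fin l) F2 =>
          ((unflat z.1 : Matrix (Fin l) (Fin (2 * g l)) F2), z.2) :=
        (detC_unflat.comp_zero .fst).prod .snd
      have h3 := h1.bind ((hE l).comp ((detC_combineCols hm).comp_zero h2))
      obtain ⟨C, hC1, hC2⟩ := h3.exists_circuit
      refine ⟨C, hC1.trans ?_, fun _ x => hC2 noOracle x⟩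
      have hj := h.le.trans (hrl l)
      have hgl := hg l
      have htl := ht l
      have e1 : 3 * (t l + 1) + l * (20 * (t l + 1) ^ 2) ≤
          3 * (l + 1) + l * (20 * (l + 1) ^ 2) := by gcongr
      have e2 : (g l + j l + 1) ^ 3 ≤ (l + l + 1) ^ 3 := by gcongr
      have e3 := Nat.mul_le_mul hj e1
      have e4 : j l * ((g l + j l) * (l * 2 + 3)) ≤ l * ((l + l) * (l * 2 + 3)) := by gcongr
      have e5 : (j l + 1) * (50 * (g l + j l + 1) ^ 3) ≤ (l + 1) * (50 * (l + l + 1) ^ 3) := by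
        gcongr
      have e6 : l * (g l * ((g l + j l) * 2 + 3)) ≤ l * (l * ((l + l) * 2 + 3)) := by gcongr
      simp only [cost]
      omega
    · exact ⟨⟨[], []⟩, by simp [Circuit.size], fun h' => absurd h' h⟩
  choose D hD1 hD2 using hD
  refine Negligible.of_abs_le (hX D (PolySize.of_polyBdd hcost ho hD1)) fun l => ?_
  split_ifs with h
  · have hm : g l + j l ≤ 2 * g l := by have := hr l; omega
    have key : ∀ μ : PMF (Matrix (Fin l) (Fin (2 * g l)) F2),
        μ.bind (fun G => (D l).eval noOracle (List.ofFn (flat G))) =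
          ((μ.bind fun G => (uniformOn (sparseMats (t l) (j l) l)).map fun P =>
            combineCols hm P G).bind (E l)).map List.ofFn := by
      intro μ
      simp only [hD2 l h, unflat_flat, PMF.bind_bind, PMF.map_bind, PMF.bind_map,
        Function.comp_def]
    refine le_of_eq ?_
    rw [abs_abs, abs_abs]
    simp only [key]
    rw [null_bind_combineCols, planted_bind_combineCols hm (ht l)]
    rfl
  · simp

/-! ## Answers of the encoder under LPN -/

/-- The encoder with the public key `(G, z)`. -/
def encodeDist {n g : ℕ} (η : ℝ) (G : Matrix (Fin n) (Fin g) F2) (z : Str n) : PMF (Str n) :=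
  (uniformStr g).bind fun u => (berStr η n).map fun e => G *ᵥ u + z + e

theorem samp_encodeDist {n g : ℕ} (η : ℝ) :
    Samp (2 * n + g + n * (2 * g + 3) + n) fun x : Matrix (Fin n) (Fin g) F2 × Str n =>
      encodeDist η x.1 x.2 := by
  have := (samp_encode (n := n) (g := g) η).comp_zero detC_packKey
  simp only [keyMat_packKey, keyVec_packKey] at this
  exact this

/-- The first `j` answers are uniform, the other ones are encodings. -/
def mixedAnswers {n g : ℕ} (η : ℝ) (Q j : ℕ) (G : Matrix (Fin n) (Fin g) F2) (z : Str n) :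
    PMF (Fin Q → Str n) :=
  piPMF fun i => if (i : ℕ) < j then uniformStr n else encodeDist η G z

/-- As `mixedAnswers`, but the answer with number `j` is `y`. -/
def fixedAnswer {n g : ℕ} (η : ℝ) (Q j : ℕ) (G : Matrix (Fin n) (Fin g) F2) (z y : Str n) :
    PMF (Fin Q → Str n) :=
  piPMF fun i => if (i : ℕ) < j then uniformStr n else if (i : ℕ) = j then PMF.pure y
    else encodeDist η G z

theorem encodeDist_bind_fixedAnswer {n g Q j : ℕ} (η : ℝ) (hj : j < Q)
    (G : Matrix (Fin n) (Fin g) F2) (z : Str n) :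
    (encodeDist η G z).bind (fixedAnswer η Q j G z) = mixedAnswers η Q j G z := by
  rw [mixedAnswers, piPMF_eq_bind_update _ (⟨j, hj⟩ : Fin Q)]
  simp only [lt_irrefl, if_false]
  congr 1
  funext y
  rw [fixedAnswer]
  congr 1
  funext i
  by_cases hi : i = ⟨j, hj⟩
  · subst hi; simp
  · have : (i : ℕ) ≠ j := fun h => hi (Fin.ext h)
    simp [this, hi]

theorem uniformStr_bind_fixedAnswer {n g Q j : ℕ} (η : ℝ) (hj : j < Q)
    (G : Matrix (Fin n) (Fin g) F2) (z : Str n) :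
    (uniformStr n).bind (fixedAnswer η Q j G z) = mixedAnswers η Q (j + 1) G z := by
  rw [mixedAnswers, piPMF_eq_bind_update _ (⟨j, hj⟩ : Fin Q)]
  simp only [Nat.lt_succ_self, if_true]
  congr 1
  funext y
  rw [fixedAnswer]
  congr 1
  funext i
  by_cases hi : i = ⟨j, hj⟩
  · subst hi; simp
  · have h1 : (i : ℕ) ≠ j := fun h => hi (Fin.ext h)
    have h2 : (i : ℕ) ≤ j ↔ (i : ℕ) < j := by omega
    simp [h1, h2, hi]

/-- The game in which a test gets the public key `(G, z)` and answers of the given kind. -/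
def game {n g Q o : ℕ} (T : Str (n * g + n) × (Fin Q → Str n) → PMF (Str o))
    (ans : Matrix (Fin n) (Fin g) F2 → Str n → PMF (Fin Q → Str n))
    (G : Matrix (Fin n) (Fin g) F2) : PMF (Str o) :=
  (uniformStr n).bind fun z => (ans G z).bind fun a => T (packKey G z, a)

theorem samp_game {n g Q o N : ℕ} (η : ℝ) {T : Str (n * g + n) × (Fin Q → Str n) → PMF (Str o)}
    (hT : Samp N T) (j : ℕ) :
    Samp (n + (Q * (2 * n + g + n * (2 * g + 3) + n) + N))
      fun x : Matrix (Fin n) (Fin g) F2 => game T (mixedAnswers η Q j) x := by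
  have h1 : Samp (Q * (2 * n + g + n * (2 * g + 3) + n))
      fun x : Matrix (Fin n) (Fin g) F2 × Str n => mixedAnswers η Q j x.1 x.2 :=
    .pi_fin fun i => by
      split_ifs
      · exact (Samp.uniform_str n).mono (by omega)
      · exact samp_encodeDist η
  exact (Samp.uniform_str n).bind
    (h1.bind (hT.comp_zero ((detC_packKey.comp_zero .fst).prod .snd)))

/-- The LPN distinguisher. It reads the challenge (A, y) in the format of a public key, draws its
own z, answers query j by y + z, and produces the remaining answers itself, encodings included,
since these require the public key only. -/
theorem samp_fixedAnswer {n g Q j o N : ℕ} (η : ℝ)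
    {T : Str (n * g + n) × (Fin Q → Str n) → PMF (Str o)} (hT : Samp N T) :
    Samp (n + (Q * (2 * n + g + n * (2 * g + 3) + n) + N)) fun x : Str (n * g + n) =>
      (uniformStr n).bind fun z => (fixedAnswer η Q j (keyMat x) z (keyVec x + z)).bind fun a =>
        T (packKey (keyMat x) z, a) := by
  have h0 : DetC 0 fun x : Str (n * g + n) × Str n =>
      ((keyMat x.1 : Matrix (Fin n) (Fin g) F2), x.2) := (detC_keyMat.comp_zero .fst).prod .snd
  have henc : Samp (2 * n + g + n * (2 * g + 3) + n) fun x : Str (n * g + n) × Str n =>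
      encodeDist η (keyMat x.1 : Matrix (Fin n) (Fin g) F2) x.2 := by
    have := Samp.comp_zero (samp_encodeDist (n := n) (g := g) η) h0
    exact this
  have hv : DetC 0 fun x : Str (n * g + n) × Str n => (keyVec x.1 : Str n) :=
    detC_keyVec.comp_zero .fst
  have hy : DetC n fun x : Str (n * g + n) × Str n => (keyVec x.1 : Str n) + x.2 :=
    (hv.vecAdd .snd).mono (by omega)
  have h1 : Samp (Q * (2 * n + g + n * (2 * g + 3) + n))
      fun x : Str (n * g + n) × Str n =>
        fixedAnswer η Q j (keyMat x.1 : Matrix (Fin n) (Fin g) F2) x.2 (keyVec x.1 + x.2) := by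
    refine .pi_fin fun i => ?_
    split_ifs
    · exact (Samp.uniform_str n).mono (by omega)
    · exact (Samp.det hy).mono (by omega)
    · exact henc
  have h2 : DetC 0 fun x : Str (n * g + n) × Str n =>
      packKey (keyMat x.1 : Matrix (Fin n) (Fin g) F2) x.2 := detC_packKey.comp_zero h0
  have h3 : DetC 0 fun x : (Str (n * g + n) × Str n) × (Fin Q → Str n) =>
      (packKey (keyMat x.1.1 : Matrix (Fin n) (Fin g) F2) x.1.2, x.2) :=
    (h2.comp_zero .fst).prod .snd
  have h4 := h1.bind (g := fun x => T (packKey (keyMat x.1.1 : Matrix (Fin n) (Fin g) F2) x.1.2,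
    x.2)) (hT.comp_zero h3)
  exact (Samp.uniform_str n).bind (g := fun x : Str (n * g + n) × Str n =>
    (fixedAnswer η Q j (keyMat x.1 : Matrix (Fin n) (Fin g) F2) x.2 (keyVec x.1 + x.2)).bind
      fun a => T (packKey (keyMat x.1 : Matrix (Fin n) (Fin g) F2) x.2, a)) h4

/-- Under the LPN assumption no test tells encodings from uniform answers, if `G` is uniform. -/
theorem negligible_game (hL : LPN g η) (hg : ∀ l, g l ≤ l) (hQ : PolyBdd Q) (ho : PolyBdd o)
    (hN : PolyBdd N) {T : ∀ l, Str (l * g l + l) × (Fin (Q l) → Str l) → PMF (Str (o l))}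
    (hT : ∀ l, Samp (N l) (T l)) :
    Negligible fun l => |acc ((PMF.uniformOfFintype (Matrix (Fin l) (Fin (g l)) F2)).bind
        (game (T l) (mixedAnswers η (Q l) 0))) -
      acc ((PMF.uniformOfFintype (Matrix (Fin l) (Fin (g l)) F2)).bind
        (game (T l) (mixedAnswers η (Q l) (Q l))))| := by
  refine negligible_hybrid hQ
    (fun l j => acc ((PMF.uniformOfFintype (Matrix (Fin l) (Fin (g l)) F2)).bind
        (game (T l) (mixedAnswers η (Q l) j)))) fun j => ?_
  let cost : ℕ → ℕ := fun l => l + (Q l * (2 * l + l + l * (2 * l + 3) + l) + N l)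
  have hcost : PolyBdd cost := by
    have c := PolyBdd.const
    have x := PolyBdd.id
    exact x.add ((hQ.mul (((((c 2).mul x).add x).add
      (x.mul (((c 2).mul x).add (c 3)))).add x)).add hN)
  choose D hD1 hD2 using fun l => (samp_fixedAnswer (j := j l) η (hT l)).exists_circuit
  have hD3 : ∀ l, (D l).size ≤ 2 * cost l + o l := by
    intro l
    have hgl := hg l
    have e1 : Q l * (2 * l + g l + l * (2 * g l + 3) + l) ≤
        Q l * (2 * l + l + l * (2 * l + 3) + l) := by gcongr
    have := hD1 l
    simp only [cost]
    omega
  refine Negligible.of_abs_le (hL D (PolySize.of_polyBdd hcost ho hD3)) fun l => ?_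
  split_ifs with h
  · refine le_of_eq ?_
    rw [abs_abs, abs_abs]
    have key : ∀ (A : Matrix (Fin l) (Fin (g l)) F2) (y : Str l),
        (D l).eval noOracle (List.ofFn (flat A) ++ List.ofFn y) =
          ((uniformStr l).bind fun z => (fixedAnswer η (Q l) (j l) A z (y + z)).bind fun a =>
            T l (packKey A z, a)).map List.ofFn := by
      intro A y
      have := hD2 l noOracle (packKey A y)
      rw [keyMat_packKey, keyVec_packKey] at this
      rw [← this, packKey, List.ofFn_fin_append]
    have e1 : ∀ A : Matrix (Fin l) (Fin (g l)) F2,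
        ((uniformStr (g l)).bind fun s => (berStr η l).bind fun e =>
          (D l).eval noOracle (List.ofFn (flat A) ++ List.ofFn (A *ᵥ s + e))) =
          (game (T l) (mixedAnswers η (Q l) (j l)) A).map List.ofFn := by
      intro A
      rw [game]
      simp only [key, ← encodeDist_bind_fixedAnswer η h, encodeDist, PMF.bind_bind, PMF.map_bind,
        PMF.bind_map, Function.comp_def]
      conv_lhs => enter [2, s]; rw [PMF.bind_comm]
      rw [PMF.bind_comm]
      simp only [add_right_comm]
    have e2 : ∀ A : Matrix (Fin l) (Fin (g l)) F2,
        ((uniformStr l).bind fun u =>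
          (D l).eval noOracle (List.ofFn (flat A) ++ List.ofFn u)) =
          (game (T l) (mixedAnswers η (Q l) (j l + 1)) A).map List.ofFn := by
      intro A
      rw [game]
      simp only [key, ← uniformStr_bind_fixedAnswer η h, PMF.bind_bind, PMF.map_bind]
      rw [PMF.bind_comm]
      congr 1
      funext z
      -- A uniform challenge shifted by z is still uniform for every fixed z.
      conv_rhs => rw [← uniformStr_map_add z]
      rw [PMF.bind_map]
      rfl
    simp only [e1, e2, acc, PMF.map_bind]
  · simp

/-! ## Pseudorandomness -/

theorem ldpc_map_snd (n g t r : ℕ) : (ldpc n g t r).map Prod.snd = checkDist n g t r := by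
  rw [ldpc, PMF.map_bind, checkDist]
  congr 1
  funext P
  rw [PMF.map_comp]
  exact PMF.map_id _

theorem checkDist_zero (n g t : ℕ) :
    checkDist n g t 0 = PMF.uniformOfFintype (Matrix (Fin n) (Fin g) F2) := by
  rw [checkDist, uniformOfFintype_eq_uniformOn]
  have : ∀ P : Matrix (Fin 0) (Fin n) F2,
      ({G : Matrix (Fin n) (Fin g) F2 | P * G = 0} : Finset _) = Finset.univ := by
    intro P
    ext G
    simp only [Finset.mem_filter, Finset.mem_univ, true_and, iff_true]
    ext i
    exact i.elim0
  simp only [this, PMF.bind_const]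

theorem ldpcPRC_pseudorandom (hg : ∀ l, g l ≤ l) (ht : ∀ l, t l ≤ l) (hr : ∀ l, r l ≤ g l)
    (hL : LPN g η) (hX : PlantedXOR (fun n => 2 * g n) t) :
    (ldpcPRC (fun n => n) g t r (fun _ => η) ζ).Pseudorandom := by
  intro A hA
  choose T hT1 hT2 using fun l => exists_samp_adversary (A l) l (l * g l + l)
  have hsize : PolyBdd fun l => (A l).size := hA
  have hQ : PolyBdd fun l => (A l).gates.length := hsize.mono fun l => by
    have : (A l).gates.length ≤ ((A l).gates.map Gate.cost).sum := by
      have := List.card_nsmul_le_sum ((A l).gates.map Gate.cost) 1 (by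
        intro c hc
        obtain ⟨g, -, rfl⟩ := List.mem_map.1 hc
        cases g <;> simp [Gate.cost])
      simpa using this
    simp only [Circuit.size]
    omega
  have ho : PolyBdd fun l => (A l).outs.length := hsize.mono fun l => by
    simp only [Circuit.size]
    omega
  have hN := hQ.add (PolyBdd.const 3)
  -- Acceptance probability with i parity checks in G and j uniform answers. The number of gates
  -- bounds the number of oracle calls.
  let μ : ∀ l, ℕ → ℕ → ℝ := fun l i j => acc ((checkDist l (g l) (t l) i).bind
    (game (T l) (mixedAnswers η (A l).gates.length j)))
  have hS : ∀ (j : ℕ → ℕ) l, Samp _ (game (T l) (mixedAnswers η (A l).gates.length (j l))) :=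
    fun j l => samp_game η (hT1 l) (j l)
  have hcost : PolyBdd fun l => l + ((A l).gates.length *
      (2 * l + g l + l * (2 * g l + 3) + l) + ((A l).gates.length + 3)) := by
    have c := PolyBdd.const
    have x := PolyBdd.id
    have y := x.mono hg
    exact x.add ((hQ.mul (((((c 2).mul x).add y).add
      (x.mul (((c 2).mul y).add (c 3)))).add x)).add hN)
  have h1 := negligible_checkDist hX ht hg hr hcost ho (hS fun _ => 0)
  have h2 := negligible_game hL hg hQ ho hN hT1
  have h3 := negligible_checkDist hX ht hg hr hcost ho (hS fun l => (A l).gates.length)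
  have h0 : ∀ l, PMF.uniformOfFintype (Matrix (Fin l) (Fin (g l)) F2) =
    checkDist l (g l) (t l) 0 := fun l => (checkDist_zero _ _ _).symm
  simp only [h0] at h2
  have hreal : ∀ l, prob (((ldpcPRC (fun n => n) g t r (fun _ => η) ζ).keyGen l).bind fun k =>
      (A l).eval (oracleOf ((ldpcPRC (fun n => n) g t r (fun _ => η) ζ).encode l k.2))
        (List.ofFn k.2)) {[1]} = μ l (r l) 0 := by
    intro l
    simp only [μ, acc]
    congr 1
    rw [← ldpc_map_snd, PMF.bind_map]
    refine (PMF.bind_bind _ _ _).trans (Eq.trans ?_ (PMF.map_bind _ _ _).symm)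
    congr 1
    funext PG
    refine (PMF.bind_map _ _ _).trans ?_
    rw [Function.comp_apply, game, PMF.map_bind]
    congr 1
    funext z
    refine (hT2 l _ _).trans ?_
    have : ∀ x : Str 0, (ldpcPRC (fun n => n) g t r (fun _ => η) ζ).encode l
        (packKey PG.2 z) x = encodeDist η PG.2 z := by
      intro x
      change ((uniformStr (g l)).bind fun u => (berStr η l).map fun e =>
        keyMat (packKey PG.2 z) *ᵥ u + keyVec (packKey PG.2 z) + e) = _
      rw [keyMat_packKey, keyVec_packKey]
      rfl
    simp only [mixedAnswers, Nat.not_lt_zero, if_false]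
    congr 2
    exact congrArg _ (funext fun _ => this _)
  have hideal : ∀ l, prob (((ldpcPRC (fun n => n) g t r (fun _ => η) ζ).keyGen l).bind fun k =>
      (A l).eval (oracleOf fun _ : Str ((ldpcPRC (fun n => n) g t r (fun _ => η) ζ).msgLen l) =>
        uniformStr ((ldpcPRC (fun n => n) g t r (fun _ => η) ζ).blockLen l))
        (List.ofFn k.2)) {[1]} = μ l (r l) (A l).gates.length := by
    intro l
    simp only [μ, acc]
    congr 1
    rw [← ldpc_map_snd, PMF.bind_map]
    refine (PMF.bind_bind _ _ _).trans (Eq.trans ?_ (PMF.map_bind _ _ _).symm)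
    congr 1
    funext PG
    refine (PMF.bind_map _ _ _).trans ?_
    rw [Function.comp_apply, game, PMF.map_bind]
    congr 1
    funext z
    refine (hT2 l _ _).trans ?_
    simp only [mixedAnswers, Fin.is_lt, if_true]
    rfl
  refine Negligible.of_abs_le ((h1.add h2).add h3) fun l => ?_
  rw [hreal, hideal, abs_abs]
  refine le_trans ?_ (le_abs_self _)
  have e1 := abs_sub_le (μ l (r l) 0) (μ l 0 0) (μ l (r l) (A l).gates.length)
  have e2 := abs_sub_le (μ l 0 0) (μ l 0 (A l).gates.length) (μ l (r l) (A l).gates.length)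
  rw [abs_sub_comm (μ l (r l) 0) (μ l 0 0)] at e1
  change _ ≤ |μ l 0 0 - μ l (r l) 0| + |μ l 0 0 - μ l 0 (A l).gates.length| +
    |μ l 0 (A l).gates.length - μ l (r l) (A l).gates.length|
  linarith


/-! ## Probabilities -/

section Prob

variable {α β : Type}

theorem toOuterMeasure_le_one (μ : PMF α) (S : Set α) : μ.toOuterMeasure S ≤ 1 :=
  (μ.toOuterMeasure.mono (Set.subset_univ S)).trans
    ((μ.toOuterMeasure_apply_eq_one_iff Set.univ).2 (Set.subset_univ _)).le

theorem toOuterMeasure_ne_top (μ : PMF α) (S : Set α) : μ.toOuterMeasure S ≠ ⊤ :=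
  ne_top_of_le_ne_top ENNReal.one_ne_top (toOuterMeasure_le_one μ S)

theorem prob_nonneg (μ : PMF α) (S : Set α) : 0 ≤ prob μ S := ENNReal.toReal_nonneg

theorem prob_mono (μ : PMF α) {S T : Set α} (h : S ⊆ T) : prob μ S ≤ prob μ T :=
  ENNReal.toReal_mono (toOuterMeasure_ne_top _ _) (μ.toOuterMeasure.mono h)

theorem one_sub_prob_compl_le (μ : PMF α) (S : Set α) : 1 - prob μ Sᶜ ≤ prob μ S := by
  have h1 : (1 : ENNReal) ≤ μ.toOuterMeasure S + μ.toOuterMeasure Sᶜ := by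
    rw [← (μ.toOuterMeasure_apply_eq_one_iff Set.univ).2 (Set.subset_univ _),
      ← Set.union_compl_self S]
    exact MeasureTheory.measure_union_le S Sᶜ
  have h2 := ENNReal.toReal_mono (ENNReal.add_ne_top.2 ⟨toOuterMeasure_ne_top μ S,
    toOuterMeasure_ne_top μ Sᶜ⟩) h1
  rw [ENNReal.toReal_add (toOuterMeasure_ne_top _ _) (toOuterMeasure_ne_top _ _),
    ENNReal.toReal_one] at h2
  simp only [prob]
  linarith

theorem prob_map (μ : PMF α) (f : α → β) (S : Set β) : prob (μ.map f) S = prob μ (f ⁻¹' S) := by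
  rw [prob, PMF.toOuterMeasure_map_apply, prob]

/-- The union bound: either the first stage falls into the bad set `B`, or the second stage fails
with probability at most `c`. -/
theorem prob_bind_le (μ : PMF α) (f : α → PMF β) (S : Set β) (B : Set α) {c : ℝ} (hc : 0 ≤ c)
    (h : ∀ a ∈ μ.support, a ∉ B → prob (f a) S ≤ c) : prob (μ.bind f) S ≤ prob μ B + c := by
  have h1 : (μ.bind f).toOuterMeasure S ≤ μ.toOuterMeasure B + ENNReal.ofReal c := by
    rw [PMF.toOuterMeasure_bind_apply, PMF.toOuterMeasure_apply]
    have : ENNReal.ofReal c = ∑' a, μ a * ENNReal.ofReal c := by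
      rw [ENNReal.tsum_mul_right, μ.tsum_coe, one_mul]
    rw [this, ← ENNReal.tsum_add]
    refine ENNReal.tsum_le_tsum fun a => ?_
    by_cases ha : a ∈ B
    · rw [Set.indicator_of_mem ha]
      exact le_add_right (mul_le_of_le_one_right' (toOuterMeasure_le_one _ _))
    · by_cases hs : a ∈ μ.support
      · refine le_add_left (mul_le_mul_right ?_ _)
        rw [← ENNReal.ofReal_toReal (toOuterMeasure_ne_top (f a) S)]
        exact ENNReal.ofReal_le_ofReal (h a hs ha)
      · rw [(PMF.apply_eq_zero_iff _ _).2 hs]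
        simp
  refine (ENNReal.toReal_mono (ENNReal.add_ne_top.2 ⟨toOuterMeasure_ne_top _ _,
    ENNReal.ofReal_ne_top⟩) h1).trans ?_
  rw [ENNReal.toReal_add (toOuterMeasure_ne_top _ _) ENNReal.ofReal_ne_top,
    ENNReal.toReal_ofReal hc]
  rfl

theorem prob_eq_sum [Fintype α] (μ : PMF α) (S : Set α) [DecidablePred (· ∈ S)] :
    prob μ S = ∑ x with x ∈ S, (μ x).toReal := by
  rw [prob, PMF.toOuterMeasure_apply, tsum_fintype,
    ENNReal.toReal_sum fun x _ => ?_, Finset.sum_filter]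
  · refine Finset.sum_congr rfl fun x _ => ?_
    by_cases h : x ∈ S
    · simp [h]
    · simp [h]
  · by_cases h : x ∈ S
    · simpa [h] using PMF.apply_ne_top μ x
    · simp [h]

theorem sum_toReal_eq_one [Fintype α] (μ : PMF α) : ∑ x, (μ x).toReal = 1 := by
  rw [← ENNReal.toReal_sum fun x _ => PMF.apply_ne_top μ x, pmf_sum_eq_one, ENNReal.toReal_one]

/-- A Chernoff bound for the lower tail of a sum of independent random variables in `[-1, 1]`. -/
theorem prob_piPMF_sum_le [Fintype α] {m : ℕ} (μ : Fin m → PMF α) (X : Fin m → α → ℝ)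
    (hX : ∀ i a, |X i a| ≤ 1) (M : Fin m → ℝ) (hM : ∀ i, M i ≤ ∑ a, (μ i a).toReal * X i a)
    {s : ℝ} (hs0 : 0 ≤ s) (hs1 : s ≤ 1) (A : ℝ) :
    prob (piPMF μ) {x | ∑ i, X i (x i) ≤ A} ≤ Real.exp (s * A - s * ∑ i, M i + m * s ^ 2) := by
  classical
  have hstep : ∀ i, ∑ a, (μ i a).toReal * Real.exp (-(s * X i a)) ≤
      Real.exp (-(s * M i) + s ^ 2) := by
    intro i
    -- exp(-y) ≤ 1 - y + y² for |y| ≤ 1, at y = sX; after averaging, 1 + x ≤ exp x returns to an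
    -- exponential.
    have h1 : ∀ a, Real.exp (-(s * X i a)) ≤ 1 - s * X i a + s ^ 2 := by
      intro a
      have hx := hX i a
      have h2 : |-(s * X i a)| ≤ 1 := by
        rw [abs_neg, abs_mul, abs_of_nonneg hs0]
        exact mul_le_one₀ hs1 (abs_nonneg _) hx
      have h3 := (abs_le.1 (Real.abs_exp_sub_one_sub_id_le h2)).2
      have h4 : (X i a) ^ 2 ≤ 1 := (sq_le_one_iff_abs_le_one _).2 hx
      nlinarith [sq_nonneg s]
    calc _ ≤ ∑ a, (μ i a).toReal * (1 - s * X i a + s ^ 2) :=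
          Finset.sum_le_sum fun a _ => mul_le_mul_of_nonneg_left (h1 a) ENNReal.toReal_nonneg
      _ = (∑ a, (μ i a).toReal) * (1 + s ^ 2) - s * ∑ a, (μ i a).toReal * X i a := by
          rw [Finset.sum_mul, Finset.mul_sum, ← Finset.sum_sub_distrib]
          exact Finset.sum_congr rfl fun a _ => by ring
      _ ≤ -(s * M i) + s ^ 2 + 1 := by
          rw [sum_toReal_eq_one]
          nlinarith [mul_le_mul_of_nonneg_left (hM i) hs0]
      _ ≤ _ := Real.add_one_le_exp _
  rw [prob_eq_sum]
  calc _ ≤ ∑ x with x ∈ {x : Fin m → α | ∑ i, X i (x i) ≤ A},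
        (piPMF μ x).toReal * Real.exp (s * A - s * ∑ i, X i (x i)) := by
        refine Finset.sum_le_sum fun x hx => ?_
        refine le_mul_of_one_le_right ENNReal.toReal_nonneg (Real.one_le_exp ?_)
        have := mul_le_mul_of_nonneg_left (Finset.mem_filter.1 hx).2 hs0
        linarith
    _ ≤ ∑ x, (piPMF μ x).toReal * Real.exp (s * A - s * ∑ i, X i (x i)) :=
        Finset.sum_le_sum_of_subset_of_nonneg (Finset.filter_subset _ _) fun x _ _ =>
          mul_nonneg ENNReal.toReal_nonneg (Real.exp_pos _).le
    _ = Real.exp (s * A) * ∑ x : Fin m → α,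
          ∏ i, ((μ i (x i)).toReal * Real.exp (-(s * X i (x i)))) := by
        rw [Finset.mul_sum]
        refine Finset.sum_congr rfl fun x _ => ?_
        rw [piPMF_apply, ENNReal.toReal_prod, Finset.prod_mul_distrib, ← Real.exp_sum,
          sub_eq_add_neg, Real.exp_add, Finset.mul_sum, ← Finset.sum_neg_distrib]
        ring
    _ = Real.exp (s * A) * ∏ i, ∑ a, (μ i a).toReal * Real.exp (-(s * X i a)) := by
        rw [Finset.prod_univ_sum, Fintype.piFinset_univ]
    _ ≤ Real.exp (s * A) * ∏ i, Real.exp (-(s * M i) + s ^ 2) := by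
        refine mul_le_mul_of_nonneg_left (Finset.prod_le_prod (fun i _ => ?_) fun i _ => hstep i)
          (Real.exp_pos _).le
        exact Finset.sum_nonneg fun a _ => mul_nonneg ENNReal.toReal_nonneg (Real.exp_pos _).le
    _ = _ := by
        rw [← Real.exp_sum, ← Real.exp_add, Finset.sum_add_distrib, Finset.sum_neg_distrib,
          ← Finset.mul_sum]
        simp only [Finset.sum_const, Finset.card_univ, Fintype.card_fin, nsmul_eq_mul]
        congr 1
        ring

end Prob

/-! ## Signs and sparse parities -/

/-- The sign `(-1)^b`. -/
def sgn (b : F2) : ℝ := if b = 0 then 1 else -1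

@[simp] theorem sgn_zero : sgn 0 = 1 := if_pos rfl

@[simp] theorem sgn_one : sgn 1 = -1 := if_neg one_ne_zero

theorem sgn_add (a b : F2) : sgn (a + b) = sgn a * sgn b := by
  rcases F2_cases a with rfl | rfl <;> rcases F2_cases b with rfl | rfl <;> simp
  rw [show (1 : F2) + 1 = 0 from rfl, sgn_zero]

theorem abs_sgn (b : F2) : |sgn b| = 1 := by
  rcases F2_cases b with rfl | rfl <;> simp

theorem sgn_mul_self (b : F2) : sgn b * sgn b = 1 := by
  rcases F2_cases b with rfl | rfl <;> simp

theorem sum_sgn {m : ℕ} (v : Str m) : ∑ i, sgn (v i) = m - 2 * hammingNorm v := by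
  have h : ∀ i, sgn (v i) = 1 - 2 * if v i ≠ 0 then (1 : ℝ) else 0 := by
    intro i
    rcases F2_cases (v i) with h | h
    · simp [h]
    · simp [h]; norm_num
  simp only [h, Finset.sum_sub_distrib, ← Finset.mul_sum, Finset.sum_boole, hammingNorm]
  simp

/-- The sum of `(-1)^(s · v)` over all `t`-sparse `s`. -/
def paritySum {n : ℕ} (t : ℕ) (v : Str n) : ℝ := ∑ s ∈ sparseVecs t n, sgn (s ⬝ᵥ v)

theorem sum_cons {n : ℕ} (f : Str (n + 1) → ℝ) :
    ∑ s, f s = ∑ s : Str n, f (Fin.cons 0 s) + ∑ s : Str n, f (Fin.cons 1 s) := by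
  rw [← (Fin.consEquiv fun _ : Fin (n + 1) => F2).sum_comp, Fintype.sum_prod_type]
  have hu : (Finset.univ : Finset F2) = {0, 1} := by decide
  rw [hu, Finset.sum_pair (by decide)]
  rfl

theorem paritySum_eq {n : ℕ} (t : ℕ) (v : Str n) :
    paritySum t v = ∑ s : Str n, if hammingNorm s = t then sgn (s ⬝ᵥ v) else 0 := by
  rw [paritySum, sparseVecs, Finset.sum_filter]

theorem paritySum_zero {n : ℕ} (v : Str n) : paritySum 0 v = 1 := by
  rw [paritySum_eq, Finset.sum_eq_single 0]
  · simp
  · intro s _ hs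
    rw [if_neg (by simpa using hs)]
  · simp

/-- The sums over sparse s are the coefficients of the product of the factors 1 + (-1)^(v_i) X; this
is the effect of one more factor, that is, of splitting by the first entry of s. -/
theorem paritySum_cons_succ {n : ℕ} (t : ℕ) (b : F2) (v : Str n) :
    paritySum (t + 1) (Fin.cons b v : Str (n + 1)) =
      paritySum (t + 1) v + sgn b * paritySum t v := by
  simp only [paritySum_eq, sum_cons, hammingNorm_cons]
  rw [Finset.mul_sum]
  congr 1
  · refine Finset.sum_congr rfl fun s _ => ?_
    simp [dotProduct, Fin.sum_univ_succ]
  · refine Finset.sum_congr rfl fun s _ => ?_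
    have h1 : (Fin.cons 1 s : Str (n + 1)) ⬝ᵥ (Fin.cons b v : Str (n + 1)) = b + s ⬝ᵥ v := by
      simp [dotProduct, Fin.sum_univ_succ]
    have h2 : 1 + hammingNorm s = t + 1 ↔ hammingNorm s = t := by omega
    simp only [if_true, h1, h2, sgn_add, mul_ite, mul_zero]

theorem paritySum_one {n : ℕ} (v : Str n) : paritySum 1 v = ∑ i, sgn (v i) := by
  induction n with
  | zero => simp [paritySum_eq, hammingNorm]
  | succ n ih =>
    obtain ⟨b, w, rfl⟩ : ∃ b w, v = (Fin.cons b w : Str (n + 1)) :=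
      ⟨v 0, Fin.tail v, (Fin.cons_self_tail v).symm⟩
    rw [paritySum_cons_succ, ih, paritySum_zero, Fin.sum_univ_succ]
    simp only [Fin.cons_zero, Fin.cons_succ]
    ring

/-- The three-term recurrence of the Krawtchouk polynomials. -/
theorem paritySum_succ_succ {n : ℕ} (v : Str n) (t : ℕ) :
    (t + 2) * paritySum (t + 2) v =
      (∑ i, sgn (v i)) * paritySum (t + 1) v - (n - t) * paritySum t v := by
  induction n generalizing t with
  | zero =>
    rcases t with _ | t
    · simp [paritySum_eq, hammingNorm]
    · simp [paritySum_eq, hammingNorm]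
  | succ n ih =>
    obtain ⟨b, w, rfl⟩ : ∃ b w, v = (Fin.cons b w : Str (n + 1)) :=
      ⟨v 0, Fin.tail v, (Fin.cons_self_tail v).symm⟩
    have hb := sgn_mul_self b
    rw [Fin.sum_univ_succ]
    simp only [Fin.cons_zero, Fin.cons_succ]
    rcases t with _ | t
    · have h0 := ih w 0
      rw [paritySum_cons_succ, paritySum_cons_succ, paritySum_zero]
      rw [paritySum_zero] at *
      have h1 := paritySum_one w
      rw [zero_add] at *
      push_cast at *
      linear_combination h0 - hb + sgn b * h1
    · have h0 := ih w (t + 1)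
      have h1 := ih w t
      rw [paritySum_cons_succ, paritySum_cons_succ, paritySum_cons_succ]
      push_cast at *
      linear_combination h0 + sgn b * h1 - paritySum (t + 1) w * hb

/-- Write K_t for the parity sums and S for the sum of signs, and induct on the ratio bound. In
(t+2)K_{t+2} = S K_{t+1} - (n-t)K_t, the inductive bound and t+1 ≤ θ²n give (n-t)K_t ≤ θn K_{t+1}.
This is at most half of the first term, since S ≥ 2θn, and θn K_{t+1} is left over. -/
theorem paritySum_pos_aux {n : ℕ} {v : Str n} {θ : ℝ} (hθ : 0 < θ)
    (hS : 2 * θ * n ≤ ∑ i, sgn (v i)) (t : ℕ) (ht : t < n) (ht' : (t : ℝ) ≤ θ ^ 2 * n) :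
    0 < paritySum t v ∧ θ * (n - t) * paritySum t v ≤ (t + 1) * paritySum (t + 1) v := by
  induction t with
  | zero =>
    rw [paritySum_zero, zero_add, paritySum_one]
    refine ⟨one_pos, ?_⟩
    push_cast
    have : 0 ≤ θ * n := by positivity
    linarith
  | succ t ih =>
    obtain ⟨h1, h2⟩ := ih (by omega) (by push_cast at ht'; linarith)
    have hn : (t : ℝ) + 1 < n := by exact_mod_cast ht
    have hpos : 0 < paritySum (t + 1) v := by
      have h3 : 0 < θ * (n - t) * paritySum t v := mul_pos (mul_pos hθ (by linarith)) h1
      exact pos_of_mul_pos_right (h3.trans_le h2) (by positivity)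
    refine ⟨hpos, ?_⟩
    have hrec := paritySum_succ_succ v t
    push_cast at *
    rw [show (t : ℝ) + 1 + 1 = t + 2 by ring, show t + 1 + 1 = t + 2 from rfl, hrec]
    have h4 : (n - t) * paritySum t v ≤ θ * n * paritySum (t + 1) v := by
      have h5 : θ * ((n - t) * paritySum t v) ≤ θ * (θ * n * paritySum (t + 1) v) := by
        calc _ = θ * (n - t) * paritySum t v := by ring
          _ ≤ (t + 1) * paritySum (t + 1) v := h2
          _ ≤ (θ ^ 2 * n) * paritySum (t + 1) v := mul_le_mul_of_nonneg_right ht' hpos.le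
          _ = _ := by ring
      exact le_of_mul_le_mul_left h5 hθ
    have h6 := mul_le_mul_of_nonneg_right hS hpos.le
    have h7 : 0 ≤ θ * (t + 1) * paritySum (t + 1) v := by positivity
    linarith

/-- Sparse parities of a vector of low weight are biased. -/
theorem le_paritySum {n : ℕ} {v : Str n} {θ : ℝ} (hθ : 0 < θ)
    (hS : 2 * θ * n ≤ ∑ i, sgn (v i)) (t : ℕ) (ht : t ≤ n) (ht' : (t : ℝ) ≤ θ ^ 2 * n) :
    θ ^ t * (n.choose t : ℝ) ≤ paritySum t v := by
  induction t with
  | zero => simp [paritySum_zero]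
  | succ t ih =>
    push_cast at ht'
    have h1 := ih (by omega) (by linarith)
    have h2 := (paritySum_pos_aux hθ hS t (by omega) (by linarith)).2
    have hn : (t : ℝ) + 1 ≤ n := by exact_mod_cast ht
    -- Binomial coefficients obey the ratio bound with equality and without θ, so each step gains
    -- exactly one factor θ.
    have h3 : ((n.choose (t + 1) : ℝ)) * (t + 1) = n.choose t * (n - t) := by
      have := Nat.choose_succ_right_eq n t
      rw [← Nat.cast_sub (by omega)]
      exact_mod_cast this
    have h4 := mul_le_mul_of_nonneg_left h1 (show 0 ≤ θ * (n - t) from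
      mul_nonneg hθ.le (by linarith))
    refine le_of_mul_le_mul_left ?_ (show (0 : ℝ) < t + 1 by positivity)
    calc _ = θ ^ (t + 1) * ((n.choose (t + 1) : ℝ) * (t + 1)) := by ring
      _ = θ * (n - t) * (θ ^ t * n.choose t) := by rw [h3]; ring
      _ ≤ _ := h4.trans h2

/-- Flipping a coordinate of w at which u is 1 changes every sign, so the sum equals its negative.
-/
theorem sum_sgn_dotProduct {n : ℕ} {u : Str n} (hu : u ≠ 0) : ∑ w : Str n, sgn (u ⬝ᵥ w) = 0 := by
  classical
  obtain ⟨i, hi⟩ := Function.ne_iff.1 hu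
  have h1 : u i = 1 := (F2_cases (u i)).resolve_left hi
  have h : ∑ w : Str n, sgn (u ⬝ᵥ w) = ∑ w : Str n, -sgn (u ⬝ᵥ w) := by
    rw [← Equiv.sum_comp (Equiv.addRight (Pi.single i 1 : Str n))]
    refine Finset.sum_congr rfl fun w _ => ?_
    rw [Equiv.coe_addRight, dotProduct_add, sgn_add, dotProduct_single, h1]
    simp
  rw [Finset.sum_neg_distrib] at h
  linarith

/-- The second moment of the parity sums of a uniform vector. -/
theorem sum_paritySum_sq {n t : ℕ} (ht : t ≤ n) :
    ∑ w : Str n, paritySum t w ^ 2 = 2 ^ n * (n.choose t : ℝ) := by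
  have h1 : ∀ w : Str n, paritySum t w ^ 2 =
      ∑ s ∈ sparseVecs t n, ∑ s' ∈ sparseVecs t n, sgn ((s + s') ⬝ᵥ w) := by
    intro w
    rw [sq, paritySum, Finset.sum_mul_sum]
    simp only [add_dotProduct, sgn_add]
  simp only [h1]
  rw [Finset.sum_comm, ← card_sparseVecs ht]
  have h2 : ∀ s ∈ sparseVecs t n, ∑ w : Str n, ∑ s' ∈ sparseVecs t n, sgn ((s + s') ⬝ᵥ w) =
      2 ^ n := by
    intro s hs
    rw [Finset.sum_comm, Finset.sum_eq_single s]
    · rw [str_add_self]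
      simp [ZMod.card]
    · intro s' _ hs'
      refine sum_sgn_dotProduct fun h => hs' ?_
      have : s + s' + s' = s' := by rw [h, zero_add]
      rw [add_assoc, str_add_self, add_zero] at this
      exact this.symm
    · exact fun h => absurd hs h
  rw [Finset.sum_congr rfl h2, Finset.sum_const, nsmul_eq_mul, mul_comm]

/-- Chebyshev's inequality with the second moment `sum_paritySum_sq`. -/
theorem prob_paritySum_le {n t : ℕ} (ht : t ≤ n) {δ : ℝ} (hδ : 0 < δ) :
    prob (uniformStr n) {w | δ * (n.choose t : ℝ) < |paritySum t w|} ≤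
      1 / (δ ^ 2 * (n.choose t : ℝ)) := by
  classical
  have hC : (0 : ℝ) < (n.choose t : ℝ) := by exact_mod_cast Nat.choose_pos ht
  have hcard : (Fintype.card (Str n) : ENNReal) = 2 ^ n := by simp [ZMod.card]
  have hμ : ∀ w, (uniformStr n w).toReal = (2 ^ n)⁻¹ := by
    intro w
    rw [uniformStr, PMF.uniformOfFintype_apply, hcard]
    simp
  rw [prob_eq_sum, le_div_iff₀ (by positivity)]
  simp only [hμ]
  have h : ∑ w with w ∈ {w : Str n | δ * (n.choose t : ℝ) < |paritySum t w|},
      (δ * (n.choose t : ℝ)) ^ 2 ≤ 2 ^ n * (n.choose t : ℝ) := by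
    rw [← sum_paritySum_sq ht]
    refine (Finset.sum_le_sum fun w hw => ?_).trans
      (Finset.sum_le_sum_of_subset_of_nonneg (Finset.filter_subset _ _) fun w _ _ => sq_nonneg _)
    rw [← sq_abs (paritySum t w)]
    exact pow_le_pow_left₀ (by positivity) (Finset.mem_filter.1 hw).2.le 2
  rw [Finset.sum_const, nsmul_eq_mul] at h ⊢
  have h2 : (0 : ℝ) < 2 ^ n := by positivity
  refine le_of_mul_le_mul_left ?_ (mul_pos h2 hC)
  calc _ = _ * (δ * (n.choose t : ℝ)) ^ 2 := by field_simp
    _ ≤ _ := h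
    _ = _ := by ring


/-! ## Weights of random sparse parities -/

theorem sum_uniformOn_sgn {n t : ℕ} (ht : t ≤ n) (w : Str n) :
    ∑ a, (uniformOn (sparseVecs t n) a).toReal * sgn (a ⬝ᵥ w) =
      paritySum t w / (n.choose t : ℝ) := by
  classical
  simp only [uniformOn_apply (sparseVecs_nonempty ht), card_sparseVecs ht]
  rw [paritySum, Finset.sum_div, ← Finset.sum_filter_add_sum_filter_not _ (· ∈ sparseVecs t n)]
  rw [Finset.filter_mem_eq_inter, Finset.univ_inter, add_eq_left.2]
  · refine Finset.sum_congr rfl fun a ha => ?_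
    rw [if_pos ha, ENNReal.toReal_inv, ENNReal.toReal_natCast]
    ring
  · refine Finset.sum_eq_zero fun a ha => ?_
    rw [if_neg (Finset.mem_filter.1 ha).2]
    simp

theorem sum_sgn_mulVec {n r : ℕ} (P : Matrix (Fin r) (Fin n) F2) (w : Str n) :
    ∑ i, sgn (P i ⬝ᵥ w) = r - 2 * hammingNorm (P *ᵥ w) :=
  sum_sgn (P *ᵥ w)

/-- The signs of the r parities are independent with mean at most ζ, whereas acceptance requires a
sum above 2ζr. The gap ζr and the Chernoff parameter s = ζ/2 give exponent -rζ²/2 + rζ²/4. -/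
theorem prob_weight_lt {n t r : ℕ} (ht : t ≤ n) {w : Str n} {ζ : ℝ} (h0 : 0 ≤ ζ) (h1 : ζ ≤ 1)
    (hw : |paritySum t w| ≤ ζ * (n.choose t : ℝ)) :
    prob (uniformOn (sparseMats t r n))
      {P | (hammingNorm (P *ᵥ w) : ℝ) < (1 / 2 - ζ) * r} ≤ Real.exp (-(r * ζ ^ 2 / 4)) := by
  have hC : (0 : ℝ) < (n.choose t : ℝ) := by exact_mod_cast Nat.choose_pos ht
  rw [uniformOn_sparseMats r ht]
  have key := prob_piPMF_sum_le (fun _ : Fin r => uniformOn (sparseVecs t n))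
    (fun _ a => -sgn (a ⬝ᵥ w)) (fun _ a => by rw [abs_neg, abs_sgn]) (fun _ => -ζ) (fun _ => by
      simp only [mul_neg, Finset.sum_neg_distrib, sum_uniformOn_sgn ht]
      rw [neg_le_neg_iff, div_le_iff₀ hC]
      exact (le_abs_self _).trans hw) (s := ζ / 2) (by linarith) (by linarith) (-(2 * ζ * r))
  refine (prob_mono _ fun P hP => ?_).trans (key.trans (Real.exp_le_exp.2 ?_))
  · have hP : (hammingNorm (P *ᵥ w) : ℝ) < (1 / 2 - ζ) * r := hP
    change ∑ i, -sgn (P i ⬝ᵥ w) ≤ _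
    rw [Finset.sum_neg_distrib, sum_sgn_mulVec]
    linarith
  · simp only [Finset.sum_const, Finset.card_univ, Fintype.card_fin, nsmul_eq_mul]
    nlinarith

/-- The mirror image: rejection means a sign sum of at most 2ζr, so a mean of at least 3ζ leaves the
same gap ζr. -/
theorem prob_le_weight {n t r : ℕ} (ht : t ≤ n) {w : Str n} {ζ : ℝ} (h0 : 0 ≤ ζ) (h1 : ζ ≤ 1)
    (hw : 3 * ζ * (n.choose t : ℝ) ≤ paritySum t w) :
    prob (uniformOn (sparseMats t r n))
      {P | ¬ (hammingNorm (P *ᵥ w) : ℝ) < (1 / 2 - ζ) * r} ≤ Real.exp (-(r * ζ ^ 2 / 4)) := by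
  have hC : (0 : ℝ) < (n.choose t : ℝ) := by exact_mod_cast Nat.choose_pos ht
  rw [uniformOn_sparseMats r ht]
  have key := prob_piPMF_sum_le (fun _ : Fin r => uniformOn (sparseVecs t n))
    (fun _ a => sgn (a ⬝ᵥ w)) (fun _ a => by rw [abs_sgn]) (fun _ => 3 * ζ) (fun _ => by
      rw [sum_uniformOn_sgn ht, le_div_iff₀ hC]
      exact hw) (s := ζ / 2) (by linarith) (by linarith) (2 * ζ * r)
  refine (prob_mono _ fun P hP => ?_).trans (key.trans (Real.exp_le_exp.2 ?_))
  · have hP : ¬ (hammingNorm (P *ᵥ w) : ℝ) < (1 / 2 - ζ) * r := hP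
    change ∑ i, sgn (P i ⬝ᵥ w) ≤ _
    rw [sum_sgn_mulVec]
    linarith
  · simp only [Finset.sum_const, Finset.card_univ, Fintype.card_fin, nsmul_eq_mul]
    nlinarith

theorem sum_ber_sgn {η : ℝ} (h0 : 0 ≤ η) (h1 : η ≤ 1) :
    ∑ a, (ber η a).toReal * sgn a = 1 - 2 * η := by
  have hu : (Finset.univ : Finset F2) = {0, 1} := by decide
  rw [hu, Finset.sum_pair (by decide), ber_zero h0 h1, ber_one h1,
    ENNReal.toReal_ofReal (by linarith), ENNReal.toReal_ofReal h0, sgn_zero, sgn_one]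
  ring

/-- After a low-weight error and independent noise the weight is still far below `n / 2`. -/
theorem prob_noise_le {n : ℕ} {p η : ℝ} (hp0 : 0 < p) (hp : p < 1 / 2) (hη0 : 0 < η)
    (hη : η < 1 / 2) {d : Str n} (hd : (hammingNorm d : ℝ) ≤ p * n) :
    prob (berStr η n) {e | ∑ i, sgn ((e + d) i) ≤ (1 - 2 * η) * (1 - 2 * p) / 2 * n} ≤
      Real.exp (-(n * ((1 - 2 * η) * (1 - 2 * p)) ^ 2 / 16)) := by
  set κ := (1 - 2 * η) * (1 - 2 * p)
  have hκ0 : 0 < κ := mul_pos (by linarith) (by linarith)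
  have hκ1 : κ ≤ 1 := mul_le_one₀ (by linarith) (by linarith) (by linarith)
  rw [berStr_eq]
  have key := prob_piPMF_sum_le (fun _ : Fin n => ber η) (fun i a => sgn (a + d i))
    (fun _ a => by rw [abs_sgn]) (fun i => (1 - 2 * η) * sgn (d i)) (fun i => by
      simp only [sgn_add, ← mul_assoc, ← Finset.sum_mul]
      -- The expected sign sum is at least κn and the threshold is half of that; s = κ/4 gives
      -- exponent κ²n(1/8 - 1/4 + 1/16).
      rw [sum_ber_sgn hη0.le (by linarith)]) (s := κ / 4) (by linarith) (by linarith) (κ / 2 * n)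
  refine key.trans (Real.exp_le_exp.2 ?_)
  rw [← Finset.mul_sum, sum_sgn]
  have h1 : κ * n ≤ (1 - 2 * η) * (n - 2 * hammingNorm d) := by
    rw [show κ * n = (1 - 2 * η) * ((1 - 2 * p) * n) by ring]
    refine mul_le_mul_of_nonneg_left ?_ (by linarith)
    linarith
  have h2 := mul_le_mul_of_nonneg_left h1 (show 0 ≤ κ / 4 by linarith)
  have h3 : (0 : ℝ) ≤ n := Nat.cast_nonneg n
  nlinarith

/-! ## Soundness and robustness for a fixed block length -/

/-- The decoder, as a function of the two parts of the secret key. -/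
def decodeDist {n r : ℕ} (ζ : ℝ) (P : Matrix (Fin r) (Fin n) F2) (z : Str n) (x : List F2) :
    PMF (Option (Str 0)) :=
  open Classical in PMF.pure (if h : x.length = n then
    if (hammingNorm (P *ᵥ (toStr x h + z)) : ℝ) < (1 / 2 - ζ) * r then some Fin.elim0 else none
  else none)

section Decoder

variable {n g t r : ℕ} {η ζ : ℝ}

theorem decodeDist_of_length (ζ : ℝ) (P : Matrix (Fin r) (Fin n) F2) (z : Str n) {x : List F2}
    (h : x.length = n) : decodeDist ζ P z x = open Classical in PMF.pure
      (if (hammingNorm (P *ᵥ (toStr x h + z)) : ℝ) < (1 / 2 - ζ) * r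
        then some Fin.elim0 else none) := by
  rw [decodeDist, dif_pos h]

theorem decodeDist_of_length_ne (ζ : ℝ) (P : Matrix (Fin r) (Fin n) F2) (z : Str n) {x : List F2}
    (h : x.length ≠ n) : decodeDist ζ P z x = PMF.pure none := by
  rw [decodeDist, dif_neg h]

theorem decodeDist_add (P : Matrix (Fin r) (Fin n) F2) (z v : Str n) (x : List F2)
    (hv : P *ᵥ v = 0) : decodeDist ζ P (z + v) x = decodeDist ζ P z x := by
  by_cases hx : x.length = n
  · simp only [decodeDist_of_length ζ P _ hx]
    rw [← add_assoc, Matrix.mulVec_add, hv, add_zero]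
  · simp only [decodeDist_of_length_ne ζ P _ hx]

theorem ldpc_bind_fst {α : Type} (f : Matrix (Fin r) (Fin n) F2 → PMF α) :
    ((ldpc n g t r).bind fun PG => f PG.1) = (uniformOn (sparseMats t r n)).bind f := by
  rw [ldpc, PMF.bind_bind]
  simp only [PMF.bind_map, Function.comp_def, PMF.bind_const]

/-- As z is uniform and independent of P, so is w = c + z. Up to Chebyshev's exceptional set, w has
small bias, and then the rows of P rarely accept it. Strings of another length are rejected
outright. -/
theorem prob_decodeDist_sound (ht : t ≤ n) (h0 : 0 < ζ) (h1 : ζ ≤ 1) (c : List F2) :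
    1 - (1 / (ζ ^ 2 * (n.choose t : ℝ)) + Real.exp (-(r * ζ ^ 2 / 4))) ≤
      prob ((ldpc n g t r).bind fun PG => (uniformStr n).bind fun z => decodeDist ζ PG.1 z c)
        {none} := by
  classical
  refine le_trans (sub_le_sub_left ?_ _) (one_sub_prob_compl_le _ _)
  by_cases hc : c.length = n
  · rw [ldpc_bind_fst fun P => (uniformStr n).bind fun z => decodeDist ζ P z c, PMF.bind_comm]
    conv_lhs => rw [← uniformStr_map_add (toStr c hc), PMF.bind_map]
    refine (prob_bind_le _ _ _ {w | ζ * (n.choose t : ℝ) < |paritySum t w|}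
      (Real.exp_pos _).le fun w _ hw => ?_).trans (add_le_add_left (prob_paritySum_le ht h0) _)
    have hw : |paritySum t w| ≤ ζ * (n.choose t : ℝ) := not_lt.1 hw
    have e1 : toStr c hc + (w + toStr c hc) = w := by
      rw [add_comm w, ← add_assoc, str_add_self, zero_add]
    simp only [Function.comp_apply, decodeDist_of_length ζ _ _ hc, e1]
    refine le_trans (le_of_eq (prob_map (uniformOn (sparseMats t r n)) _ _)) ?_
    refine (prob_mono _ fun P hP => ?_).trans (prob_weight_lt ht h0.le h1 hw)
    by_contra hcon
    exact hP (if_neg hcon)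
  · simp only [decodeDist_of_length_ne ζ _ _ hc, PMF.bind_const]
    refine le_trans (le_of_eq ?_) (add_nonneg (by positivity) (Real.exp_pos _).le)
    simp [prob]

theorem wtDiff_ofFn {n : ℕ} (x y : Str n) : wtDiff (List.ofFn x) (List.ofFn y) =
    hammingNorm (x + y) := by
  induction n with
  | zero => simp [wtDiff, hammingNorm]
  | succ n ih =>
    obtain ⟨a, x, rfl⟩ : ∃ b w, x = (Fin.cons b w : Str (n + 1)) :=
      ⟨x 0, Fin.tail x, (Fin.cons_self_tail x).symm⟩
    obtain ⟨b, y, rfl⟩ : ∃ b w, y = (Fin.cons b w : Str (n + 1)) :=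
      ⟨y 0, Fin.tail y, (Fin.cons_self_tail y).symm⟩
    have h1 : (Fin.cons a x + Fin.cons b y : Str (n + 1)) = Fin.cons (a + b) (x + y) := by
      funext i
      cases i using Fin.cases <;> rfl
    rw [h1, hammingNorm_cons, ← ih]
    simp only [wtDiff, List.ofFn_succ, Fin.cons_zero, Fin.cons_succ, List.zipWith_cons_cons,
      List.count_cons, beq_iff_eq]
    rw [add_comm]

/-- The decoder's answer to a codeword with errors depends on the sparse parities of the noise and
of the errors only. -/
theorem robust_game_eq (E : Channel) :
    ((ldpc n g t r).bind fun PG => (uniformStr n).bind fun z =>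
      (encodeDist η PG.2 z).bind fun x => (E (List.ofFn x)).bind fun y =>
        decodeDist ζ PG.1 z y) =
    ((uniformStr n).bind fun x => (E (List.ofFn x)).map fun y => (x, y)).bind fun xy =>
      (berStr η n).bind fun e => (uniformOn (sparseMats t r n)).bind fun P =>
        decodeDist ζ P (xy.1 + e) xy.2 := by
  have hinner : ∀ PG : Matrix (Fin r) (Fin n) F2 × Matrix (Fin n) (Fin g) F2,
      PG.1 * PG.2 = 0 →
      ((uniformStr n).bind fun z => (encodeDist η PG.2 z).bind fun x =>
        (E (List.ofFn x)).bind fun y => decodeDist ζ PG.1 z y) =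
      (berStr η n).bind fun e => (uniformStr n).bind fun x => (E (List.ofFn x)).bind fun y =>
        decodeDist ζ PG.1 (x + e) y := by
    intro PG hPG
    simp only [encodeDist, PMF.bind_bind, PMF.bind_map, Function.comp_def]
    rw [PMF.bind_comm]
    refine Eq.trans ?_ (PMF.bind_const (uniformStr g) _)
    congr 1
    funext u
    rw [PMF.bind_comm]
    congr 1
    funext e
    -- Put x = z + Gu + e, which is uniform together with z. The decoder's offset x + e becomes z +
    -- Gu, which it cannot tell from z because PG = 0.
    conv_rhs => rw [← uniformStr_map_add (PG.2 *ᵥ u + e), PMF.bind_map]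
    congr 1
    funext z
    have e1 : PG.2 *ᵥ u + z + e = z + (PG.2 *ᵥ u + e) := by
      rw [add_comm (PG.2 *ᵥ u) z, add_assoc]
    have e2 : z + (PG.2 *ᵥ u + e) + e = z + PG.2 *ᵥ u := by
      rw [add_assoc, add_assoc, str_add_self, add_zero]
    simp only [Function.comp_apply, e1, e2]
    congr 1
    funext y
    exact (decodeDist_add _ _ _ _
      (by rw [Matrix.mulVec_mulVec, hPG, Matrix.zero_mulVec])).symm
  have hleft : ((ldpc n g t r).bind fun PG => (uniformStr n).bind fun z =>
      (encodeDist η PG.2 z).bind fun x => (E (List.ofFn x)).bind fun y =>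
        decodeDist ζ PG.1 z y) =
      (uniformOn (sparseMats t r n)).bind fun P => (berStr η n).bind fun e =>
        (uniformStr n).bind fun x => (E (List.ofFn x)).bind fun y =>
          decodeDist ζ P (x + e) y := by
    rw [ldpc_eq, PMF.bind_bind]
    congr 1
    funext P
    rw [PMF.bind_map]
    refine Eq.trans ?_ (PMF.bind_const (PMF.uniformOfFintype (Matrix (Fin n) (Fin g) F2)) _)
    congr 1
    funext U
    exact hinner (P, kerProj P * U) (by rw [← Matrix.mul_assoc, mul_kerProj, Matrix.zero_mul])
  rw [hleft, PMF.bind_bind]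
  simp only [PMF.bind_map, Function.comp_def]
  calc _ = (berStr η n).bind fun e => (uniformStr n).bind fun x =>
        (uniformOn (sparseMats t r n)).bind fun P =>
          (E (List.ofFn x)).bind fun y => decodeDist ζ P (x + e) y := by
        rw [PMF.bind_comm]
        congr 1; funext e
        rw [PMF.bind_comm]
    _ = (uniformStr n).bind fun x => (berStr η n).bind fun e =>
        (E (List.ofFn x)).bind fun y =>
          (uniformOn (sparseMats t r n)).bind fun P => decodeDist ζ P (x + e) y := by
        rw [PMF.bind_comm]
        congr 1; funext x
        congr 1; funext e
        rw [PMF.bind_comm]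
    _ = _ := by
        congr 1; funext x
        rw [PMF.bind_comm]

/-- In `robust_game_eq` the matrix P is drawn last, which allows the three failures to be treated in
turn: too many channel errors, untypical noise e, and untypical rows of P for a vector that is
already fixed. -/
theorem prob_decodeDist_robust {p : ℝ} (hp0 : 0 < p) (hp : p < 1 / 2) (hη0 : 0 < η)
    (hη : η < 1 / 2) (ht : t ≤ n) (h0 : 0 ≤ ζ) (h1 : ζ ≤ 1)
    (ht' : (t : ℝ) ≤ ((1 - 2 * η) * (1 - 2 * p) / 4) ^ 2 * n)
    (hζ : 3 * ζ ≤ ((1 - 2 * η) * (1 - 2 * p) / 4) ^ t) {E : Channel}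
    (hE : ∀ x, ∀ y ∈ (E x).support, y.length = x.length) (m : Str 0) :
    1 - (prob ((uniformStr n).bind fun x => (E (List.ofFn x)).map fun y => (List.ofFn x, y))
        {xy | p * (n : ℝ) < (wtDiff xy.2 xy.1 : ℝ)} +
        (Real.exp (-(n * ((1 - 2 * η) * (1 - 2 * p)) ^ 2 / 16)) +
          Real.exp (-(r * ζ ^ 2 / 4)))) ≤
      prob ((ldpc n g t r).bind fun PG => (uniformStr n).bind fun z =>
        (encodeDist η PG.2 z).bind fun x => (E (List.ofFn x)).bind fun y =>
          decodeDist ζ PG.1 z y) {some m} := by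
  classical
  refine le_trans (sub_le_sub_left ?_ _) (one_sub_prob_compl_le _ _)
  rw [robust_game_eq]
  have hbad : prob ((uniformStr n).bind fun x => (E (List.ofFn x)).map fun y => (List.ofFn x, y))
        {xy | p * (n : ℝ) < (wtDiff xy.2 xy.1 : ℝ)} =
      prob ((uniformStr n).bind fun x => (E (List.ofFn x)).map fun y => (x, y))
        {xy | p * (n : ℝ) < (wtDiff xy.2 (List.ofFn xy.1) : ℝ)} := by
    rw [show {xy : Str n × List F2 | p * (n : ℝ) < (wtDiff xy.2 (List.ofFn xy.1) : ℝ)} =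
      (fun xy => (List.ofFn xy.1, xy.2)) ⁻¹' {xy | p * (n : ℝ) < (wtDiff xy.2 xy.1 : ℝ)} from rfl,
      ← prob_map, PMF.map_bind]
    simp only [PMF.map_comp, Function.comp_def]
  rw [hbad]
  refine prob_bind_le _ _ _ _ (add_nonneg (Real.exp_pos _).le (Real.exp_pos _).le) ?_
  rintro ⟨x, y⟩ hxy hgood
  have hgood : ¬ (p * (n : ℝ) < (wtDiff y (List.ofFn x) : ℝ)) := hgood
  have hy : y.length = n := by
    rw [PMF.mem_support_bind_iff] at hxy
    obtain ⟨x', -, h⟩ := hxy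
    rw [PMF.mem_support_map_iff] at h
    obtain ⟨y', hy', h⟩ := h
    obtain ⟨rfl, rfl⟩ := Prod.mk.inj h
    simpa using hE _ _ hy'
  have hd : (hammingNorm (toStr y hy + x) : ℝ) ≤ p * n := by
    rw [← wtDiff_ofFn, ofFn_toStr]
    exact not_lt.1 hgood
  refine prob_bind_le _ _ _ {e | ∑ i, sgn ((e + (toStr y hy + x)) i) ≤
    (1 - 2 * η) * (1 - 2 * p) / 2 * n} (Real.exp_pos _).le (fun e _ he => ?_) |>.trans
    (add_le_add_left (prob_noise_le hp0 hp hη0 hη hd) _)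
  have he : (1 - 2 * η) * (1 - 2 * p) / 2 * n < ∑ i, sgn ((e + (toStr y hy + x)) i) :=
    not_le.1 he
  have hθ : 0 < (1 - 2 * η) * (1 - 2 * p) / 4 :=
    div_pos (mul_pos (by linarith) (by linarith)) (by norm_num)
  have hbias := le_paritySum hθ (v := e + (toStr y hy + x)) (by linarith) t ht ht'
  have hC : (0 : ℝ) < (n.choose t : ℝ) := by exact_mod_cast Nat.choose_pos ht
  have hbias' := (mul_le_mul_of_nonneg_right hζ hC.le).trans hbias
  have e1 : toStr y hy + (x + e) = e + (toStr y hy + x) := by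
    rw [← add_assoc, add_comm]
  simp only [decodeDist_of_length ζ _ _ hy, e1]
  refine le_trans (le_of_eq (prob_map (uniformOn (sparseMats t r n)) _ _)) ?_
  refine (prob_mono _ fun P hP => ?_).trans (prob_le_weight ht h0 h1 hbias')
  intro hcon
  exact hP ((if_pos hcon).trans (congrArg some (Subsingleton.elim (α := Str 0) _ _)))

end Decoder

/-! ## The two games of the code in terms of the parts of its keys -/

section Games

variable {g t r : ℕ → ℕ} {η : ℝ} {ζ : ℕ → ℝ} {l : ℕ}

theorem keyGen_bind {α : Type} (f : Str (r l * l + l) × Str (l * g l + l) → PMF α) :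
    ((ldpcPRC (fun n => n) g t r (fun _ => η) ζ).keyGen l).bind f =
      (ldpc l (g l) (t l) (r l)).bind fun PG => (uniformStr l).bind fun z =>
        f (packKey PG.1 z, packKey PG.2 z) :=
  (PMF.bind_bind _ _ _).trans (congrArg _ (funext fun _ => PMF.bind_map _ _ _))

theorem decode_packKey (P : Matrix (Fin (r l)) (Fin l) F2) (z : Str l) (x : List F2) :
    (ldpcPRC (fun n => n) g t r (fun _ => η) ζ).decode l (packKey P z) x =
      decodeDist (ζ l) P z x := by
  classical
  change PMF.pure (if h : x.length = l then
      if (hammingNorm (keyMat (packKey P z) *ᵥ toStr x h +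
        keyMat (packKey P z) *ᵥ keyVec (packKey P z)) : ℝ) < (1 / 2 - ζ l) * (r l : ℝ)
      then some Fin.elim0 else none
    else none) = _
  simp only [keyMat_packKey, keyVec_packKey, ← Matrix.mulVec_add]
  rfl

theorem encode_packKey (G : Matrix (Fin l) (Fin (g l)) F2) (z : Str l) (m : Str 0) :
    (ldpcPRC (fun n => n) g t r (fun _ => η) ζ).encode l (packKey G z) m =
      encodeDist η G z := by
  change ((uniformStr (g l)).bind fun u => (berStr η l).map fun e =>
    keyMat (packKey G z) *ᵥ u + keyVec (packKey G z) + e) = _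
  rw [keyMat_packKey, keyVec_packKey]
  rfl

theorem ldpcPRC_sound_game (c : List F2) :
    (((ldpcPRC (fun n => n) g t r (fun _ => η) ζ).keyGen l).bind fun k =>
        (ldpcPRC (fun n => n) g t r (fun _ => η) ζ).decode l k.1 c) =
      (ldpc l (g l) (t l) (r l)).bind fun PG => (uniformStr l).bind fun z =>
        decodeDist (ζ l) PG.1 z c :=
  (keyGen_bind _).trans (congrArg _ (funext fun PG => congrArg _ (funext fun z =>
    decode_packKey PG.1 z c)))

theorem ldpcPRC_robust_game (E : Channel) (m : Str 0) :
    (((ldpcPRC (fun n => n) g t r (fun _ => η) ζ).keyGen l).bind fun k =>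
      ((ldpcPRC (fun n => n) g t r (fun _ => η) ζ).encode l k.2 m).bind fun x =>
      (E (List.ofFn x)).bind fun y =>
        (ldpcPRC (fun n => n) g t r (fun _ => η) ζ).decode l k.1 y) =
      (ldpc l (g l) (t l) (r l)).bind fun PG => (uniformStr l).bind fun z =>
        (encodeDist η PG.2 z).bind fun x => (E (List.ofFn x)).bind fun y =>
          decodeDist (ζ l) PG.1 z y := by
  refine (keyGen_bind _).trans (congrArg _ (funext fun PG => congrArg _ (funext fun z => ?_)))
  refine (congrArg (fun μ => PMF.bind μ fun x => (E (List.ofFn x)).bind fun y =>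
    (ldpcPRC (fun n => n) g t r (fun _ => η) ζ).decode l (packKey PG.1 z) y)
    (encode_packKey PG.2 z m)).trans ?_
  exact congrArg _ (funext fun x => congrArg _ (funext fun y => decode_packKey PG.1 z y))

end Games


/-! ## Asymptotics of the parameters -/

theorem Negligible.of_eventually_le {f f' : ℕ → ℝ} (hf : Negligible f) (h0 : ∀ᶠ l in atTop, 0 ≤ f' l)
    (h : ∀ᶠ l in atTop, f' l ≤ f l) : Negligible f' := by
  intro k
  refine squeeze_zero' ?_ ?_ (hf k)
  · filter_upwards [h0] with l hl using by positivity
  · filter_upwards [h] with l hl using mul_le_mul_of_nonneg_left hl (by positivity)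

theorem Negligible.add {f f' : ℕ → ℝ} (hf : Negligible f) (hf' : Negligible f') :
    Negligible fun l => f l + f' l :=
  SuperpolynomialDecay.add hf hf'

theorem negligible_of_eventually_eq_zero {f : ℕ → ℝ} (h : ∀ᶠ l in atTop, f l = 0) :
    Negligible f := by
  intro k
  refine tendsto_const_nhds.congr' ?_
  filter_upwards [h] with l hl
  rw [hl, mul_zero]

theorem negligible_exp_neg_rpow {a δ : ℝ} (ha : 0 < a) (hδ : 0 < δ) :
    Negligible fun l : ℕ => Real.exp (-(a * (l : ℝ) ^ δ)) := by
  intro k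
  have h1 := (tendsto_rpow_mul_exp_neg_mul_atTop_nhds_zero (k / δ) a ha).comp
    ((tendsto_rpow_atTop hδ).comp (tendsto_natCast_atTop_atTop (R := ℝ)))
  refine h1.congr fun l => ?_
  simp only [Function.comp_apply]
  rw [← Real.rpow_mul (Nat.cast_nonneg l), mul_div_cancel₀ _ hδ.ne', Real.rpow_natCast, neg_mul]

theorem powFloor_le {ε : ℝ} (h0 : 0 < ε) (h1 : ε ≤ 1) (l : ℕ) : powFloor ε l ≤ l := by
  rcases Nat.eq_zero_or_pos l with rfl | hl
  · simp [powFloor, Real.zero_rpow h0.ne']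
  · refine Nat.floor_le_of_le ?_
    have h : (1 : ℝ) ≤ l := by exact_mod_cast hl
    simpa using Real.rpow_le_rpow_of_exponent_le h h1

theorem half_rpow_le_powFloor {ε : ℝ} (h0 : 0 < ε) {l : ℕ} (hl : 1 ≤ l) :
    (l : ℝ) ^ ε / 2 ≤ powFloor ε l := by
  have h1 : (1 : ℝ) ≤ (l : ℝ) ^ ε := Real.one_le_rpow (by exact_mod_cast hl) h0.le
  have h2 : (1 : ℝ) ≤ powFloor ε l := by exact_mod_cast Nat.le_floor (by simpa using h1)
  have h3 : (l : ℝ) ^ ε < powFloor ε l + 1 := Nat.lt_floor_add_one _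
  linarith

/-- The floor costs at most a factor 2, so rζ²/4 is at least l^(ε/2)/8. -/
theorem negligible_exp_powFloor {ε : ℝ} (hε : 0 < ε) : Negligible fun l : ℕ =>
    Real.exp (-((powFloor ε l : ℝ) * ((l : ℝ) ^ (-ε / 4)) ^ 2 / 4)) := by
  refine (negligible_exp_neg_rpow (a := 1 / 8) (δ := ε / 2) (by norm_num) (by linarith)).of_eventually_le
    (.of_forall fun l => (Real.exp_pos _).le) ?_
  filter_upwards [eventually_ge_atTop 1] with l hl
  have hl' : (0 : ℝ) < l := by exact_mod_cast hl
  refine Real.exp_le_exp.2 (neg_le_neg ?_)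
  have h1 : ((l : ℝ) ^ (-ε / 4)) ^ 2 = (l : ℝ) ^ (-ε / 2) := by
    rw [← Real.rpow_natCast, ← Real.rpow_mul hl'.le]
    congr 1
    push_cast
    ring
  have h2 : (l : ℝ) ^ (ε / 2) = (l : ℝ) ^ ε * (l : ℝ) ^ (-ε / 2) := by
    rw [← Real.rpow_add hl']
    congr 1
    ring
  have h3 := mul_le_mul_of_nonneg_right (half_rpow_le_powFloor hε hl)
    (Real.rpow_nonneg hl'.le (-ε / 2))
  rw [h1, h2]
  linarith

/-- `⌊c log l⌋`, but at most `l`. -/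
def logFloor (c : ℝ) (l : ℕ) : ℕ := min l ⌊c * Real.log l⌋₊

theorem logFloor_le_self (c : ℝ) (l : ℕ) : logFloor c l ≤ l := min_le_left _ _

theorem logFloor_le {c : ℝ} (hc : 0 ≤ c) (l : ℕ) : (logFloor c l : ℝ) ≤ c * Real.log l :=
  (Nat.cast_le.2 (min_le_right _ _)).trans
    (Nat.floor_le (mul_nonneg hc (Real.log_natCast_nonneg l)))

theorem tendsto_log_natCast : Tendsto (fun l : ℕ => Real.log l) atTop atTop :=
  Real.tendsto_log_atTop.comp tendsto_natCast_atTop_atTop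

theorem eventually_mul_log_le {c δ s : ℝ} (hc : 0 < c) (hδ : 0 < δ) (hs : 0 < s) :
    ∀ᶠ l : ℕ in atTop, c * Real.log l ≤ δ * (l : ℝ) ^ s := by
  have h := ((isLittleO_log_rpow_atTop hs).comp_tendsto
    (tendsto_natCast_atTop_atTop (R := ℝ))).def (div_pos hδ hc)
  filter_upwards [h] with l hl
  have hl : |Real.log l| ≤ δ / c * |(l : ℝ) ^ s| := hl
  rw [abs_of_nonneg (Real.log_natCast_nonneg l),
    abs_of_nonneg (Real.rpow_nonneg (Nat.cast_nonneg l) s), div_mul_eq_mul_div,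
    le_div_iff₀ hc] at hl
  linarith

theorem half_log_le_logFloor {c : ℝ} (hc : 0 < c) :
    ∀ᶠ l : ℕ in atTop, c / 2 * Real.log l ≤ logFloor c l := by
  filter_upwards [eventually_mul_log_le hc one_pos one_pos,
    tendsto_log_natCast.eventually_ge_atTop (2 / c)] with l h1 h2
  rw [one_mul, Real.rpow_one] at h1
  rw [logFloor, min_eq_right (Nat.floor_le_of_le h1)]
  have h3 := Nat.sub_one_lt_floor (c * Real.log l)
  rw [div_le_iff₀ hc] at h2
  linarith

theorem logFloor_isTheta {c : ℝ} (hc : 0 < c) :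
    (fun l : ℕ => (logFloor c l : ℝ)) =Θ[atTop] fun l : ℕ => Real.log (l : ℝ) := by
  refine ⟨IsBigO.of_bound c (.of_forall fun l => ?_), IsBigO.of_bound (2 / c) ?_⟩
  · rw [Real.norm_natCast, Real.norm_of_nonneg (Real.log_natCast_nonneg l)]
    exact logFloor_le hc.le l
  · filter_upwards [half_log_le_logFloor hc] with l hl
    rw [Real.norm_natCast, Real.norm_of_nonneg (Real.log_natCast_nonneg l), div_mul_eq_mul_div,
      le_div_iff₀ hc]
    linarith

theorem tendsto_logFloor {c : ℝ} (hc : 0 < c) : Tendsto (logFloor c) atTop atTop := by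
  refine (tendsto_natCast_atTop_iff (R := ℝ)).1 ?_
  exact tendsto_atTop_mono' _ (half_log_le_logFloor hc)
    (tendsto_log_natCast.const_mul_atTop (by linarith))

/-- C(l,t) ≥ (l+1-t)^t/t! ≥ ((l+1-t)/t)^t, and t ≤ √l/2 makes the base at least √l. -/
theorem pow_le_choose_logFloor {c : ℝ} (hc : 0 < c) : ∀ᶠ l : ℕ in atTop,
    ((l : ℝ) ^ (1 / 2 : ℝ)) ^ logFloor c l ≤ l.choose (logFloor c l) := by
  filter_upwards [eventually_mul_log_le hc (by norm_num : (0 : ℝ) < 1 / 2)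
    (by norm_num : (0 : ℝ) < 1 / 2), eventually_ge_atTop 1] with l h1 hl
  have hl' : (1 : ℝ) ≤ l := by exact_mod_cast hl
  set t := logFloor c l
  have ht : (t : ℝ) ≤ 1 / 2 * (l : ℝ) ^ (1 / 2 : ℝ) := (logFloor_le hc.le l).trans h1
  have hsq : (l : ℝ) ^ (1 / 2 : ℝ) * (l : ℝ) ^ (1 / 2 : ℝ) = l := by
    rw [← Real.rpow_add (by linarith)]
    norm_num
  set q := (l : ℝ) ^ (1 / 2 : ℝ)
  have hq : 1 ≤ q := Real.one_le_rpow hl' (by norm_num)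
  have hchoose := Nat.pow_le_choose (α := ℝ) t l
  have hsub : ((l + 1 - t : ℕ) : ℝ) = l + 1 - t := by
    rw [Nat.cast_sub ((logFloor_le_self c l).trans (Nat.le_succ l))]
    push_cast
    ring
  have hfac : (t.factorial : ℝ) ≤ (t : ℝ) ^ t := by exact_mod_cast Nat.factorial_le_pow t
  have hpos : (0 : ℝ) < t.factorial := by exact_mod_cast t.factorial_pos
  refine le_trans ?_ hchoose
  rw [le_div_iff₀ hpos, hsub]
  refine (mul_le_mul_of_nonneg_left hfac (by positivity)).trans ?_
  rw [← mul_pow]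
  refine pow_le_pow_left₀ (by positivity) ?_ t
  nlinarith

theorem negligible_inv_choose {c ε : ℝ} (hc : 0 < c) (hε : ε ≤ 1) : Negligible fun l : ℕ =>
    1 / (((l : ℝ) ^ (-ε / 4)) ^ 2 * (l.choose (logFloor c l) : ℝ)) := by
  intro k
  refine squeeze_zero' (.of_forall fun l => by positivity) ?_ tendsto_one_div_atTop_nhds_zero_nat
  filter_upwards [pow_le_choose_logFloor hc, eventually_ge_atTop 1,
    -- This makes (√l)^t at least l^(k+2): beyond l^k, one power of l absorbs ζ² ≥ 1/l and one
    -- leaves a bound 1/l that tends to 0.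
    (tendsto_logFloor hc).eventually_ge_atTop (2 * k + 4)] with l h1 hl ht
  have hl' : (1 : ℝ) ≤ l := by exact_mod_cast hl
  have hl0 : (0 : ℝ) < l := by linarith
  have h2 : (l : ℝ) ^ (k + 2) ≤ l.choose (logFloor c l) := by
    refine le_trans ?_ h1
    rw [← Real.rpow_natCast _ (logFloor c l), ← Real.rpow_mul hl0.le, ← Real.rpow_natCast]
    refine Real.rpow_le_rpow_of_exponent_le hl' ?_
    have : ((2 * k + 4 : ℕ) : ℝ) ≤ logFloor c l := by exact_mod_cast ht
    push_cast at this ⊢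
    linarith
  have h3 : (l : ℝ)⁻¹ ≤ ((l : ℝ) ^ (-ε / 4)) ^ 2 := by
    rw [← Real.rpow_natCast, ← Real.rpow_mul hl0.le, ← Real.rpow_neg_one]
    refine Real.rpow_le_rpow_of_exponent_le hl' ?_
    push_cast
    linarith
  have h4 : (l : ℝ) ^ k * l ≤ ((l : ℝ) ^ (-ε / 4)) ^ 2 * (l.choose (logFloor c l) : ℝ) := by
    refine le_trans (le_of_eq ?_) (mul_le_mul h3 h2 (by positivity) (by positivity))
    field_simp
    ring
  have h5 : (0 : ℝ) < l.choose (logFloor c l) := (pow_pos hl0 _).trans_le h2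
  rw [mul_one_div, div_le_div_iff₀ (by positivity) hl0, one_mul]
  exact h4

/-- The constant is chosen such that θ^(c log l) = l^(-ε/8). This exceeds l^(-ε/4) by the factor
l^(ε/8), which is eventually at least 3. -/
theorem three_mul_rpow_le_pow_logFloor {θ ε : ℝ} (hε : 0 < ε) (h0 : 0 < θ) (h1 : θ < 1) :
    ∀ᶠ l : ℕ in atTop,
      3 * (l : ℝ) ^ (-ε / 4) ≤ θ ^ logFloor (ε / (8 * -Real.log θ)) l := by
  have hlog : Real.log θ < 0 := Real.log_neg h0 h1
  have hc : 0 < ε / (8 * -Real.log θ) := div_pos hε (by linarith)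
  filter_upwards [((tendsto_rpow_atTop (show 0 < ε / 8 by linarith)).comp
    (tendsto_natCast_atTop_atTop (R := ℝ))).eventually_ge_atTop 3, eventually_ge_atTop 1]
    with l h3 hl
  have hl0 : (0 : ℝ) < l := by exact_mod_cast hl
  have h2 : (l : ℝ) ^ (-(ε / 8)) ≤ θ ^ logFloor (ε / (8 * -Real.log θ)) l := by
    rw [← Real.rpow_natCast]
    refine le_trans (le_of_eq ?_)
      (Real.rpow_le_rpow_of_exponent_ge h0 h1.le (logFloor_le hc.le l))
    rw [Real.rpow_def_of_pos hl0, Real.rpow_def_of_pos h0]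
    congr 1
    have := hlog.ne
    field_simp
  refine le_trans ?_ h2
  have h4 : (l : ℝ) ^ (-(ε / 8)) = (l : ℝ) ^ (ε / 8) * (l : ℝ) ^ (-ε / 4) := by
    rw [← Real.rpow_add hl0]
    congr 1
    ring
  rw [h4]
  exact mul_le_mul_of_nonneg_right h3 (Real.rpow_nonneg hl0.le _)

theorem rpow_neg_le_one {ε : ℝ} (hε : 0 ≤ ε) {l : ℕ} (hl : 1 ≤ l) : (l : ℝ) ^ (-ε / 4) ≤ 1 :=
  Real.rpow_le_one_of_one_le_of_nonpos (by exact_mod_cast hl) (by linarith)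

/-! ## Soundness and robustness -/

theorem ldpcPRC_sound {c ε η : ℝ} {g : ℕ → ℕ} (hc : 0 < c) (hε : ε ∈ Set.Ioo (0 : ℝ) 1) :
    (ldpcPRC (fun n => n) g (logFloor c) (powFloor ε) (fun _ => η)
      fun n => (n : ℝ) ^ (-ε / 4)).Sound := by
  refine ⟨fun l => (1 / (((l : ℝ) ^ (-ε / 4)) ^ 2 * (l.choose (logFloor c l) : ℝ)) +
    -- The bound is claimed for every l, but the estimates need ζ > 0; at l = 0 the last summand
    -- makes it trivial.
    Real.exp (-((powFloor ε l : ℝ) * ((l : ℝ) ^ (-ε / 4)) ^ 2 / 4))) + if l = 0 then 1 else 0,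
    (Negligible.add (negligible_inv_choose hc hε.2.le) (negligible_exp_powFloor hε.1)).add
      (negligible_of_eventually_eq_zero ?_), fun l c' => ?_⟩
  · filter_upwards [eventually_ge_atTop 1] with l hl
    exact if_neg (by omega)
  · rcases Nat.eq_zero_or_pos l with rfl | hl
    · refine le_trans ?_ (prob_nonneg _ _)
      have h1 := Real.exp_pos (-((powFloor ε 0 : ℝ) * (((0 : ℕ) : ℝ) ^ (-ε / 4)) ^ 2 / 4))
      have h2 : 0 ≤ 1 / ((((0 : ℕ) : ℝ) ^ (-ε / 4)) ^ 2 *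
        ((0 : ℕ).choose (logFloor c 0) : ℝ)) := by positivity
      beta_reduce
      rw [if_pos rfl]
      linarith
    · have key := prob_decodeDist_sound (g := g l) (r := powFloor ε l) (logFloor_le_self c l)
        (Real.rpow_pos_of_pos (show (0 : ℝ) < l by exact_mod_cast hl) (-ε / 4))
        (rpow_neg_le_one hε.1.le hl) c'
      beta_reduce
      rw [if_neg (by omega), add_zero]
      have hgame := ldpcPRC_sound_game (g := g) (t := logFloor c) (r := powFloor ε) (η := η)
        (ζ := fun n => (n : ℝ) ^ (-ε / 4)) (l := l) c'
      exact key.trans (congrArg (fun μ : PMF (Option (Str 0)) => prob μ {none}) hgame.symm).le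

theorem ldpcPRC_robust {p η ε : ℝ} {g : ℕ → ℕ} (hp : p ∈ Set.Ioo (0 : ℝ) (1 / 2))
    (hη : η ∈ Set.Ioo (0 : ℝ) (1 / 2)) (hε : ε ∈ Set.Ioo (0 : ℝ) 1) {E : Channel}
    (hE : PBounded p E) :
    (ldpcPRC (fun n => n) g
      (logFloor (ε / (8 * -Real.log ((1 - 2 * η) * (1 - 2 * p) / 4)))) (powFloor ε) (fun _ => η)
      fun n => (n : ℝ) ^ (-ε / 4)).RobustTo E := by
  classical
  obtain ⟨hp0, hp1⟩ := hp
  obtain ⟨hη0, hη1⟩ := hη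
  obtain ⟨hlen, νE, hνE, hbound⟩ := hE
  have hκ0 : 0 < (1 - 2 * η) * (1 - 2 * p) := mul_pos (by linarith) (by linarith)
  have hκ1 : (1 - 2 * η) * (1 - 2 * p) ≤ 1 :=
    mul_le_one₀ (by linarith) (by linarith) (by linarith)
  have hc : 0 < ε / (8 * -Real.log ((1 - 2 * η) * (1 - 2 * p) / 4)) :=
    div_pos hε.1 (mul_pos (by norm_num) (neg_pos.2 (Real.log_neg (by linarith) (by linarith))))
  have hexp : Negligible fun l : ℕ =>
      Real.exp (-((l : ℝ) * ((1 - 2 * η) * (1 - 2 * p)) ^ 2 / 16)) := by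
    have := negligible_exp_neg_rpow (a := ((1 - 2 * η) * (1 - 2 * p)) ^ 2 / 16) (δ := 1)
      (by positivity) one_pos
    simp only [Real.rpow_one] at this
    convert this using 4
    ring
  set κ := (1 - 2 * η) * (1 - 2 * p) with hκ
  set c := ε / (8 * -Real.log (κ / 4)) with hcdef
  -- The parameter inequalities hold only for large l. At the finitely many other l the error bound
  -- is raised by 1 and says nothing.
  let good : ℕ → Prop := fun l => 1 ≤ l ∧ (logFloor c l : ℝ) ≤ (κ / 4) ^ 2 * l ∧
    3 * (l : ℝ) ^ (-ε / 4) ≤ (κ / 4) ^ logFloor c l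
  have hgood : ∀ᶠ l in atTop, good l := by
    filter_upwards [eventually_ge_atTop 1,
      eventually_mul_log_le hc (show 0 < (κ / 4) ^ 2 by positivity) one_pos,
      three_mul_rpow_le_pow_logFloor hε.1 (show 0 < κ / 4 by linarith) (by linarith)]
      with l h1 h2 h3
    rw [Real.rpow_one] at h2
    exact ⟨h1, (logFloor_le hc.le l).trans h2, h3⟩
  refine ⟨fun l => (νE l + (Real.exp (-((l : ℝ) * κ ^ 2 / 16)) +
    Real.exp (-((powFloor ε l : ℝ) * ((l : ℝ) ^ (-ε / 4)) ^ 2 / 4)))) +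
      if good l then 0 else 1,
    (hνE.add (hexp.add (negligible_exp_powFloor hε.1))).add
      (negligible_of_eventually_eq_zero ?_), fun l m => ?_⟩
  · filter_upwards [hgood] with l hl
    exact if_pos hl
  · by_cases hl : good l
    · refine le_trans ((sub_le_sub_left ?_ _).trans
        (prob_decodeDist_robust hp0 hp1 hη0 hη1 (logFloor_le_self c l)
          (Real.rpow_nonneg (Nat.cast_nonneg l) _) (rpow_neg_le_one hε.1.le hl.1) hl.2.1 hl.2.2
          hlen m)) (congrArg (fun μ => prob μ {some m}) (ldpcPRC_robust_game E m)).ge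
      beta_reduce
      rw [if_pos hl, add_zero]
      exact add_le_add_left (hbound l) _
    · refine le_trans ?_ (prob_nonneg _ _)
      have h1 := (prob_nonneg _ _).trans (hbound l)
      have h2 := Real.exp_pos (-((l : ℝ) * κ ^ 2 / 16))
      have h3 := Real.exp_pos (-((powFloor ε l : ℝ) * ((l : ℝ) ^ (-ε / 4)) ^ 2 / 4))
      beta_reduce
      rw [if_neg hl]
      linarith

end

end PRC

theorem mainTheorem2 (p η ε : ℝ) (hp : p ∈ Set.Ioo (0 : ℝ) (1 / 2))
    (hη : η ∈ Set.Ioo (0 : ℝ) (1 / 2)) (hε : ε ∈ Set.Ioo (0 : ℝ) 1) :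
    ∃ t : ℕ → ℕ,
      ((fun n : ℕ => (t n : ℝ)) =Θ[Filter.atTop] fun n : ℕ => Real.log (n : ℝ)) ∧
      (∀ n : ℕ, t n ≤ n) ∧
      ∃ S : PRC.PKCode,
        S = PRC.ldpcPRC (fun n => n) (PRC.powFloor ε) t (PRC.powFloor ε) (fun _ => η)
          (fun n => (n : ℝ) ^ (-ε / 4)) ∧
        S.ZeroBit ∧
        S.Efficient ∧
        S.Sound ∧
        (∀ E : PRC.Channel, PRC.PBounded p E → S.RobustTo E) ∧
        (PRC.LPN (PRC.powFloor ε) η → PRC.PlantedXOR (fun n => 2 * PRC.powFloor ε n) t →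
          S.Pseudorandom ∧ ∀ E : PRC.Channel, PRC.PBounded p E → S.IsPRC E) := by
  have hκ0 : 0 < (1 - 2 * η) * (1 - 2 * p) :=
    mul_pos (by linarith [hη.2]) (by linarith [hp.2])
  have hκ1 : (1 - 2 * η) * (1 - 2 * p) ≤ 1 :=
    mul_le_one₀ (by linarith [hη.1]) (by linarith [hp.2]) (by linarith [hp.1])
  have hc : 0 < ε / (8 * -Real.log ((1 - 2 * η) * (1 - 2 * p) / 4)) :=
    div_pos hε.1 (mul_pos (by norm_num) (neg_pos.2 (Real.log_neg (by linarith) (by linarith))))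
  have hg := PRC.powFloor_le hε.1 hε.2.le
  have hef := PRC.ldpcPRC_efficient (η := η) (ζ := fun n => (n : ℝ) ^ (-ε / 4)) hg
    (PRC.logFloor_le_self
      (ε / (8 * -Real.log ((1 - 2 * η) * (1 - 2 * p) / 4)))) hg
  have hsound := PRC.ldpcPRC_sound (η := η) (g := PRC.powFloor ε) hc hε
  have hrob := fun E => PRC.ldpcPRC_robust (g := PRC.powFloor ε) hp hη hε (E := E)
  -- The witness is `PRC.logFloor` with the constant of `hc`, which depends on p, η and ε only, so
  -- that one t serves all p-bounded channels.
  refine ⟨_, PRC.logFloor_isTheta hc, PRC.logFloor_le_self _, _, rfl, fun _ => rfl, hef, hsound,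
    hrob, fun hL hX => ?_⟩
  have hps := PRC.ldpcPRC_pseudorandom (ζ := fun n => (n : ℝ) ^ (-ε / 4)) hg
    (PRC.logFloor_le_self _) (fun _ => le_rfl) hL hX
  exact ⟨hps, fun E hE => ⟨hef, hrob E hE, hsound, hps⟩⟩
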